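/- Conventions. Let $X$ be a connected space with a universal covering $p\colon\tilde X\to X$, on which $\pi=\pi_1(X,x)$ acts by covering transformations, and let $A$ be a $\mathbb{Z}[\pi]$-module with action $\rho$. Let $S_*(\tilde X)$ be the singular chain complex of $\tilde X$; it is a complex of $\mathbb{Z}[\pi]$-modules. The cohomology $\mathrm{H}^n(X;A_\rho)$ of $X$ with local coefficients in $A$ is the $n$-th cohomology of the cochain complex $\mathrm{Hom}_{\mathbb{Z}[\pi]}(S_*(\tilde X),A)$. (1) The space $\mathbb{R}^3\setminus\{0\}$, with the group $\{\pm1\}$ acting by multiplication and with the projection $v\mapsto([v],\log\|v\|)$, is a universal covering of $\mathbb{R}\mathrm{P}^2\times\mathbb{R}$. For every base point, $\pi_1(\mathbb{R}\mathrm{P}^2\times\mathbb{R})$ has order two, and there is a unique homomorphism $f_*\colon\pi_1(\mathbb{R}\mathrm{P}^2\times\mathbb{R})\to\mathrm{GL}(3,\mathbb{Z})$ that sends the non-trivial element $a$ to $-I$. (2) Let $\mathbb{Z}^3_{f_*}$ be $\mathbb{Z}^3$ with the action of $\pi_1(\mathbb{R}\mathrm{P}^2\times\mathbb{R})$ through $f_*$.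 Then, whichever universal covering and base points are used, $$\mathrm{H}^2(\mathbb{R}\mathrm{P}^2\times\mathbb{R};\mathbb{Z}^3_{f_*})\cong\mathbb{Z}^3 .$$ (3) The quotient map $S^2\to\mathbb{R}\mathrm{P}^2$ is a universal covering, with group $\pi=\{1,t\}$, where $t$ is the antipodal map. Let $S^2=e^0_\pm\cup e^1_\pm\cup e^2_\pm$ be the standard cell structure, in which the closure of $e^i_+$ is $\{v\in S^2 : v_i\ge 0,\ v_j=0 \text{ for } j>i\}$ (coordinates $v_0,v_1,v_2$) and $e^i_-=t\,e^i_+$. For $i=0,1,2$ let $\mathrm{C}_i(S^2)$ be the free $\mathbb{Z}[\pi]$-module of rank one generated by $e^i_+$, with differentials $\partial_2e^2_+=(1+t)e^1_+$ and $\partial_1e^1_-=(1-t)e^0_+$. Let $\mathbb{Z}^3_{f_*}$ be $\mathbb{Z}^3$ on which the non-trivial element of $\pi_1(\mathbb{R}\mathrm{P}^2)$ acts as $-I$. Then the adjoint $$\delta_2\colon\mathrm{Hom}_{\mathbb{Z}[\pi]}(\mathrm{C}_1(S^2),\mathbb{Z}^3_{f_*})\to\mathrm{Hom}_{\mathbb{Z}[\pi]}(\mathrm{C}_2(S^2),\mathbb{Z}^3_{f_*})$$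 of $\partial_2$ vanishes, and $$\mathrm{H}^2(\mathbb{R}\mathrm{P}^2;\mathbb{Z}^3_{f_*})\cong\mathrm{Hom}_{\mathbb{Z}[\pi]}(\mathrm{C}_2(S^2),\mathbb{Z}^3_{f_*})/\mathrm{im}\,\delta_2\cong\mathbb{Z}^3 .$$ The first isomorphism is induced by a $\mathbb{Z}[\pi]$-linear chain map $\mathrm{C}_*(S^2)\to S_*(S^2)$ that sends each $e^i_+$ to a singular chain in the closure of $e^i_+$. -/

import Mathlib

noncomputable section

open Representation

/-! ### Singular chains with a group action, equivariant cochains -/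

/-- The standard topological `n`-simplex. -/
abbrev TopSimplex (n : ℕ) : Type := stdSimplex ℝ (Fin (n + 1))

/-- The inclusion of the `i`-th face (the one opposite to the vertex `i`). -/
def faceInclusion (n : ℕ) (i : Fin (n + 2)) : C(TopSimplex n, TopSimplex (n + 1)) :=
  ⟨stdSimplex.map i.succAbove, stdSimplex.continuous_map _⟩

/-- The group of singular `n`-chains: the free abelian group on the singular `n`-simplices. -/
abbrev SingularChain (E : Type*) [TopologicalSpace E] (n : ℕ) : Type _ :=
  C(TopSimplex n, E) →₀ ℤ

/-- The singular boundary `∂σ = ∑ i, (-1)^i σ ∘ (i-th face)`. -/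
def singularBoundary (E : Type*) [TopologicalSpace E] (n : ℕ) :
    SingularChain E (n + 1) →ₗ[ℤ] SingularChain E n :=
  Finsupp.linearCombination ℤ fun σ : C(TopSimplex (n + 1), E) =>
    ∑ i : Fin (n + 2), Finsupp.single (σ.comp (faceInclusion n i)) ((-1 : ℤ) ^ (i : ℕ))

section Equivariant

variable (G E : Type*) [Group G] [TopologicalSpace E] [MulAction G E] [ContinuousConstSMul G E]

/-- The `ℤ[G]`-module of singular `n`-chains of a `G`-space, with `g • σ = (g • ·) ∘ σ`. -/
def singularRep (n : ℕ) : Representation ℤ G (SingularChain E n) where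
  toFun g := Finsupp.lmapDomain ℤ ℤ fun σ : C(TopSimplex n, E) => g • σ
  map_one' := by ext; simp
  map_mul' g h := by ext; simp [mul_smul]

/-- The singular boundary as a `ℤ[G]`-linear map. -/
def equivariantBoundary (n : ℕ) :
    IntertwiningMap (singularRep G E (n + 1)) (singularRep G E n) where
  toLinearMap := singularBoundary E n
  isIntertwining' g := by
    refine Finsupp.lhom_ext' fun σ => LinearMap.ext_ring ?_
    simp [singularRep, singularBoundary, Finsupp.mapDomain_single,
      ContinuousMap.smul_comp]

end Equivariant

section Dual

variable {G V W A : Type*} [Group G] [AddCommGroup V] [AddCommGroup W] [AddCommGroup A]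
  {ρ : Representation ℤ G V} {σ : Representation ℤ G W}

/-- The adjoint `Hom_{ℤ[G]}(W, A) → Hom_{ℤ[G]}(V, A)`, `φ ↦ φ ∘ f`, of a `ℤ[G]`-linear map
`f : V → W`. -/
def adjointMap (τ : Representation ℤ G A) (f : IntertwiningMap ρ σ) :
    IntertwiningMap σ τ →+ IntertwiningMap ρ τ where
  toFun φ := φ.comp f
  map_zero' := by ext; rfl
  map_add' φ ψ := IntertwiningMap.comp_add _ _ _ _ _ _

end Dual

section EquivariantCohomology

variable {G : Type*} (E : Type*) {A : Type*} [Group G] [TopologicalSpace E] [MulAction G E]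
  [ContinuousConstSMul G E] [AddCommGroup A] (τ : Representation ℤ G A)

/-- The equivariant singular cochains `Hom_{ℤ[G]}(S_n(E), A)`. -/
abbrev EquivariantCochain (n : ℕ) : Type _ := IntertwiningMap (singularRep G E n) τ

/-- The coboundary `Hom_{ℤ[G]}(S_n(E), A) → Hom_{ℤ[G]}(S_{n+1}(E), A)`. -/
def coboundary (n : ℕ) : EquivariantCochain E τ n →+ EquivariantCochain E τ (n + 1) :=
  adjointMap τ (equivariantBoundary G E n)

/-- The equivariant cocycles of degree `n`. -/
abbrev cocycles (n : ℕ) : AddSubgroup (EquivariantCochain E τ n) := (coboundary E τ n).ker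

/-- The equivariant coboundaries of degree `n`. -/
def coboundaries : (n : ℕ) → AddSubgroup (EquivariantCochain E τ n)
  | 0 => ⊥
  | n + 1 => (coboundary E τ n).range

/-- The `n`-th cohomology group of the cochain complex `Hom_{ℤ[G]}(S_*(E), A)`. -/
abbrev EquivariantCohomology (n : ℕ) : Type _ :=
  cocycles E τ n ⧸ (coboundaries E τ n).addSubgroupOf (cocycles E τ n)

end EquivariantCohomology

/-! ### Cohomology with local coefficients -/

section Twisted

variable {E X G A : Type*} [TopologicalSpace E] [TopologicalSpace X] [Group G] [MulAction G E]
  [SimplyConnectedSpace E] [AddCommGroup A] {p : E → X} (hp : IsQuotientCoveringMap p G)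
  {x : X} (e : p ⁻¹' {x})

/-- For a universal covering `p : E → X` with group `G` of covering transformations and a point
`e` over `x`, a `π₁(X, x)`-module is a `G`-module: if `γ_g` is the class of the image of a path
from `e` to `g • e`, then `g` acts as `γ_g⁻¹`. (The product `a * b` of Mathlib's fundamental group
is the loop "first `b`, then `a`", so that `g ↦ γ_g` reverses products and `g ↦ γ_g⁻¹` is a
homomorphism.) -/
def deckRep (ρ : Representation ℤ (FundamentalGroup X x) A) : Representation ℤ G A :=
  ρ.comp ((hp.fundamentalGroupEquiv e).symm.toMonoidHom.comp (MulEquiv.inv' G).toMonoidHom)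

/-- The cohomology `H^n(X; A_ρ)` of `X` with local coefficients in the `π₁(X, x)`-module `A`:
the cohomology of `Hom_{ℤ[π₁]}(S_*(E), A)`, where `p : E → X` is a universal covering, on which
`π₁(X, x)` acts by covering transformations. -/
abbrev TwistedCohomology (ρ : Representation ℤ (FundamentalGroup X x) A) (n : ℕ) : Type _ :=
  haveI : ContinuousConstSMul G E := hp.toContinuousConstSMul
  EquivariantCohomology E (deckRep hp e ρ) n

end Twisted

/-- The action on `ℤ³` given by a homomorphism to `GL(3, ℤ)`. -/
def latticeRep {P : Type*} [Group P] (f : P →* Matrix.GeneralLinearGroup (Fin 3) ℤ) :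
    Representation ℤ P (Fin 3 → ℤ) :=
  (Matrix.toLinAlgEquiv' : Matrix (Fin 3) (Fin 3) ℤ ≃ₐ[ℤ] _).toAlgHom.toRingHom.toMonoidHom.comp
    ((Units.coeHom _).comp f)

/-! ### The spaces -/

/-- Euclidean three-space. -/
abbrev R3 : Type := EuclideanSpace ℝ (Fin 3)

/-- The real projective plane: lines through the origin of `ℝ³`. -/
abbrev RP2 : Type := Projectivization ℝ R3

/-- The quotient topology of `ℝ³ ∖ {0}`. -/
instance RP2.instTopologicalSpace : TopologicalSpace RP2 :=
  inferInstanceAs (TopologicalSpace (Quotient (projectivizationSetoid ℝ R3)))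

/-- The unit sphere of `ℝ³`. -/
abbrev S2 : Type := Metric.sphere (0 : R3) 1

/-- The group `{1, -1}` acts on the sphere, `-1` being the antipodal map. -/
instance S2.instMulAction : MulAction ℤˣ S2 where
  smul u v := ⟨u • (v : R3), by
    rcases Int.units_eq_one_or u with rfl | rfl <;> simp [Units.smul_def]⟩
  one_smul v := Subtype.ext (one_smul ℤˣ (v : R3))
  mul_smul a b v := Subtype.ext (mul_smul a b (v : R3))

instance S2.instContinuousConstSMul : ContinuousConstSMul ℤˣ S2 where
  continuous_const_smul u :=
    ((continuous_const_smul u).comp continuous_subtype_val).subtype_mk _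

/-- The covering `S² → ℝP²`. -/
def sphereCover (v : S2) : RP2 :=
  Projectivization.mk ℝ (v : R3) (ne_zero_of_mem_unit_sphere v)

/-- `ℝ³ ∖ {0}`, on which the group `{1, -1}` acts by multiplication. -/
abbrev PuncturedR3 : Type := {v : R3 // v ≠ 0}

/-- The covering `ℝ³ ∖ {0} → ℝP² × ℝ`. -/
def puncturedCover (v : PuncturedR3) : RP2 × ℝ :=
  (Projectivization.mk ℝ (v : R3) v.2, Real.log ‖(v : R3)‖)

/-! ### The cellular chain complex of the two-sphere

The sphere has the cells `e^i_+` and `e^i_- = t e^i_+` for `i = 0, 1, 2`, where `t` is the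
antipodal map. Each `C_i(S²)` is `ℤ[{1, t}]`, where `1` stands for `e^i_+` and `t` for `e^i_-`. -/

/-- The closure of the cell `e^i_+`. -/
def closedCell (i : Fin 3) : Set S2 :=
  {v | 0 ≤ (v : R3) i ∧ ∀ j, i < j → (v : R3) j = 0}

/-- The module `C_i(S²)`, free of rank one over the group ring. -/
abbrev cellRep : Representation ℤ ℤˣ (MonoidAlgebra ℤ ℤˣ) := leftRegular ℤ ℤˣ

/-- The generator `e^i_+` of `C_i(S²)`. -/
abbrev cellGen : MonoidAlgebra ℤ ℤˣ := 1

/-- The antipodal map `t` as an element of the group ring. -/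
abbrev cellT : MonoidAlgebra ℤ ℤˣ := MonoidAlgebra.single (-1) 1

/-- Multiplication by an element of the group ring. -/
def cellMul (c : MonoidAlgebra ℤ ℤˣ) : IntertwiningMap cellRep cellRep where
  toLinearMap := LinearMap.mulRight ℤ c
  isIntertwining' g := by
    ext h
    simp [← asAlgebraHom_single_one, -asAlgebraHom_single, mul_assoc]

/-- `∂₂ e²_+ = (1 + t) e¹_+`. -/
def cellBoundary₂ : IntertwiningMap cellRep cellRep := cellMul (1 + cellT)

/-- `∂₁ e¹_- = (1 - t) e⁰_+`, that is, `∂₁ e¹_+ = (t - 1) e⁰_+`. -/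
def cellBoundary₁ : IntertwiningMap cellRep cellRep := cellMul (cellT - 1)

/-- The cellular coboundary `δ₂ : Hom(C₁(S²), A) → Hom(C₂(S²), A)`. -/
def cellDelta₂ {A : Type*} [AddCommGroup A] (τ : Representation ℤ ℤˣ A) :
    IntertwiningMap cellRep τ →+ IntertwiningMap cellRep τ :=
  adjointMap τ cellBoundary₂

/-- A `ℤ[{1, t}]`-linear chain map from the cellular complex `C_*(S²)` to the singular complex
`S_*(S²)` that sends each cell to a chain of simplices inside its closure. -/
structure CellChainMap where
  toSing₀ : IntertwiningMap cellRep (singularRep ℤˣ S2 0)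
  toSing₁ : IntertwiningMap cellRep (singularRep ℤˣ S2 1)
  toSing₂ : IntertwiningMap cellRep (singularRep ℤˣ S2 2)
  comm₁ : (equivariantBoundary ℤˣ S2 0).comp toSing₁ = toSing₀.comp cellBoundary₁
  comm₂ : (equivariantBoundary ℤˣ S2 1).comp toSing₂ = toSing₁.comp cellBoundary₂
  carried₀ : toSing₀ cellGen ∈ Finsupp.supported ℤ ℤ {σ | ∀ y, σ y ∈ closedCell 0}
  carried₁ : toSing₁ cellGen ∈ Finsupp.supported ℤ ℤ {σ | ∀ y, σ y ∈ closedCell 1}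
  carried₂ : toSing₂ cellGen ∈ Finsupp.supported ℤ ℤ {σ | ∀ y, σ y ∈ closedCell 2}

end

noncomputable section

open Representation

/-! ### Alternating sums of faces -/

/-! Both base spaces are quotients by `{1, -1}` of a simply connected space with the homology of the
two-sphere, and the non-trivial deck transformation `t` acts on the coefficients by `-1`. Evaluation
of a degree-two cocycle on the cell `e²₊` gives the isomorphism with `ℤ³`. It kills coboundaries
because `∂e²₊ = (1 + t)e¹₊` and `1 + t` acts on the coefficients as `0`; the same computation gives
`δ₂ = 0`.

That evaluation is injective on cohomology and surjective follows from comparing the singular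
complex with the complex `C₂ → C₁ → C₀` of free `ℤ[π]`-modules. `CellularModel` collects what the
comparison needs: an equivariant chain map that is a homology isomorphism through degree two, where
the fundamental cycle is `(1 - t)e²₊`, none of whose non-zero multiples bounds. Since the action is
free, a homotopy inverse can be chosen on one simplex per orbit (`exists_intertwiningMap`,
`exists_retraction₁`, `exists_retraction₂`). The outcome is `mem_coboundaries_iff` and
`exists_cocycle`.

The homology of `ℝ³ ∖ {0}` comes from a Mayer–Vietoris argument made by hand. Removing the lower or
the upper half of the vertical axis leaves a set that is star convex about a pole, hence acyclic by
coning. The intersection is the complement of the axis; its universal covering is the contractible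
space `ℂ × ℝ` through the exponential, so its first homology is generated by the equator and
detected by the change of angle. Iterated barycentric subdivision (`exists_homotopy_mem_sup`) splits
chains between the two sets. The sphere inherits everything as a radial retract.

The same two sets give simple connectivity by a van Kampen argument. An arbitrary universal covering
of `ℝP² × ℝ` is homeomorphic to the standard one over the base (`IsCoveringMap.exists_homeomorph`),
and on both sides each non-trivial group element acts on the coefficients by `-1`, so the
computation carries over (`CellularModel.nonempty_equiv`). -/

/-- The index pairs `(i, j)` and `(i.succAbove j, j.predAbove i)` name the same face of codimension
two with opposite signs, and passing from one to the other is a fixed-point free involution. This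
one cancellation gives `∂∂ = 0` for singular and for ordered chains. -/
theorem sum_alternating_eq_zero {M : Type*} [AddCommGroup M] {n : ℕ}
    (f : Fin (n + 3) → Fin (n + 2) → M)
    (hf : ∀ i j, f (i.succAbove j) (j.predAbove i) = f i j) :
    ∑ i : Fin (n + 3), ∑ j : Fin (n + 2), (-1 : ℤ) ^ ((i : ℕ) + (j : ℕ)) • f i j = 0 := by
  rw [← Fintype.sum_prod_type' (f := fun (i : Fin (n + 3)) (j : Fin (n + 2)) =>
    (-1 : ℤ) ^ ((i : ℕ) + (j : ℕ)) • f i j)]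
  refine Finset.sum_involution (fun p _ => (p.1.succAbove p.2, p.2.predAbove p.1)) ?_ ?_ ?_ ?_
  · rintro ⟨i, j⟩ -
    simp only [hf, Fin.neg_one_pow_succAbove_add_predAbove]
    simp
  · rintro ⟨i, j⟩ - - h
    exact Fin.succAbove_ne i j (congrArg Prod.fst h)
  · simp
  · rintro ⟨i, j⟩ -
    simp [Fin.succAbove_succAbove_predAbove, Fin.predAbove_predAbove_succAbove]

theorem map_mem_of_supported {α M : Type*} [AddCommGroup M] {s : Set α} (f : (α →₀ ℤ) →ₗ[ℤ] M)
    (N : Submodule ℤ M) (h : ∀ a ∈ s, f (Finsupp.single a 1) ∈ N) {z : α →₀ ℤ}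
    (hz : z ∈ Finsupp.supported ℤ ℤ s) : f z ∈ N := by
  rw [Finsupp.supported_eq_span_single] at hz
  induction hz using Submodule.span_induction with
  | mem x hx => obtain ⟨a, ha, rfl⟩ := hx; exact h a ha
  | zero => simp
  | add x y _ _ hx hy => rw [map_add]; exact N.add_mem hx hy
  | smul a x _ hx => rw [map_smul]; exact N.smul_mem a hx

section Chains

variable {E F K : Type*} [TopologicalSpace E] [TopologicalSpace F] [TopologicalSpace K]

/-- The chain map induced by a continuous map. -/
def chainMap (f : C(E, F)) (n : ℕ) : SingularChain E n →ₗ[ℤ] SingularChain F n :=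
  Finsupp.lmapDomain ℤ ℤ fun σ => f.comp σ

@[simp]
theorem chainMap_single (f : C(E, F)) (n : ℕ) (σ : C(TopSimplex n, E)) (a : ℤ) :
    chainMap f n (Finsupp.single σ a) = Finsupp.single (f.comp σ) a := by
  simp [chainMap, Finsupp.mapDomain_single]

@[simp]
theorem singularBoundary_single (n : ℕ) (σ : C(TopSimplex (n + 1), E)) :
    singularBoundary E n (Finsupp.single σ 1) =
      ∑ i : Fin (n + 2), Finsupp.single (σ.comp (faceInclusion n i)) ((-1 : ℤ) ^ (i : ℕ)) := by
  simp [singularBoundary]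

theorem chainMap_boundary (f : C(E, F)) (n : ℕ) (z : SingularChain E (n + 1)) :
    singularBoundary F n (chainMap f (n + 1) z) = chainMap f n (singularBoundary E n z) := by
  have : (singularBoundary F n) ∘ₗ chainMap f (n + 1) = chainMap f n ∘ₗ singularBoundary E n := by
    refine Finsupp.lhom_ext' fun σ => LinearMap.ext_ring ?_
    simp [ContinuousMap.comp_assoc]
  exact LinearMap.congr_fun this z

theorem chainMap_comp (g : C(F, K)) (f : C(E, F)) (n : ℕ) (z : SingularChain E n) :
    chainMap g n (chainMap f n z) = chainMap (g.comp f) n z := by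
  have : chainMap g n ∘ₗ chainMap f n = chainMap (g.comp f) n := by
    refine Finsupp.lhom_ext' fun σ => LinearMap.ext_ring ?_
    simp [ContinuousMap.comp_assoc]
  exact LinearMap.congr_fun this z

@[simp]
theorem chainMap_id (n : ℕ) (z : SingularChain E n) :
    chainMap (ContinuousMap.id E) n z = z := by
  have : chainMap (ContinuousMap.id E) n = LinearMap.id := by
    refine Finsupp.lhom_ext' fun σ => LinearMap.ext_ring ?_
    simp
  exact LinearMap.congr_fun this z

theorem chainMap_injective {f : C(E, F)} (hf : Function.Injective f) (n : ℕ) :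
    Function.Injective (chainMap f n) :=
  Finsupp.mapDomain_injective fun _ _ h => ContinuousMap.ext fun y =>
    hf (congrArg (fun g : C(TopSimplex n, F) => g y) h)

/-- The simplicial identity in the form required by `sum_alternating_eq_zero`, without a case
distinction on the order of the indices. -/
theorem faceInclusion_comp (n : ℕ) (i : Fin (n + 3)) (j : Fin (n + 2)) :
    (faceInclusion (n + 1) (i.succAbove j)).comp (faceInclusion n (j.predAbove i)) =
      (faceInclusion (n + 1) i).comp (faceInclusion n j) := by
  ext1 y
  simp only [faceInclusion, ContinuousMap.comp_apply, ContinuousMap.coe_mk,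
    stdSimplex.map_comp_apply]
  congr 1
  funext k
  simp [Fin.succAbove_succAbove_succAbove_predAbove]

@[simp]
theorem singularBoundary_singularBoundary (n : ℕ) (z : SingularChain E (n + 2)) :
    singularBoundary E n (singularBoundary E (n + 1) z) = 0 := by
  have : singularBoundary E n ∘ₗ singularBoundary E (n + 1) = 0 := by
    refine Finsupp.lhom_ext' fun σ => LinearMap.ext_ring ?_
    have key (τ : C(TopSimplex (n + 1), E)) (a : ℤ) :
        singularBoundary E n (Finsupp.single τ a) = a • ∑ j : Fin (n + 2),
          Finsupp.single (τ.comp (faceInclusion n j)) ((-1 : ℤ) ^ (j : ℕ)) := by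
      simp [singularBoundary]
    simp only [LinearMap.comp_apply, Finsupp.lsingle_apply, singularBoundary_single, map_sum, key,
      Finset.smul_sum, LinearMap.zero_apply]
    rw [← sum_alternating_eq_zero (fun i j => Finsupp.single
      ((σ.comp (faceInclusion (n + 1) i)).comp (faceInclusion n j)) (1 : ℤ))
      fun i j => by simp only [ContinuousMap.comp_assoc, faceInclusion_comp]]
    simp [pow_add]
  exact LinearMap.congr_fun this z

/-- The augmentation, the sum of the coefficients. -/
def augmentation (E : Type*) [TopologicalSpace E] (n : ℕ) : SingularChain E n →ₗ[ℤ] ℤ :=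
  Finsupp.linearCombination ℤ fun _ => (1 : ℤ)

@[simp]
theorem augmentation_single (n : ℕ) (σ : C(TopSimplex n, E)) (a : ℤ) :
    augmentation E n (Finsupp.single σ a) = a := by
  simp [augmentation]

@[simp]
theorem augmentation_boundary (z : SingularChain E 1) :
    augmentation E 0 (singularBoundary E 0 z) = 0 := by
  have : augmentation E 0 ∘ₗ singularBoundary E 0 = 0 := by
    refine Finsupp.lhom_ext' fun σ => LinearMap.ext_ring ?_
    simp [Fin.sum_univ_two]
  exact LinearMap.congr_fun this z

@[simp]
theorem augmentation_chainMap (f : C(E, F)) (n : ℕ) (z : SingularChain E n) :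
    augmentation F n (chainMap f n z) = augmentation E n z := by
  have : augmentation F n ∘ₗ chainMap f n = augmentation E n := by
    refine Finsupp.lhom_ext' fun σ => LinearMap.ext_ring ?_
    simp
  exact LinearMap.congr_fun this z

/-- The chains all of whose simplices have their image in `X`. -/
def chainsIn (X : Set E) (n : ℕ) : Submodule ℤ (SingularChain E n) :=
  Finsupp.supported ℤ ℤ {σ | ∀ y, σ y ∈ X}

theorem single_mem_chainsIn {X : Set E} {n : ℕ} {σ : C(TopSimplex n, E)} (h : ∀ y, σ y ∈ X)
    (a : ℤ) : Finsupp.single σ a ∈ chainsIn X n :=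
  Finsupp.single_mem_supported ℤ a h

/-- A linear map sends `chainsIn X n` into a submodule as soon as it does so on simplices. -/
theorem map_mem_of_chainsIn {X : Set E} {n : ℕ} {M : Type*} [AddCommGroup M]
    (f : SingularChain E n →ₗ[ℤ] M) (N : Submodule ℤ M)
    (h : ∀ σ : C(TopSimplex n, E), (∀ y, σ y ∈ X) → f (Finsupp.single σ 1) ∈ N)
    {z : SingularChain E n} (hz : z ∈ chainsIn X n) : f z ∈ N :=
  map_mem_of_supported f N h hz

theorem boundary_mem_chainsIn {X : Set E} {n : ℕ} {z : SingularChain E (n + 1)}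
    (hz : z ∈ chainsIn X (n + 1)) : singularBoundary E n z ∈ chainsIn X n :=
  map_mem_of_chainsIn _ _ (fun σ hσ => by
    rw [singularBoundary_single]
    exact Submodule.sum_mem _ fun i _ =>
      single_mem_chainsIn (fun y => by exact hσ (faceInclusion n i y)) _) hz

theorem chainMap_mem_chainsIn {X : Set E} {Y : Set F} {f : C(E, F)} (h : ∀ x ∈ X, f x ∈ Y)
    {n : ℕ} {z : SingularChain E n} (hz : z ∈ chainsIn X n) : chainMap f n z ∈ chainsIn Y n :=
  map_mem_of_chainsIn _ _ (fun σ hσ => by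
    rw [chainMap_single]
    exact single_mem_chainsIn (fun y => h _ (hσ y)) _) hz

theorem chainsIn_mono {X Y : Set E} (h : X ⊆ Y) (n : ℕ) : chainsIn X n ≤ chainsIn Y n :=
  Finsupp.supported_mono fun _ hσ y => h (hσ y)

theorem mem_chainsIn_inter {X Y : Set E} {n : ℕ} {z : SingularChain E n}
    (hX : z ∈ chainsIn X n) (hY : z ∈ chainsIn Y n) : z ∈ chainsIn (X ∩ Y) n :=
  fun _ hσ y => ⟨hX hσ y, hY hσ y⟩

@[simp]
theorem chainsIn_univ (n : ℕ) : chainsIn (Set.univ : Set E) n = ⊤ := by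
  simp [chainsIn]

/-- Chains with simplices in the image of a lift of simplices are images of chains. -/
theorem exists_chainMap_eq {X : Set F} {n : ℕ} {f : C(E, F)}
    (h : ∀ σ : C(TopSimplex n, F), (∀ y, σ y ∈ X) → ∃ τ : C(TopSimplex n, E), f.comp τ = σ)
    {z : SingularChain F n} (hz : z ∈ chainsIn X n) : ∃ z', chainMap f n z' = z :=
  map_mem_of_chainsIn LinearMap.id (LinearMap.range (chainMap f n)) (fun σ hσ => by
    obtain ⟨τ, rfl⟩ := h σ hσ
    exact ⟨Finsupp.single τ 1, by simp⟩) hz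

end Chains

/-! ### Chains of tuples of points and their cones -/

/-- The ordered chains of a set: the free abelian group on the tuples of points. -/
abbrev TupleChain (Y : Type*) (n : ℕ) : Type _ := (Fin (n + 1) → Y) →₀ ℤ

section Tuples

variable {Y Z : Type*}

/-- The boundary of ordered chains. -/
def tupleBoundary (Y : Type*) (n : ℕ) : TupleChain Y (n + 1) →ₗ[ℤ] TupleChain Y n :=
  Finsupp.linearCombination ℤ fun v : Fin (n + 2) → Y =>
    ∑ i : Fin (n + 2), Finsupp.single (v ∘ i.succAbove) ((-1 : ℤ) ^ (i : ℕ))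

/-- The chain map of ordered chains induced by a map. -/
def tupleMap (f : Y → Z) (n : ℕ) : TupleChain Y n →ₗ[ℤ] TupleChain Z n :=
  Finsupp.lmapDomain ℤ ℤ fun v => f ∘ v

/-- The cone over ordered chains. -/
def tupleCone (y : Y) (n : ℕ) : TupleChain Y n →ₗ[ℤ] TupleChain Y (n + 1) :=
  Finsupp.lmapDomain ℤ ℤ fun v => Fin.cons (α := fun _ => Y) y v

@[simp]
theorem tupleMap_single (f : Y → Z) (n : ℕ) (v : Fin (n + 1) → Y) (a : ℤ) :
    tupleMap f n (Finsupp.single v a) = Finsupp.single (f ∘ v) a := by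
  simp [tupleMap, Finsupp.mapDomain_single]

@[simp]
theorem tupleCone_single (y : Y) (n : ℕ) (v : Fin (n + 1) → Y) (a : ℤ) :
    tupleCone y n (Finsupp.single v a) =
      Finsupp.single (Fin.cons (α := fun _ => Y) y v : Fin (n + 2) → Y) a := by
  simp [tupleCone, Finsupp.mapDomain_single]

theorem tupleBoundary_single (n : ℕ) (v : Fin (n + 2) → Y) (a : ℤ) :
    tupleBoundary Y n (Finsupp.single v a) =
      a • ∑ i : Fin (n + 2), Finsupp.single (v ∘ i.succAbove) ((-1 : ℤ) ^ (i : ℕ)) := by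
  simp [tupleBoundary]

theorem tupleMap_boundary (f : Y → Z) (n : ℕ) (c : TupleChain Y (n + 1)) :
    tupleMap f n (tupleBoundary Y n c) = tupleBoundary Z n (tupleMap f (n + 1) c) := by
  have : tupleMap f n ∘ₗ tupleBoundary Y n = tupleBoundary Z n ∘ₗ tupleMap f (n + 1) := by
    refine Finsupp.lhom_ext' fun v => LinearMap.ext_ring ?_
    simp [tupleBoundary_single, Function.comp_assoc]
  exact LinearMap.congr_fun this c

theorem tupleMap_cone (f : Y → Z) (y : Y) (n : ℕ) (c : TupleChain Y n) :
    tupleMap f (n + 1) (tupleCone y n c) = tupleCone (f y) n (tupleMap f n c) := by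
  have : tupleMap f (n + 1) ∘ₗ tupleCone y n = tupleCone (f y) n ∘ₗ tupleMap f n := by
    refine Finsupp.lhom_ext' fun v => LinearMap.ext_ring ?_
    simp only [LinearMap.comp_apply, Finsupp.lsingle_apply, tupleCone_single, tupleMap_single]
    congr 1
    funext i
    refine Fin.cases ?_ (fun j => ?_) i <;> simp
  exact LinearMap.congr_fun this c

theorem cons_comp_succAbove_zero (y : Y) {n : ℕ} (v : Fin (n + 1) → Y) :
    (Fin.cons (α := fun _ => Y) y v : Fin (n + 2) → Y) ∘ (0 : Fin (n + 2)).succAbove = v := by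
  funext j; simp

theorem cons_comp_succAbove_succ (y : Y) {n : ℕ} (v : Fin (n + 2) → Y) (i : Fin (n + 2)) :
    (Fin.cons (α := fun _ => Y) y v : Fin (n + 3) → Y) ∘ i.succ.succAbove =
      Fin.cons (α := fun _ => Y) y (v ∘ i.succAbove) := by
  funext j
  refine Fin.cases ?_ (fun k => ?_) j <;> simp

/-- Face `0` of a cone is its base, and face `i + 1` is the cone over face `i`; the index shift
produces the minus sign. -/
theorem tupleBoundary_cone (y : Y) (n : ℕ) (c : TupleChain Y (n + 1)) :
    tupleBoundary Y (n + 1) (tupleCone y (n + 1) c) = c - tupleCone y n (tupleBoundary Y n c) := by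
  have : tupleBoundary Y (n + 1) ∘ₗ tupleCone y (n + 1) =
      LinearMap.id - tupleCone y n ∘ₗ tupleBoundary Y n := by
    refine Finsupp.lhom_ext' fun v => LinearMap.ext_ring ?_
    simp only [LinearMap.comp_apply, LinearMap.sub_apply, LinearMap.id_apply,
      Finsupp.lsingle_apply, tupleCone_single, tupleBoundary_single, one_smul, map_sum]
    rw [Fin.sum_univ_succ, cons_comp_succAbove_zero, sub_eq_add_neg, ← Finset.sum_neg_distrib]
    refine congrArg₂ (· + ·) (by simp) ?_
    · refine Finset.sum_congr rfl fun i _ => ?_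
      rw [cons_comp_succAbove_succ, ← Finsupp.single_neg]
      simp [pow_succ]
  exact LinearMap.congr_fun this c

theorem tupleBoundary_boundary (n : ℕ) (c : TupleChain Y (n + 2)) :
    tupleBoundary Y n (tupleBoundary Y (n + 1) c) = 0 := by
  have : tupleBoundary Y n ∘ₗ tupleBoundary Y (n + 1) = 0 := by
    refine Finsupp.lhom_ext' fun v => LinearMap.ext_ring ?_
    simp only [LinearMap.comp_apply, Finsupp.lsingle_apply, map_sum, tupleBoundary_single, one_smul,
      Finset.smul_sum, LinearMap.zero_apply]
    rw [← sum_alternating_eq_zero (fun i j => Finsupp.single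
      ((v ∘ i.succAbove) ∘ j.succAbove) (1 : ℤ)) fun i j => by
        congr 1
        funext k
        simp [Fin.succAbove_succAbove_succAbove_predAbove]]
    simp [pow_add]
  exact LinearMap.congr_fun this c

end Tuples

/-! ### Affine simplices in a standard simplex -/

section Affine

variable {m m' n : ℕ}

/-- The affine simplex with given vertices. -/
def affineSimplex (w : Fin (n + 1) → TopSimplex m) : C(TopSimplex n, TopSimplex m) where
  toFun t := ⟨∑ i, t i • (w i : Fin (m + 1) → ℝ),
    (convex_stdSimplex ℝ _).sum_mem (fun i _ => t.2.1 i) t.2.2 fun i _ => (w i).2⟩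
  continuous_toFun := by
    refine Continuous.subtype_mk (continuous_finsetSum _ fun i _ => ?_) _
    exact ((continuous_apply i).comp continuous_subtype_val).smul continuous_const

theorem affineSimplex_apply (w : Fin (n + 1) → TopSimplex m) (t : TopSimplex n) :
    (affineSimplex w t : Fin (m + 1) → ℝ) = ∑ i, t i • (w i : Fin (m + 1) → ℝ) := rfl

theorem affineSimplex_affineSimplex (u : Fin (m + 1) → TopSimplex m')
    (w : Fin (n + 1) → TopSimplex m) (t : TopSimplex n) :
    affineSimplex u (affineSimplex w t) = affineSimplex (affineSimplex u ∘ w) t := by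
  apply stdSimplex.ext
  simp only [affineSimplex_apply, Function.comp_apply, Finset.smul_sum]
  rw [Finset.sum_comm]
  refine Finset.sum_congr rfl fun i _ => ?_
  simp only [Finset.sum_apply, Pi.smul_apply, smul_eq_mul, Finset.sum_smul]
  exact Finset.sum_congr rfl fun j _ => mul_smul _ _ _

theorem affineSimplex_comp (u : Fin (m + 1) → TopSimplex m') (w : Fin (n + 1) → TopSimplex m) :
    (affineSimplex u).comp (affineSimplex w) = affineSimplex (affineSimplex u ∘ w) :=
  ContinuousMap.ext fun t => affineSimplex_affineSimplex u w t

/-- The vertices of the standard simplex. -/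
def simplexVertices (n : ℕ) : Fin (n + 1) → TopSimplex n := fun i => stdSimplex.vertex i

theorem affineSimplex_vertices : affineSimplex (simplexVertices n) = ContinuousMap.id _ := by
  ext1 t
  apply stdSimplex.ext
  rw [affineSimplex_apply]
  funext j
  simp [simplexVertices, Pi.single_apply]

theorem affineSimplex_vertex (w : Fin (n + 1) → TopSimplex m) (i : Fin (n + 1)) :
    affineSimplex w (simplexVertices n i) = w i := by
  apply stdSimplex.ext
  rw [affineSimplex_apply]
  have (j : Fin (n + 1)) : (simplexVertices n i) j = if j = i then 1 else 0 := by
    simp only [simplexVertices, stdSimplex.vertex_coe, Pi.single_apply]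
  simp [this]

theorem affineSimplex_comp_vertices (w : Fin (n + 1) → TopSimplex m) :
    affineSimplex w ∘ simplexVertices n = w :=
  funext fun i => affineSimplex_vertex w i

theorem faceInclusion_apply_self (i : Fin (n + 2)) (t : TopSimplex n) :
    (faceInclusion n i t) i = 0 := by
  simp only [faceInclusion, ContinuousMap.coe_mk, stdSimplex.map_coe,
    FunOnFinite.linearMap_apply_apply]
  exact Finset.sum_eq_zero fun k hk => by simp [Fin.succAbove_ne] at hk

theorem faceInclusion_apply_succAbove (i : Fin (n + 2)) (t : TopSimplex n) (j : Fin (n + 1)) :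
    (faceInclusion n i t) (i.succAbove j) = t j := by
  simp only [faceInclusion, ContinuousMap.coe_mk, stdSimplex.map_coe,
    FunOnFinite.linearMap_apply_apply]
  rw [Finset.sum_eq_single j] <;> simp

theorem faceInclusion_apply_sum {M : Type*} [AddCommGroup M] [Module ℝ M] (i : Fin (n + 2))
    (t : TopSimplex n) (f : Fin (n + 2) → M) :
    ∑ j, (faceInclusion n i t) j • f j = ∑ j, t j • f (i.succAbove j) := by
  rw [Fin.sum_univ_succAbove _ i, faceInclusion_apply_self, zero_smul, zero_add]
  simp only [faceInclusion_apply_succAbove]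

theorem affineSimplex_face (w : Fin (n + 2) → TopSimplex m) (i : Fin (n + 2)) :
    (affineSimplex w).comp (faceInclusion n i) = affineSimplex (w ∘ i.succAbove) := by
  ext1 t
  apply stdSimplex.ext
  exact faceInclusion_apply_sum i t fun j => (w j : Fin (m + 1) → ℝ)

/-- The singular chain made of the affine simplices with given vertices. -/
def realize (m n : ℕ) : TupleChain (TopSimplex m) n →ₗ[ℤ] SingularChain (TopSimplex m) n :=
  Finsupp.lmapDomain ℤ ℤ fun w => affineSimplex w

@[simp]
theorem realize_single (w : Fin (n + 1) → TopSimplex m) (a : ℤ) :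
    realize m n (Finsupp.single w a) = Finsupp.single (affineSimplex w) a := by
  simp [realize, Finsupp.mapDomain_single]

theorem realize_boundary (c : TupleChain (TopSimplex m) (n + 1)) :
    singularBoundary _ n (realize m (n + 1) c) = realize m n (tupleBoundary _ n c) := by
  have : singularBoundary _ n ∘ₗ realize m (n + 1) = realize m n ∘ₗ tupleBoundary _ n := by
    refine Finsupp.lhom_ext' fun v => LinearMap.ext_ring ?_
    simp [tupleBoundary_single, affineSimplex_face]
  exact LinearMap.congr_fun this c

theorem chainMap_realize (u : Fin (m + 1) → TopSimplex m') (c : TupleChain (TopSimplex m) n) :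
    chainMap (affineSimplex u) n (realize m n c) = realize m' n (tupleMap (affineSimplex u) n c) := by
  have : chainMap (affineSimplex u) n ∘ₗ realize m n =
      realize m' n ∘ₗ tupleMap (affineSimplex u) n := by
    refine Finsupp.lhom_ext' fun v => LinearMap.ext_ring ?_
    simp [affineSimplex_comp]
  exact LinearMap.congr_fun this c

end Affine

/-! ### Natural subdivision operators -/

/-- A natural operator on the ordered chains of the standard simplices, together with a natural
chain homotopy to the identity. -/
structure ChainSubdivision where
  D (m n : ℕ) : TupleChain (TopSimplex m) n →ₗ[ℤ] TupleChain (TopSimplex m) n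
  T (m n : ℕ) : TupleChain (TopSimplex m) n →ₗ[ℤ] TupleChain (TopSimplex m) (n + 1)
  natural_D {m m' n : ℕ} (u : Fin (m + 1) → TopSimplex m') (c : TupleChain (TopSimplex m) n) :
    tupleMap (affineSimplex u) n (D m n c) = D m' n (tupleMap (affineSimplex u) n c)
  natural_T {m m' n : ℕ} (u : Fin (m + 1) → TopSimplex m') (c : TupleChain (TopSimplex m) n) :
    tupleMap (affineSimplex u) (n + 1) (T m n c) = T m' n (tupleMap (affineSimplex u) n c)
  homotopy_zero {m : ℕ} (c : TupleChain (TopSimplex m) 0) :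
    tupleBoundary _ 0 (T m 0 c) = c - D m 0 c
  homotopy_succ {m n : ℕ} (c : TupleChain (TopSimplex m) (n + 1)) :
    tupleBoundary _ (n + 1) (T m (n + 1) c) + T m n (tupleBoundary _ n c) = c - D m (n + 1) c

namespace ChainSubdivision

variable {m n : ℕ}

/-- Compatibility with the boundary is forced by the homotopy: apply `∂` to the homotopy formula and
compare with the formula for the boundary, one degree lower. -/
theorem boundary_D (S : ChainSubdivision) (c : TupleChain (TopSimplex m) (n + 1)) :
    tupleBoundary _ n (S.D m (n + 1) c) = S.D m n (tupleBoundary _ n c) := by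
  have h := congrArg (tupleBoundary _ n) (S.homotopy_succ c)
  rw [map_add, tupleBoundary_boundary, zero_add, map_sub] at h
  cases n with
  | zero =>
    rw [S.homotopy_zero] at h
    exact (sub_right_inj.mp h).symm
  | succ n =>
    have h' := S.homotopy_succ (tupleBoundary _ (n + 1) c)
    rw [tupleBoundary_boundary, map_zero, add_zero, h] at h'
    exact sub_right_inj.mp h'

/-- The trivial subdivision. -/
def refl : ChainSubdivision where
  D _ _ := LinearMap.id
  T _ _ := 0
  natural_D _ _ := rfl
  natural_T _ _ := by simp
  homotopy_zero _ := by simp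
  homotopy_succ _ := by simp

/-- The composition of two subdivisions. -/
def comp (S' S : ChainSubdivision) : ChainSubdivision where
  D m n := S'.D m n ∘ₗ S.D m n
  T m n := S.T m n + S'.T m n ∘ₗ S.D m n
  natural_D u c := by simp [S.natural_D, S'.natural_D]
  natural_T u c := by simp [S.natural_D, S.natural_T, S'.natural_T]
  homotopy_zero c := by simp [S.homotopy_zero, S'.homotopy_zero]
  homotopy_succ c := by
    have h := S.homotopy_succ c
    have h' := S'.homotopy_succ (S.D _ _ c)
    rw [S.boundary_D] at h'
    simp only [LinearMap.add_apply, LinearMap.comp_apply, map_add]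
    calc _ = (tupleBoundary _ _ (S.T _ _ c) + S.T _ _ (tupleBoundary _ _ c)) +
        (tupleBoundary _ _ (S'.T _ _ (S.D _ _ c)) + S'.T _ _ (S.D _ _ (tupleBoundary _ _ c))) := by
          abel
      _ = _ := by rw [h, h']; abel

/-- Iterated subdivision. -/
def iterate (S : ChainSubdivision) : ℕ → ChainSubdivision
  | 0 => refl
  | k + 1 => S.comp (S.iterate k)

end ChainSubdivision

/-! ### The induced operators on singular chains -/

section Transfer

variable {E : Type*} [TopologicalSpace E] {k : ℕ}

/-- The operator on singular chains induced by an operator on ordered chains. -/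
def inducedOperator (E : Type*) [TopologicalSpace E] (n : ℕ) {k : ℕ}
    (F : TupleChain (TopSimplex n) n →ₗ[ℤ] TupleChain (TopSimplex n) k) :
    SingularChain E n →ₗ[ℤ] SingularChain E k :=
  Finsupp.linearCombination ℤ fun σ : C(TopSimplex n, E) =>
    chainMap σ k (realize n k (F (Finsupp.single (simplexVertices n) 1)))

@[simp]
theorem inducedOperator_single (n : ℕ)
    (F : TupleChain (TopSimplex n) n →ₗ[ℤ] TupleChain (TopSimplex n) k)
    (σ : C(TopSimplex n, E)) :
    inducedOperator E n F (Finsupp.single σ 1) =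
      chainMap σ k (realize n k (F (Finsupp.single (simplexVertices n) 1))) := by
  simp [inducedOperator]

theorem inducedOperator_mem_chainsIn {X : Set E} {n : ℕ}
    (F : TupleChain (TopSimplex n) n →ₗ[ℤ] TupleChain (TopSimplex n) k)
    {z : SingularChain E n} (hz : z ∈ chainsIn X n) : inducedOperator E n F z ∈ chainsIn X k :=
  map_mem_of_chainsIn _ _ (fun σ hσ => by
    rw [inducedOperator_single]
    exact chainMap_mem_chainsIn (X := Set.univ) (fun x _ => hσ x) (by simp)) hz

/-- An affine simplex is the image of the standard one under an affine map, so naturality of `F`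
identifies the two sides. This carries identities from ordered chains over to singular chains. -/
theorem inducedOperator_chainMap_realize {m n : ℕ}
    (F : ∀ m, TupleChain (TopSimplex m) n →ₗ[ℤ] TupleChain (TopSimplex m) k)
    (hF : ∀ (u : Fin (n + 1) → TopSimplex m) (c : TupleChain (TopSimplex n) n),
      tupleMap (affineSimplex u) k (F n c) = F m (tupleMap (affineSimplex u) n c))
    (τ : C(TopSimplex m, E)) (c : TupleChain (TopSimplex m) n) :
    inducedOperator E n (F n) (chainMap τ n (realize m n c)) =
      chainMap τ k (realize m k (F m c)) := by
  have : inducedOperator E n (F n) ∘ₗ chainMap τ n ∘ₗ realize m n =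
      chainMap τ k ∘ₗ realize m k ∘ₗ F m := by
    refine Finsupp.lhom_ext' fun w => LinearMap.ext_ring ?_
    simp only [LinearMap.comp_apply, Finsupp.lsingle_apply, realize_single, chainMap_single,
      inducedOperator_single]
    rw [← chainMap_comp, chainMap_realize, hF, tupleMap_single, affineSimplex_comp_vertices]
  exact LinearMap.congr_fun this c

/-- The universal example: every singular simplex is the image of the identity simplex. -/
theorem single_eq_chainMap_realize (n : ℕ) (σ : C(TopSimplex n, E)) :
    Finsupp.single σ (1 : ℤ) =
      chainMap σ n (realize n n (Finsupp.single (simplexVertices n) 1)) := by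
  simp [affineSimplex_vertices]

/-- By naturality it suffices to treat the identity simplex, where the formula is the homotopy for
ordered chains. -/
theorem ChainSubdivision.inducedOperator_homotopy (S : ChainSubdivision) (n : ℕ)
    (z : SingularChain E (n + 1)) :
    singularBoundary E (n + 1) (inducedOperator E (n + 1) (S.T (n + 1) (n + 1)) z) +
      inducedOperator E n (S.T n n) (singularBoundary E n z) =
        z - inducedOperator E (n + 1) (S.D (n + 1) (n + 1)) z := by
  have : singularBoundary E (n + 1) ∘ₗ inducedOperator E (n + 1) (S.T (n + 1) (n + 1)) +
      inducedOperator E n (S.T n n) ∘ₗ singularBoundary E n =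
        LinearMap.id - inducedOperator E (n + 1) (S.D (n + 1) (n + 1)) := by
    refine Finsupp.lhom_ext' fun σ => LinearMap.ext_ring ?_
    simp only [LinearMap.comp_apply, LinearMap.add_apply, LinearMap.sub_apply, LinearMap.id_apply,
      Finsupp.lsingle_apply]
    rw [single_eq_chainMap_realize, inducedOperator_chainMap_realize (fun m => S.T m (n + 1))
      (fun u c => S.natural_T u c), chainMap_boundary, chainMap_boundary, realize_boundary,
      realize_boundary, inducedOperator_chainMap_realize (fun m => S.T m n)
      (fun u c => S.natural_T u c), inducedOperator_chainMap_realize (fun m => S.D m (n + 1))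
      (fun u c => S.natural_D u c), ← map_add, ← map_add, S.homotopy_succ, map_sub, map_sub]
  exact LinearMap.congr_fun this z

end Transfer

/-! ### Barycentric subdivision -/

section Barycentric

variable {m m' n : ℕ}

/-- The barycenter of a tuple of points of a simplex. -/
def tupleBarycenter (w : Fin (n + 1) → TopSimplex m) : TopSimplex m :=
  affineSimplex w stdSimplex.barycenter

theorem affineSimplex_barycenter (u : Fin (m + 1) → TopSimplex m')
    (w : Fin (n + 1) → TopSimplex m) :
    affineSimplex u (tupleBarycenter w) = tupleBarycenter (affineSimplex u ∘ w) :=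
  affineSimplex_affineSimplex u w _

/-- Barycentric subdivision of ordered chains. -/
def barycentricD (m : ℕ) : (n : ℕ) → TupleChain (TopSimplex m) n →ₗ[ℤ] TupleChain (TopSimplex m) n
  | 0 => LinearMap.id
  | n + 1 => Finsupp.linearCombination ℤ fun v : Fin (n + 2) → TopSimplex m =>
      tupleCone (tupleBarycenter v) n (barycentricD m n (tupleBoundary _ n (Finsupp.single v 1)))

/-- The chain homotopy from barycentric subdivision to the identity. -/
def barycentricT (m : ℕ) :
    (n : ℕ) → TupleChain (TopSimplex m) n →ₗ[ℤ] TupleChain (TopSimplex m) (n + 1)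
  | 0 => Finsupp.linearCombination ℤ fun v : Fin 1 → TopSimplex m =>
      tupleCone (tupleBarycenter v) 0 (Finsupp.single v 1)
  | n + 1 => Finsupp.linearCombination ℤ fun v : Fin (n + 2) → TopSimplex m =>
      tupleCone (tupleBarycenter v) (n + 1)
        (Finsupp.single v 1 - barycentricT m n (tupleBoundary _ n (Finsupp.single v 1)))

theorem barycentricD_succ_single (v : Fin (n + 2) → TopSimplex m) :
    barycentricD m (n + 1) (Finsupp.single v 1) =
      tupleCone (tupleBarycenter v) n
        (barycentricD m n (tupleBoundary _ n (Finsupp.single v 1))) := by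
  simp [barycentricD]

theorem barycentricT_zero_single (v : Fin 1 → TopSimplex m) :
    barycentricT m 0 (Finsupp.single v 1) =
      tupleCone (tupleBarycenter v) 0 (Finsupp.single v 1) := by
  simp [barycentricT]

theorem barycentricT_succ_single (v : Fin (n + 2) → TopSimplex m) :
    barycentricT m (n + 1) (Finsupp.single v 1) =
      tupleCone (tupleBarycenter v) (n + 1)
        (Finsupp.single v 1 - barycentricT m n (tupleBoundary _ n (Finsupp.single v 1))) := by
  simp [barycentricT]

theorem barycentricD_natural (u : Fin (m + 1) → TopSimplex m') (n : ℕ)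
    (c : TupleChain (TopSimplex m) n) :
    tupleMap (affineSimplex u) n (barycentricD m n c) =
      barycentricD m' n (tupleMap (affineSimplex u) n c) := by
  induction n with
  | zero => rfl
  | succ n ih =>
    have : tupleMap (affineSimplex u) (n + 1) ∘ₗ barycentricD m (n + 1) =
        barycentricD m' (n + 1) ∘ₗ tupleMap (affineSimplex u) (n + 1) := by
      refine Finsupp.lhom_ext' fun v => LinearMap.ext_ring ?_
      simp only [LinearMap.comp_apply, Finsupp.lsingle_apply]
      rw [barycentricD_succ_single, tupleMap_cone, ih, tupleMap_boundary, tupleMap_single,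
        barycentricD_succ_single, affineSimplex_barycenter]
    exact LinearMap.congr_fun this c

theorem barycentricT_natural (u : Fin (m + 1) → TopSimplex m') (n : ℕ)
    (c : TupleChain (TopSimplex m) n) :
    tupleMap (affineSimplex u) (n + 1) (barycentricT m n c) =
      barycentricT m' n (tupleMap (affineSimplex u) n c) := by
  induction n with
  | zero =>
    have : tupleMap (affineSimplex u) 1 ∘ₗ barycentricT m 0 =
        barycentricT m' 0 ∘ₗ tupleMap (affineSimplex u) 0 := by
      refine Finsupp.lhom_ext' fun v => LinearMap.ext_ring ?_
      simp only [LinearMap.comp_apply, Finsupp.lsingle_apply]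
      rw [barycentricT_zero_single, tupleMap_cone, tupleMap_single, barycentricT_zero_single,
        affineSimplex_barycenter]
    exact LinearMap.congr_fun this c
  | succ n ih =>
    have : tupleMap (affineSimplex u) (n + 2) ∘ₗ barycentricT m (n + 1) =
        barycentricT m' (n + 1) ∘ₗ tupleMap (affineSimplex u) (n + 1) := by
      refine Finsupp.lhom_ext' fun v => LinearMap.ext_ring ?_
      simp only [LinearMap.comp_apply, Finsupp.lsingle_apply]
      rw [barycentricT_succ_single, tupleMap_cone, map_sub, ih, tupleMap_boundary, tupleMap_single,
        barycentricT_succ_single, affineSimplex_barycenter]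
    exact LinearMap.congr_fun this c

theorem tupleBarycenter_zero (v : Fin 1 → TopSimplex m) : tupleBarycenter v = v 0 := by
  apply stdSimplex.ext
  rw [tupleBarycenter, affineSimplex_apply]
  simp

/-- Both sides vanish: a point is its own barycenter, so the homotopy sends it to the degenerate
edge `(v, v)`, and subdivision does nothing in degree zero. -/
theorem barycentric_homotopy_zero (c : TupleChain (TopSimplex m) 0) :
    tupleBoundary _ 0 (barycentricT m 0 c) = c - barycentricD m 0 c := by
  have : tupleBoundary _ 0 ∘ₗ barycentricT m 0 = 0 := by
    refine Finsupp.lhom_ext' fun v => LinearMap.ext_ring ?_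
    simp only [LinearMap.comp_apply, Finsupp.lsingle_apply, LinearMap.zero_apply]
    rw [barycentricT_zero_single, tupleCone_single, tupleBoundary_single, one_smul,
      Fin.sum_univ_two, cons_comp_succAbove_zero, tupleBarycenter_zero]
    have : (Fin.cons (α := fun _ => TopSimplex m) (v 0) v : Fin 2 → TopSimplex m) ∘
        (1 : Fin 2).succAbove = v := by
      funext j
      fin_cases j
      simp
    rw [this, ← Finsupp.single_add]
    simp
  rw [show barycentricD m 0 c = c from rfl, sub_self]
  exact LinearMap.congr_fun this c

/-- With `b` the barycenter, the cone formula gives `∂Tv = (v - T∂v) - b * ∂(v - T∂v)`. The formula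
one degree lower, applied to the cycle `∂v`, turns `∂(v - T∂v)` into `D∂v`, whose cone is `Dv`. -/
theorem barycentric_homotopy_succ (n : ℕ) (c : TupleChain (TopSimplex m) (n + 1)) :
    tupleBoundary _ (n + 1) (barycentricT m (n + 1) c) +
      barycentricT m n (tupleBoundary _ n c) = c - barycentricD m (n + 1) c := by
  induction n with
  | zero =>
    have : tupleBoundary _ 1 ∘ₗ barycentricT m 1 + barycentricT m 0 ∘ₗ tupleBoundary _ 0 =
        LinearMap.id - barycentricD m 1 := by
      refine Finsupp.lhom_ext' fun v => LinearMap.ext_ring ?_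
      simp only [LinearMap.comp_apply, Finsupp.lsingle_apply, LinearMap.add_apply,
        LinearMap.sub_apply, LinearMap.id_apply]
      rw [barycentricT_succ_single, tupleBoundary_cone, map_sub, barycentric_homotopy_zero,
        barycentricD_succ_single, sub_sub_cancel]
      abel
    exact LinearMap.congr_fun this c
  | succ n ih =>
    have : tupleBoundary _ (n + 2) ∘ₗ barycentricT m (n + 2) +
        barycentricT m (n + 1) ∘ₗ tupleBoundary _ (n + 1) =
        LinearMap.id - barycentricD m (n + 2) := by
      refine Finsupp.lhom_ext' fun v => LinearMap.ext_ring ?_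
      simp only [LinearMap.comp_apply, Finsupp.lsingle_apply, LinearMap.add_apply,
        LinearMap.sub_apply, LinearMap.id_apply]
      have h := ih (tupleBoundary _ (n + 1) (Finsupp.single v 1))
      rw [tupleBoundary_boundary, map_zero, add_zero] at h
      rw [barycentricT_succ_single, tupleBoundary_cone, map_sub, h, barycentricD_succ_single,
        sub_sub_cancel]
      abel
    exact LinearMap.congr_fun this c

/-- Barycentric subdivision. -/
def barycentricSubdivision : ChainSubdivision where
  D := barycentricD
  T := barycentricT
  natural_D u c := barycentricD_natural u _ c
  natural_T u c := barycentricT_natural u _ c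
  homotopy_zero := barycentric_homotopy_zero
  homotopy_succ := barycentric_homotopy_succ _

end Barycentric

/-! ### The mesh of iterated subdivisions -/

section Mesh

variable {m n : ℕ}

theorem affineSimplex_mem_closedBall {w : Fin (n + 1) → TopSimplex m} {x : TopSimplex m} {r : ℝ}
    (h : ∀ i, dist (w i) x ≤ r) (t : TopSimplex n) : dist (affineSimplex w t) x ≤ r :=
  (convex_closedBall (x : Fin (m + 1) → ℝ) r).sum_mem (fun i _ => t.2.1 i) t.2.2 fun i _ => h i

/-- The difference of the barycenter and `w i` is `1 / (n + 1)` times the sum of the `n` vectors `w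
j - w i` with `j ≠ i`. -/
theorem dist_tupleBarycenter_le {w : Fin (n + 1) → TopSimplex m} {d : ℝ}
    (h : ∀ i j, dist (w i) (w j) ≤ d) (i : Fin (n + 1)) :
    dist (tupleBarycenter w) (w i) ≤ n / (n + 1) * d := by
  have hn : (0 : ℝ) < n + 1 := by positivity
  have h1 : ((tupleBarycenter w : Fin (m + 1) → ℝ) - w i) =
      ∑ j ∈ Finset.univ.erase i, ((n : ℝ) + 1)⁻¹ • ((w j : Fin (m + 1) → ℝ) - w i) := by
    rw [Finset.sum_erase _ (by simp), ← Finset.smul_sum, Finset.sum_sub_distrib, smul_sub,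
      tupleBarycenter, affineSimplex_apply, Finset.smul_sum]
    congr 1
    · refine Finset.sum_congr rfl fun j _ => ?_
      congr 1
      change ((Fintype.card (Fin (n + 1)) : ℝ))⁻¹ = _
      simp
    · simp only [Finset.sum_const, Finset.card_univ, Fintype.card_fin]
      rw [← Nat.cast_smul_eq_nsmul ℝ, smul_smul]
      push_cast
      rw [inv_mul_cancel₀ hn.ne', one_smul]
  have h2 : dist (tupleBarycenter w) (w i) =
      ‖((tupleBarycenter w : Fin (m + 1) → ℝ) - w i)‖ := by
    rw [Subtype.dist_eq, dist_eq_norm]; rfl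
  rw [h2, h1]
  refine (norm_sum_le_of_le (f := _) (n := fun _ => ((n : ℝ) + 1)⁻¹ * d) _ fun j _ => ?_).trans ?_
  · rw [norm_smul, Real.norm_of_nonneg (inv_nonneg.mpr hn.le)]
    have := h j i
    rw [Subtype.dist_eq, dist_eq_norm] at this
    exact mul_le_mul_of_nonneg_left this (inv_nonneg.mpr hn.le)
  · rw [Finset.sum_const, Finset.card_erase_of_mem (Finset.mem_univ _), Finset.card_univ,
      Fintype.card_fin, Nat.add_sub_cancel, nsmul_eq_mul]
    exact le_of_eq (by ring)

/-- The ordered chains of tuples of diameter at most `d`. -/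
def meshChains (m n : ℕ) (d : ℝ) : Submodule ℤ (TupleChain (TopSimplex m) n) :=
  Finsupp.supported ℤ ℤ {w | ∀ i j, dist (w i) (w j) ≤ d}

/-- The ordered chains of tuples in the closed ball around `x` of radius `r`. -/
def ballChains (m n : ℕ) (x : TopSimplex m) (r : ℝ) : Submodule ℤ (TupleChain (TopSimplex m) n) :=
  Finsupp.supported ℤ ℤ {w | ∀ i, dist (w i) x ≤ r}

theorem tupleBoundary_mem_supported {Y : Type*} {s : Set (Fin (n + 1) → Y)} {v : Fin (n + 2) → Y}
    (h : ∀ i : Fin (n + 2), v ∘ i.succAbove ∈ s) :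
    tupleBoundary Y n (Finsupp.single v 1) ∈ Finsupp.supported ℤ ℤ s := by
  rw [tupleBoundary_single, one_smul]
  exact Submodule.sum_mem _ fun i _ => Finsupp.single_mem_supported ℤ _ (h i)

/-- Balls are convex, so new barycenters stay inside. The case of a ball around the barycenter
bounds the edges that the next cone adds. -/
theorem barycentricD_mem_ballChains {x : TopSimplex m} {r : ℝ} {c : TupleChain (TopSimplex m) n}
    (hc : c ∈ ballChains m n x r) : barycentricD m n c ∈ ballChains m n x r := by
  induction n with
  | zero => exact hc
  | succ n ih =>
    refine map_mem_of_supported _ _ (fun v hv => ?_) hc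
    rw [barycentricD_succ_single]
    refine map_mem_of_supported _ _ (fun u hu => ?_)
      (ih (tupleBoundary_mem_supported fun i j => hv (i.succAbove j)))
    rw [tupleCone_single]
    refine Finsupp.single_mem_supported ℤ _ fun i => ?_
    refine Fin.cases ?_ (fun j => ?_) i
    · exact affineSimplex_mem_closedBall hv _
    · exact hu j

/-- A new simplex is the cone from the barycenter over a simplex of a subdivided face. Edges within
the face shrink by induction, and edges at the cone point are at most the distance from the
barycenter to a vertex. -/
theorem barycentricD_mem_meshChains {d : ℝ} {c : TupleChain (TopSimplex m) n}
    (hc : c ∈ meshChains m n d) : barycentricD m n c ∈ meshChains m n (n / (n + 1) * d) := by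
  induction n with
  | zero =>
    refine map_mem_of_supported _ _ (fun v hv => ?_) hc
    refine Finsupp.single_mem_supported ℤ _ fun i j => ?_
    rw [Fin.fin_one_eq_zero i, Fin.fin_one_eq_zero j]
    simp
  | succ n ih =>
    refine map_mem_of_supported _ _ (fun v hv => ?_) hc
    rw [barycentricD_succ_single]
    have hd : 0 ≤ d := by simpa using hv 0 0
    set d' : ℝ := (n + 1 : ℕ) / ((n + 1 : ℕ) + 1) * d with hd'
    -- The factor `n / (n + 1)` increases with the dimension, so the bound for faces is good enough.
    have h1 : (n : ℝ) / (n + 1) * d ≤ d' := by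
      refine mul_le_mul_of_nonneg_right ?_ hd
      push_cast
      rw [div_le_div_iff₀ (by positivity) (by positivity)]
      nlinarith
    have hmem : barycentricD m n (tupleBoundary _ n (Finsupp.single v 1)) ∈
        Finsupp.supported ℤ ℤ ({w | ∀ i j, dist (w i) (w j) ≤ d'} ∩
          {w | ∀ i, dist (w i) (tupleBarycenter v) ≤ d'}) := by
      rw [Finsupp.supported_inter]
      refine ⟨?_, ?_⟩
      · exact Finsupp.supported_mono (fun w hw i j => (hw i j).trans h1)
          (ih (tupleBoundary_mem_supported fun i j k => hv _ _))
      · exact barycentricD_mem_ballChains (tupleBoundary_mem_supported fun i j => by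
          rw [dist_comm]; exact dist_tupleBarycenter_le hv _)
    refine map_mem_of_supported _ _ (fun u hu => ?_) hmem
    rw [tupleCone_single]
    have hd0 : 0 ≤ d' := by positivity
    refine Finsupp.single_mem_supported ℤ _ fun i j => ?_
    refine Fin.cases ?_ (fun i' => ?_) i <;> refine Fin.cases ?_ (fun j' => ?_) j
    · simpa using hd0
    · rw [dist_comm]; exact hu.2 j'
    · exact hu.2 i'
    · exact hu.1 i' j'

theorem iterate_barycentricD_mem_meshChains (k : ℕ) {d : ℝ} {c : TupleChain (TopSimplex m) n}
    (hc : c ∈ meshChains m n d) :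
    (barycentricSubdivision.iterate k).D m n c ∈ meshChains m n (((n : ℝ) / (n + 1)) ^ k * d) := by
  induction k with
  | zero => rw [pow_zero, one_mul]; exact hc
  | succ k ih =>
    rw [pow_succ', mul_assoc]
    exact barycentricD_mem_meshChains ih

/-- A chain in the union of two open sets becomes, after enough barycentric subdivisions, a sum of
chains in these sets. -/
theorem eventually_subdivision_mem_sup {E : Type*} [TopologicalSpace E] {X U V : Set E}
    (hU : IsOpen U) (hV : IsOpen V) (hX : X ⊆ U ∪ V) {n : ℕ} {z : SingularChain E n}
    (hz : z ∈ chainsIn X n) :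
    ∀ᶠ k in Filter.atTop, inducedOperator E n ((barycentricSubdivision.iterate k).D n n) z ∈
      chainsIn U n ⊔ chainsIn V n := by
  rw [chainsIn, Finsupp.supported_eq_span_single] at hz
  induction hz using Submodule.span_induction with
  | zero => simp
  -- Asking for all large `k`, and not for some `k`, provides a common number of subdivisions for
  -- the two summands.
  | add x y _ _ hx hy =>
    filter_upwards [hx, hy] with k hx hy
    rw [map_add]; exact Submodule.add_mem _ hx hy
  | smul a x _ hx =>
    filter_upwards [hx] with k hx
    rw [map_smul]; exact Submodule.smul_mem _ a hx
  | mem x hx =>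
    obtain ⟨σ, hσ, rfl⟩ := hx
    -- The cover is pulled back to the simplex, where compactness gives a Lebesgue number; the mesh
    -- of the subdivisions eventually drops below it.
    obtain ⟨δ, hδ, hball⟩ := lebesgue_number_lemma_of_metric (s := Set.univ)
      (c := fun b : Bool => σ ⁻¹' (if b then U else V)) isCompact_univ
      (fun b => (by cases b <;> simpa : IsOpen (if b then U else V)).preimage σ.continuous)
      (fun y _ => by
        rcases hX (hσ y) with h | h
        · exact Set.mem_iUnion.mpr ⟨true, h⟩
        · exact Set.mem_iUnion.mpr ⟨false, h⟩)
    have hlim : Filter.Tendsto (fun k : ℕ => ((n : ℝ) / (n + 1)) ^ k *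
        Metric.diam (Set.univ : Set (TopSimplex n))) Filter.atTop (nhds 0) := by
      rw [← zero_mul (Metric.diam (Set.univ : Set (TopSimplex n)))]
      refine (tendsto_pow_atTop_nhds_zero_of_lt_one (by positivity) ?_).mul_const _
      rw [div_lt_one (by positivity)]
      linarith
    filter_upwards [hlim.eventually_lt_const hδ] with k hk
    rw [inducedOperator_single]
    refine map_mem_of_supported (chainMap σ n ∘ₗ realize n n) _ (fun w hw => ?_)
      (iterate_barycentricD_mem_meshChains k (d := Metric.diam (Set.univ : Set (TopSimplex n)))
        (Finsupp.single_mem_supported ℤ _ fun i j => Metric.dist_le_diam_of_mem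
          isCompact_univ.isBounded (Set.mem_univ _) (Set.mem_univ _)))
    rw [LinearMap.comp_apply, realize_single, chainMap_single]
    -- A small affine simplex lies in the ball of radius `δ` around its first vertex, by convexity.
    obtain ⟨b, hb⟩ := hball (w 0) (Set.mem_univ _)
    have hmem : ∀ y, σ (affineSimplex w y) ∈ (if b then U else V) := fun y =>
      hb (lt_of_le_of_lt (affineSimplex_mem_closedBall (fun i => hw i 0) y) hk)
    cases b
    · exact Submodule.mem_sup_right (single_mem_chainsIn hmem _)
    · exact Submodule.mem_sup_left (single_mem_chainsIn hmem _)

/-- Chains in the union of two open sets are sums of chains in these sets, up to a chain homotopy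
that keeps chains in any given subset. -/
theorem exists_homotopy_mem_sup {E : Type*} [TopologicalSpace E] {X U V : Set E}
    (hU : IsOpen U) (hV : IsOpen V) (hX : X ⊆ U ∪ V) {n : ℕ} {z : SingularChain E (n + 1)}
    (hz : z ∈ chainsIn X (n + 1)) :
    ∃ T : ∀ k, SingularChain E k →ₗ[ℤ] SingularChain E (k + 1),
      (∀ k (Y : Set E), ∀ c ∈ chainsIn Y k, T k c ∈ chainsIn Y (k + 1)) ∧
      z - singularBoundary E (n + 1) (T (n + 1) z) - T n (singularBoundary E n z) ∈
        chainsIn U (n + 1) ⊔ chainsIn V (n + 1) := by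
  obtain ⟨k, hk⟩ := (eventually_subdivision_mem_sup hU hV hX hz).exists
  refine ⟨fun j => inducedOperator E j ((barycentricSubdivision.iterate k).T j j),
    fun j Y c hc => inducedOperator_mem_chainsIn _ hc, ?_⟩
  rwa [sub_sub, ChainSubdivision.inducedOperator_homotopy, sub_sub_cancel]

end Mesh

/-! ### Cones of singular simplices in a vector space -/

section Cone

variable {V : Type*} [NormedAddCommGroup V] [NormedSpace ℝ V] {n : ℕ}

theorem sum_succ_eq_one_sub (t : TopSimplex (n + 1)) : ∑ i : Fin (n + 1), t i.succ = 1 - t 0 := by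
  have h := t.2.2
  rw [Fin.sum_univ_succ] at h
  exact eq_sub_of_add_eq' h

/-- The projection of a point of a simplex from the vertex `0` to the opposite face. -/
def simplexTail (t : TopSimplex (n + 1)) : TopSimplex n :=
  open Classical in
  -- The projection is undefined at the cone vertex. The value chosen there is harmless, since the
  -- cone multiplies it by `1 - t 0 = 0`.
  if h : t 0 = 1 then stdSimplex.vertex 0 else
    ⟨fun i => t i.succ / (1 - t 0), fun i => div_nonneg (t.2.1 _)
      (sub_nonneg.mpr (stdSimplex.le_one t 0)), by
        rw [← Finset.sum_div, sum_succ_eq_one_sub, div_self (sub_ne_zero.mpr (Ne.symm h))]⟩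

theorem simplexTail_apply {t : TopSimplex (n + 1)} (h : t 0 ≠ 1) (i : Fin (n + 1)) :
    (simplexTail t) i = t i.succ / (1 - t 0) := by
  rw [simplexTail, dif_neg h]
  rfl

theorem continuous_coord (i : Fin (n + 1)) : Continuous fun t : TopSimplex n => t i :=
  (continuous_apply i).comp continuous_subtype_val

theorem continuousAt_simplexTail {t : TopSimplex (n + 1)} (h : t 0 ≠ 1) :
    ContinuousAt (simplexTail (n := n)) t := by
  rw [Topology.IsInducing.subtypeVal.continuousAt_iff, continuousAt_pi]
  intro i
  have h1 : ContinuousAt (fun s : TopSimplex (n + 1) => s i.succ / (1 - s 0)) t :=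
    (continuous_coord _).continuousAt.div
      (continuous_const.sub (continuous_coord _)).continuousAt (sub_ne_zero.mpr (Ne.symm h))
  refine h1.congr ?_
  filter_upwards [(continuous_coord (n := n + 1) 0).continuousAt.eventually_ne h] with s hs
  exact (simplexTail_apply hs i).symm

/-- The cone over a singular simplex. -/
def coneSimplex (b : V) (σ : C(TopSimplex n, V)) : C(TopSimplex (n + 1), V) where
  toFun t := t 0 • b + (1 - t 0) • σ (simplexTail t)
  continuous_toFun := by
    rw [continuous_iff_continuousAt]
    intro t
    have h0 := (continuous_coord (n := n + 1) 0).continuousAt (x := t)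
    refine (h0.smul continuousAt_const).add ?_
    by_cases h : t 0 = 1
    -- `simplexTail` need not be continuous at the cone vertex, but `σ` is bounded and its factor `1
    -- - s 0` tends to zero.
    · obtain ⟨C, hC⟩ := (isCompact_range σ.continuous).isBounded.exists_norm_le
      have h1 : Filter.Tendsto (fun s : TopSimplex (n + 1) => (1 - s 0)) (nhds t) (nhds 0) := by
        have : ContinuousAt (fun s : TopSimplex (n + 1) => (1 - s 0)) t :=
          continuousAt_const.sub h0
        rw [ContinuousAt, h, sub_self] at this
        exact this
      rw [ContinuousAt, h, sub_self, zero_smul]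
      exact h1.zero_smul_isBoundedUnder_le
        (Filter.isBoundedUnder_of ⟨C, fun s => hC _ (Set.mem_range_self _)⟩)
    · exact (continuousAt_const.sub h0).smul
        (σ.continuous.continuousAt.comp (continuousAt_simplexTail h))

theorem coneSimplex_apply (b : V) (σ : C(TopSimplex n, V)) (t : TopSimplex (n + 1)) :
    coneSimplex b σ t = t 0 • b + (1 - t 0) • σ (simplexTail t) := rfl

theorem coneSimplex_mem {X : Set V} {b : V} (hX : StarConvex ℝ b X) {σ : C(TopSimplex n, V)}
    (hσ : ∀ y, σ y ∈ X) (t : TopSimplex (n + 1)) : coneSimplex b σ t ∈ X :=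
  hX (hσ _) (t.2.1 0) (sub_nonneg.mpr (stdSimplex.le_one t 0)) (add_sub_cancel _ _)

theorem coneSimplex_face_zero (b : V) (σ : C(TopSimplex n, V)) :
    (coneSimplex b σ).comp (faceInclusion n 0) = σ := by
  ext1 t
  have h0 := faceInclusion_apply_self 0 t
  have h : simplexTail (faceInclusion n 0 t) = t := by
    apply stdSimplex.ext
    funext i
    rw [simplexTail_apply (by rw [h0]; exact zero_ne_one), h0, sub_zero, div_one,
      ← Fin.succAbove_zero_apply, faceInclusion_apply_succAbove]
  rw [ContinuousMap.comp_apply, coneSimplex_apply, h, h0]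
  simp

theorem coneSimplex_face_succ (b : V) (σ : C(TopSimplex (n + 1), V)) (i : Fin (n + 2)) :
    (coneSimplex b σ).comp (faceInclusion (n + 1) i.succ) =
      coneSimplex b (σ.comp (faceInclusion n i)) := by
  ext1 t
  have h0 : (faceInclusion (n + 1) i.succ t) 0 = t 0 := by
    have := faceInclusion_apply_succAbove i.succ t 0
    rwa [Fin.succ_succAbove_zero] at this
  rw [ContinuousMap.comp_apply, coneSimplex_apply, coneSimplex_apply, h0]
  by_cases h : t 0 = 1
  · simp [h]
  · suffices key : simplexTail (faceInclusion (n + 1) i.succ t) =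
        faceInclusion n i (simplexTail t) by rw [key]; rfl
    apply stdSimplex.ext
    funext j
    rw [simplexTail_apply (by rwa [h0]), h0]
    refine Fin.succAboveCases i ?_ (fun k => ?_) j
    · rw [faceInclusion_apply_self, faceInclusion_apply_self, zero_div]
    · rw [faceInclusion_apply_succAbove, simplexTail_apply h, ← Fin.succ_succAbove_succ,
        faceInclusion_apply_succAbove]

/-- The singular `0`-simplex at a point. -/
abbrev pointSimplex {E : Type*} [TopologicalSpace E] (x : E) : C(TopSimplex 0, E) :=
  ContinuousMap.const _ x

theorem eq_pointSimplex {E : Type*} [TopologicalSpace E] (σ : C(TopSimplex 0, E)) :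
    σ = pointSimplex (σ (stdSimplex.vertex 0)) := by
  ext1 y
  exact congrArg σ (Subsingleton.elim _ _)

theorem coneSimplex_face_one (b : V) (σ : C(TopSimplex 0, V)) :
    (coneSimplex b σ).comp (faceInclusion 0 1) = pointSimplex b := by
  ext1 t
  have h0 : (faceInclusion 0 1 t) 0 = 1 := by
    have := faceInclusion_apply_succAbove 1 t 0
    exact this.trans (stdSimplex.eq_one_of_unique (X := Fin 1) t 0)
  rw [ContinuousMap.comp_apply, coneSimplex_apply, h0]
  simp

/-- The cone over a singular chain. -/
def coneChain (b : V) (n : ℕ) : SingularChain V n →ₗ[ℤ] SingularChain V (n + 1) :=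
  Finsupp.lmapDomain ℤ ℤ fun σ => coneSimplex b σ

@[simp]
theorem coneChain_single (b : V) (σ : C(TopSimplex n, V)) (a : ℤ) :
    coneChain b n (Finsupp.single σ a) = Finsupp.single (coneSimplex b σ) a := by
  simp [coneChain, Finsupp.mapDomain_single]

theorem coneChain_mem_chainsIn {X : Set V} {b : V} (hX : StarConvex ℝ b X)
    {z : SingularChain V n} (hz : z ∈ chainsIn X n) : coneChain b n z ∈ chainsIn X (n + 1) :=
  map_mem_of_chainsIn _ _ (fun σ hσ => by
    rw [coneChain_single]
    exact single_mem_chainsIn (coneSimplex_mem hX hσ) _) hz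

theorem boundary_coneChain (b : V) (z : SingularChain V (n + 1)) :
    singularBoundary V (n + 1) (coneChain b (n + 1) z) =
      z - coneChain b n (singularBoundary V n z) := by
  have : singularBoundary V (n + 1) ∘ₗ coneChain b (n + 1) =
      LinearMap.id - coneChain b n ∘ₗ singularBoundary V n := by
    refine Finsupp.lhom_ext' fun σ => LinearMap.ext_ring ?_
    simp only [LinearMap.comp_apply, LinearMap.sub_apply, LinearMap.id_apply,
      Finsupp.lsingle_apply, coneChain_single, singularBoundary_single, map_sum]
    rw [Fin.sum_univ_succ, coneSimplex_face_zero, sub_eq_add_neg, ← Finset.sum_neg_distrib]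
    refine congrArg₂ (· + ·) (by simp) (Finset.sum_congr rfl fun i _ => ?_)
    rw [coneSimplex_face_succ, ← Finsupp.single_neg]
    simp [pow_succ]
  exact LinearMap.congr_fun this z

theorem boundary_coneChain_zero (b : V) (z : SingularChain V 0) :
    singularBoundary V 0 (coneChain b 0 z) =
      z - Finsupp.single (pointSimplex b) (augmentation V 0 z) := by
  have : singularBoundary V 0 ∘ₗ coneChain b 0 =
      LinearMap.id - Finsupp.lsingle (pointSimplex b) ∘ₗ augmentation V 0 := by
    refine Finsupp.lhom_ext' fun σ => LinearMap.ext_ring ?_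
    simp only [LinearMap.comp_apply, LinearMap.sub_apply, LinearMap.id_apply,
      Finsupp.lsingle_apply, coneChain_single, singularBoundary_single, augmentation_single]
    rw [Fin.sum_univ_two, coneSimplex_face_zero, coneSimplex_face_one, sub_eq_add_neg,
      ← Finsupp.single_neg]
    simp
  exact LinearMap.congr_fun this z

/-- The cone from the star centre stays in `X`, and for a cycle its boundary is the cycle itself. -/
theorem StarConvex.exists_boundary_eq {X : Set V} {b : V} (hX : StarConvex ℝ b X)
    {z : SingularChain V (n + 1)} (hz : z ∈ chainsIn X (n + 1)) (h : singularBoundary V n z = 0) :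
    ∃ s ∈ chainsIn X (n + 2), singularBoundary V (n + 1) s = z :=
  ⟨_, coneChain_mem_chainsIn hX hz, by rw [boundary_coneChain, h, map_zero, sub_zero]⟩

theorem StarConvex.exists_boundary_eq_zero {X : Set V} {b : V} (hX : StarConvex ℝ b X)
    {z : SingularChain V 0} (hz : z ∈ chainsIn X 0) (h : augmentation V 0 z = 0) :
    ∃ s ∈ chainsIn X 1, singularBoundary V 0 s = z :=
  ⟨_, coneChain_mem_chainsIn hX hz, by
    rw [boundary_coneChain_zero, h, Finsupp.single_zero, sub_zero]⟩

/-- The straight singular `1`-simplex between two points. -/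
def segmentSimplex (a b : V) : C(TopSimplex 1, V) where
  toFun t := t 0 • a + t 1 • b
  continuous_toFun :=
    ((continuous_coord 0).smul continuous_const).add ((continuous_coord 1).smul continuous_const)

/-- The straight singular `1`-chain between two points. -/
abbrev segmentChain (a b : V) : SingularChain V 1 := Finsupp.single (segmentSimplex a b) 1

theorem vertex_eval_face_zero {E : Type*} [TopologicalSpace E] (σ : C(TopSimplex 1, E)) :
    σ.comp (faceInclusion 0 0) = pointSimplex (σ (stdSimplex.vertex 1)) := by
  rw [eq_pointSimplex (σ.comp _), ContinuousMap.comp_apply]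
  simp [faceInclusion]

theorem vertex_eval_face_one {E : Type*} [TopologicalSpace E] (σ : C(TopSimplex 1, E)) :
    σ.comp (faceInclusion 0 1) = pointSimplex (σ (stdSimplex.vertex 0)) := by
  rw [eq_pointSimplex (σ.comp _), ContinuousMap.comp_apply]
  simp [faceInclusion]

/-- The boundary of a singular `1`-simplex is the difference of its end points. -/
theorem singularBoundary_one {E : Type*} [TopologicalSpace E] (σ : C(TopSimplex 1, E)) :
    singularBoundary E 0 (Finsupp.single σ 1) =
      Finsupp.single (pointSimplex (σ (stdSimplex.vertex 1))) 1 -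
        Finsupp.single (pointSimplex (σ (stdSimplex.vertex 0))) 1 := by
  rw [singularBoundary_single, Fin.sum_univ_two, vertex_eval_face_zero, vertex_eval_face_one,
    sub_eq_add_neg, ← Finsupp.single_neg]
  simp

theorem segmentSimplex_vertex_zero (a b : V) :
    segmentSimplex a b (stdSimplex.vertex 0) = a := by
  simp [segmentSimplex]

theorem segmentSimplex_vertex_one (a b : V) :
    segmentSimplex a b (stdSimplex.vertex 1) = b := by
  simp [segmentSimplex]

theorem boundary_segmentChain (a b : V) : singularBoundary V 0 (segmentChain a b) =
    Finsupp.single (pointSimplex b) 1 - Finsupp.single (pointSimplex a) 1 := by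
  rw [singularBoundary_one, segmentSimplex_vertex_zero, segmentSimplex_vertex_one]

end Cone

/-! ### The complement of the vertical axis -/

/-- The complement of the vertical axis in `ℝ³`. -/
def axisComplement : Set R3 := {v | v 0 ≠ 0 ∨ v 1 ≠ 0}

/-- The universal covering of the complement of the vertical axis, in cylindrical coordinates. -/
def cylinderCover : C(ℂ × ℝ, R3) where
  toFun a := !₂[(Complex.exp a.1).re, (Complex.exp a.1).im, a.2]
  continuous_toFun := by
    refine (PiLp.continuous_toLp 2 _).comp (continuous_pi fun i => ?_)
    fin_cases i
    · exact Complex.continuous_re.comp (Complex.continuous_exp.comp continuous_fst)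
    · exact Complex.continuous_im.comp (Complex.continuous_exp.comp continuous_fst)
    · exact continuous_snd

@[simp] theorem cylinderCover_two (a : ℂ × ℝ) : cylinderCover a 2 = a.2 := rfl

theorem cylinderCover_mem (a : ℂ × ℝ) : cylinderCover a ∈ axisComplement := by
  by_contra h
  rw [axisComplement, Set.mem_ofPred_eq, not_or, not_not, not_not] at h
  exact Complex.exp_ne_zero a.1 (Complex.ext h.1 h.2)

theorem cylinderCover_eq_iff {a : ℂ × ℝ} {v : R3} :
    cylinderCover a = v ↔ Complex.exp a.1 = ⟨v 0, v 1⟩ ∧ a.2 = v 2 := by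
  constructor
  · rintro rfl
    exact ⟨rfl, rfl⟩
  · rintro ⟨h1, h2⟩
    ext i
    fin_cases i
    · exact congrArg Complex.re h1
    · exact congrArg Complex.im h1
    · exact h2

/-- The covering translations of `cylinderCover`. -/
def deckVector (k : ℤ) : ℂ × ℝ := (k * (2 * Real.pi * Complex.I), 0)

theorem cylinderCover_add_deckVector (a : ℂ × ℝ) (k : ℤ) :
    cylinderCover (a + deckVector k) = cylinderCover a := by
  rw [cylinderCover_eq_iff]
  refine ⟨?_, by simp [deckVector]⟩
  rw [Prod.fst_add, deckVector, Complex.exp_add, Complex.exp_int_mul_two_pi_mul_I, mul_one]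
  rfl

theorem cylinderCover_eq_cylinderCover {a b : ℂ × ℝ} (h : cylinderCover a = cylinderCover b) :
    ∃ k : ℤ, a = b + deckVector k := by
  rw [cylinderCover_eq_iff] at h
  obtain ⟨k, hk⟩ := Complex.exp_eq_exp_iff_exists_int.mp (h.1.trans rfl : _ = Complex.exp b.1)
  exact ⟨k, Prod.ext hk (by simp [deckVector, h.2])⟩

theorem exists_cylinderCover_eq {v : R3} (hv : v ∈ axisComplement) :
    ∃ a, cylinderCover a = v := by
  refine ⟨(Complex.log ⟨v 0, v 1⟩, v 2), cylinderCover_eq_iff.mpr ⟨Complex.exp_log ?_, rfl⟩⟩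
  intro h
  rw [Complex.ext_iff] at h
  exact hv.elim (fun h0 => h0 h.1) (fun h1 => h1 h.2)

instance (n : ℕ) : LocallyPathConnectedSpace (TopSimplex n) :=
  (convex_stdSimplex ℝ _).locallyPathConnectedSpace

instance (n : ℕ) : ContractibleSpace (TopSimplex n) :=
  (convex_stdSimplex ℝ _).contractibleSpace ⟨_, (stdSimplex.vertex (0 : Fin (n + 1))).2⟩

/-- The horizontal coordinates form a non-vanishing complex function on a simplex, which lifts
through the exponential; the height is kept. -/
theorem exists_cylinder_lift {n : ℕ} {σ : C(TopSimplex n, R3)} (hσ : ∀ y, σ y ∈ axisComplement)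
    {y₀ : TopSimplex n} {a : ℂ × ℝ} (ha : cylinderCover a = σ y₀) :
    ∃ τ : C(TopSimplex n, ℂ × ℝ), cylinderCover.comp τ = σ ∧ τ y₀ = a := by
  have hcoord (i : Fin 3) : Continuous fun y => σ y i :=
    (EuclideanSpace.proj (𝕜 := ℝ) i).continuous.comp σ.continuous
  let f : C(TopSimplex n, ℂ) := ⟨fun y => ⟨σ y 0, σ y 1⟩,
    Complex.equivRealProdCLM.symm.continuous.comp ((hcoord 0).prodMk (hcoord 1))⟩
  rw [cylinderCover_eq_iff] at ha
  obtain ⟨F, ⟨hF0, hF⟩, -⟩ := Complex.isCoveringMapOn_exp.existsUnique_continuousMap_lifts f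
    (a₀ := y₀) ha.1 fun y h => by
      have h' := Complex.ext_iff.mp (h : f y = 0)
      exact (hσ y).elim (fun h0 => h0 h'.1) (fun h1 => h1 h'.2)
  refine ⟨⟨fun y => (F y, σ y 2), F.continuous.prodMk (hcoord 2)⟩, ?_, Prod.ext hF0 ha.2.symm⟩
  ext1 y
  exact cylinderCover_eq_iff.mpr ⟨congrFun hF y, rfl⟩

/-- At one vertex the two lifts differ by a multiple of `2πi`; uniqueness of lifts propagates this
translation over the simplex. -/
theorem cylinder_lift_unique {n : ℕ} {τ τ' : C(TopSimplex n, ℂ × ℝ)}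
    (h : cylinderCover.comp τ = cylinderCover.comp τ') :
    ∃ k : ℤ, ∀ y, τ y = τ' y + deckVector k := by
  have hy (y) : cylinderCover (τ y) = cylinderCover (τ' y) := congrArg (fun f => f y) h
  obtain ⟨k, hk⟩ := cylinderCover_eq_cylinderCover (hy (stdSimplex.vertex 0))
  refine ⟨k, fun y => ?_⟩
  let F : C(TopSimplex n, ℂ) := ⟨fun y => (τ y).1, continuous_fst.comp τ.continuous⟩
  let F' : C(TopSimplex n, ℂ) := ⟨fun y => (τ' y + deckVector k).1,
    continuous_fst.comp (τ'.continuous.add continuous_const)⟩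
  let f : C(TopSimplex n, ℂ) := ⟨fun y => Complex.exp (τ y).1,
    Complex.continuous_exp.comp F.continuous⟩
  have hF' (y) : Complex.exp (F' y) = f y := by
    have h1 := (cylinderCover_add_deckVector (τ' y) k).trans (hy y).symm
    exact (cylinderCover_eq_iff.mp h1).1
  have hu := Complex.isCoveringMapOn_exp.existsUnique_continuousMap_lifts f
    (a₀ := stdSimplex.vertex 0) (e₀ := F (stdSimplex.vertex 0)) rfl
    (fun y => Complex.exp_ne_zero _)
  have : F = F' := hu.unique ⟨rfl, rfl⟩ ⟨(congrArg Prod.fst hk).symm, funext hF'⟩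
  refine Prod.ext (congrArg (fun g : C(TopSimplex n, ℂ) => g y) this) ?_
  have := (cylinderCover_eq_iff.mp (hy y)).2
  simpa [deckVector] using this

theorem exists_chainMap_cylinderCover {n : ℕ} {z : SingularChain R3 n}
    (hz : z ∈ chainsIn axisComplement n) : ∃ c, chainMap cylinderCover n c = z :=
  exists_chainMap_eq (fun σ hσ => by
    obtain ⟨a, ha⟩ := exists_cylinderCover_eq (hσ (stdSimplex.vertex 0))
    obtain ⟨τ, hτ, -⟩ := exists_cylinder_lift hσ ha
    exact ⟨τ, hτ⟩) hz

theorem chainMap_cylinderCover_mem {n : ℕ} (c : SingularChain (ℂ × ℝ) n) :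
    chainMap cylinderCover n c ∈ chainsIn axisComplement n :=
  chainMap_mem_chainsIn (X := Set.univ) (fun a _ => cylinderCover_mem a) (by simp)

/-- The change of angle along a singular `1`-chain around the vertical axis. -/
theorem exists_angle : ∃ w : SingularChain R3 1 →ₗ[ℤ] ℝ, ∀ τ : C(TopSimplex 1, ℂ × ℝ),
    w (Finsupp.single (cylinderCover.comp τ) 1) =
      (τ (stdSimplex.vertex 1)).1.im - (τ (stdSimplex.vertex 0)).1.im := by
  classical
  refine ⟨Finsupp.linearCombination ℤ fun σ => if h : ∃ τ, cylinderCover.comp τ = σ then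
    (h.choose (stdSimplex.vertex 1)).1.im - (h.choose (stdSimplex.vertex 0)).1.im else 0,
    fun τ => ?_⟩
  have h : ∃ τ', cylinderCover.comp τ' = cylinderCover.comp τ := ⟨τ, rfl⟩
  rw [Finsupp.linearCombination_single, one_smul, dif_pos h]
  -- The chosen lift and `τ` differ by a translation, which cancels in the difference of end points.
  obtain ⟨k, hk⟩ := cylinder_lift_unique h.choose_spec
  rw [hk, hk]
  simp

theorem vertex_comp_face {E : Type*} [TopologicalSpace E] {n : ℕ} (σ : C(TopSimplex (n + 1), E))
    (i : Fin (n + 2)) (j : Fin (n + 1)) :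
    (σ.comp (faceInclusion n i)) (stdSimplex.vertex j) =
      σ (stdSimplex.vertex (i.succAbove j)) := by
  simp [faceInclusion]

/-- On a lifted triangle the angle differences along the three edges telescope. -/
theorem angle_boundary {w : SingularChain R3 1 →ₗ[ℤ] ℝ} (hw : ∀ τ : C(TopSimplex 1, ℂ × ℝ),
    w (Finsupp.single (cylinderCover.comp τ) 1) =
      (τ (stdSimplex.vertex 1)).1.im - (τ (stdSimplex.vertex 0)).1.im)
    {s : SingularChain R3 2} (hs : s ∈ chainsIn axisComplement 2) :
    w (singularBoundary R3 1 s) = 0 := by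
  obtain ⟨c, rfl⟩ := exists_chainMap_cylinderCover hs
  rw [chainMap_boundary]
  have : w ∘ₗ chainMap cylinderCover 1 ∘ₗ singularBoundary _ 1 = 0 := by
    refine Finsupp.lhom_ext' fun τ => LinearMap.ext_ring ?_
    simp only [LinearMap.comp_apply, Finsupp.lsingle_apply, singularBoundary_single, map_sum,
      LinearMap.zero_apply, chainMap_single]
    have (i : Fin 3) : w (Finsupp.single (cylinderCover.comp (τ.comp (faceInclusion 1 i)))
        ((-1 : ℤ) ^ (i : ℕ))) = (-1) ^ (i : ℕ) *
        ((τ (stdSimplex.vertex (i.succAbove 1))).1.im -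
          (τ (stdSimplex.vertex (i.succAbove 0))).1.im) := by
      rw [← mul_one ((-1 : ℤ) ^ (i : ℕ)), ← smul_eq_mul, ← Finsupp.smul_single, map_smul, hw,
        vertex_comp_face, vertex_comp_face, zsmul_eq_mul]
      push_cast
      rfl
    rw [Fin.sum_univ_three, this, this, this]
    simp only [show (0 : Fin 3).succAbove (1 : Fin 2) = 2 from rfl,
      show (0 : Fin 3).succAbove (0 : Fin 2) = 1 from rfl,
      show (1 : Fin 3).succAbove (1 : Fin 2) = 2 from rfl,
      show (1 : Fin 3).succAbove (0 : Fin 2) = 0 from rfl,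
      show (2 : Fin 3).succAbove (1 : Fin 2) = 1 from rfl,
      show (2 : Fin 3).succAbove (0 : Fin 2) = 0 from rfl]
    simp
  exact LinearMap.congr_fun this c

/-- The end point of the lift of the half circle. -/
def halfTurn : ℂ × ℝ := (Real.pi * Complex.I, 0)

/-- The circle around the vertical axis, as a sum of two half circles. -/
def equatorChain : SingularChain R3 1 :=
  chainMap cylinderCover 1 (segmentChain 0 halfTurn + segmentChain halfTurn (deckVector 1))

theorem equatorChain_mem : equatorChain ∈ chainsIn axisComplement 1 :=
  chainMap_cylinderCover_mem _

/-- The angle changes by `2πn` along `n` times the circle and by `0` along a boundary. -/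
theorem zsmul_equatorChain_boundary {n : ℤ} {s : SingularChain R3 2}
    (hs : s ∈ chainsIn axisComplement 2) (h : singularBoundary R3 1 s = n • equatorChain) :
    n = 0 := by
  obtain ⟨w, hw⟩ := exists_angle
  have h0 := angle_boundary hw hs
  rw [h, map_smul, equatorChain, map_add, chainMap_single, chainMap_single, map_add, hw, hw,
    segmentSimplex_vertex_zero, segmentSimplex_vertex_one, segmentSimplex_vertex_zero,
    segmentSimplex_vertex_one, zsmul_eq_mul] at h0
  simp [deckVector, halfTurn, Real.pi_ne_zero] at h0
  exact h0

/-- The boundaries of chains in the complement of the axis. -/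
def axisBoundaries : Submodule ℤ (SingularChain R3 1) :=
  (chainsIn axisComplement 2).map (singularBoundary R3 1)

/-- Cycles in the vector space `ℂ × ℝ` bound, so relations between loops can be checked on end
points of their lifts. -/
theorem chainMap_mem_axisBoundaries {c : SingularChain (ℂ × ℝ) 1}
    (hc : singularBoundary _ 0 c = 0) : chainMap cylinderCover 1 c ∈ axisBoundaries := by
  obtain ⟨s, -, rfl⟩ := (starConvex_univ (𝕜 := ℝ) (0 : ℂ × ℝ)).exists_boundary_eq
    (z := c) (by simp) hc
  exact ⟨chainMap cylinderCover 2 s, chainMap_cylinderCover_mem s, chainMap_boundary _ _ _⟩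

theorem chainMap_translate_deckVector (k : ℤ) (a b : ℂ × ℝ) :
    chainMap cylinderCover 1 (segmentChain (a + deckVector k) (b + deckVector k)) =
      chainMap cylinderCover 1 (segmentChain a b) := by
  rw [chainMap_single, chainMap_single]
  congr 1
  ext1 y
  have : segmentSimplex (a + deckVector k) (b + deckVector k) y =
      segmentSimplex a b y + deckVector k := by
    change y 0 • (a + deckVector k) + y 1 • (b + deckVector k) = y 0 • a + y 1 • b + deckVector k
    have h : (y 0 + y 1) • deckVector k = deckVector k := by
      rw [stdSimplex.add_eq_one, one_smul]
    rw [add_smul] at h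
    nth_rewrite 3 [← h]
    rw [smul_add, smul_add]
    abel
  rw [ContinuousMap.comp_apply, ContinuousMap.comp_apply, this, cylinderCover_add_deckVector]

theorem deckVector_add (k l : ℤ) : deckVector (k + l) = deckVector k + deckVector l := by
  simp [deckVector, add_mul]

theorem deckVector_zero : deckVector 0 = 0 := by simp [deckVector]

/-- The segment from `0` to `deckVector k` projects to a loop of winding number `k`. Modulo
boundaries these loops are additive in `k`: translating a segment by a deck vector does not change
its image, and the resulting triangles close up in the covering. -/
theorem segment_deckVector_mem (k : ℤ) :
    chainMap cylinderCover 1 (segmentChain 0 (deckVector k)) - k • equatorChain ∈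
      axisBoundaries := by
  set B := axisBoundaries
  let L (k : ℤ) := chainMap cylinderCover 1 (segmentChain 0 (deckVector k))
  have h0 : L 0 ∈ B := chainMap_mem_axisBoundaries (by
    rw [boundary_segmentChain, deckVector_zero, sub_self])
  have h1 : L 1 - equatorChain ∈ B := by
    rw [equatorChain, ← map_sub]
    refine chainMap_mem_axisBoundaries ?_
    simp only [map_sub, map_add, boundary_segmentChain]
    abel
  have hadd (k : ℤ) : L (k + 1) - L k - L 1 ∈ B := by
    have : L 1 = chainMap cylinderCover 1 (segmentChain (deckVector k) (deckVector (k + 1))) := by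
      have := chainMap_translate_deckVector k 0 (deckVector 1)
      rw [zero_add, ← deckVector_add, add_comm (1 : ℤ) k] at this
      exact this.symm
    rw [this, ← map_sub, ← map_sub]
    refine chainMap_mem_axisBoundaries ?_
    simp only [map_sub, boundary_segmentChain]
    abel
  change L k - k • equatorChain ∈ B
  induction k using Int.induction_on with
  | zero => simpa using h0
  | succ i ih =>
    have := B.add_mem (B.add_mem (hadd i) h1) ih
    convert this using 1
    rw [add_smul, one_smul]
    abel
  | pred i ih =>
    have := B.sub_mem (B.sub_mem ih (hadd (-i - 1))) h1
    convert this using 1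
    rw [sub_smul, one_smul, sub_add_cancel]
    abel

/-- The first homology of the complement of the axis is generated by the circle. -/
theorem exists_eq_zsmul_equatorChain {z : SingularChain R3 1} (hz : z ∈ chainsIn axisComplement 1)
    (h : singularBoundary R3 0 z = 0) :
    ∃ n : ℤ, ∃ s ∈ chainsIn axisComplement 2,
      z = n • equatorChain + singularBoundary R3 1 s := by
  classical
  -- A lift of each point off the axis, without any continuity; the value `0` on the axis plays no
  -- role.
  let l (v : R3) : ℂ × ℝ := if hv : v ∈ axisComplement then (exists_cylinderCover_eq hv).choose
    else 0
  have hl {v : R3} (hv : v ∈ axisComplement) : cylinderCover (l v) = v := by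
    simp only [l, dif_pos hv]
    exact (exists_cylinderCover_eq hv).choose_spec
  let D : SingularChain R3 0 →ₗ[ℤ] SingularChain R3 1 := Finsupp.linearCombination ℤ fun σ =>
    chainMap cylinderCover 1 (segmentChain 0 (l (σ (stdSimplex.vertex 0))))
  have hD (v : R3) : D (Finsupp.single (pointSimplex v) 1) =
      chainMap cylinderCover 1 (segmentChain 0 (l v)) := by simp [D]
  -- `D` joins a base point to each vertex, so `id - D∂` turns a `1`-simplex into a loop, while it
  -- fixes the cycle `z`. It remains to treat these loops.
  have key : (LinearMap.id - D ∘ₗ singularBoundary R3 0 :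
      SingularChain R3 1 →ₗ[ℤ] SingularChain R3 1) z ∈
      axisBoundaries ⊔ Submodule.span ℤ {equatorChain} := by
    refine map_mem_of_chainsIn _ _ (fun σ hσ => ?_) hz
    set x := σ (stdSimplex.vertex 0)
    set y := σ (stdSimplex.vertex 1)
    obtain ⟨τ, hτ, hτ0⟩ := exists_cylinder_lift hσ (hl (hσ (stdSimplex.vertex 0)))
    have hτ1 : cylinderCover (τ (stdSimplex.vertex 1)) = cylinderCover (l y) := by
      rw [hl (hσ _), ← hτ]; rfl
    obtain ⟨k, hk⟩ := cylinderCover_eq_cylinderCover hτ1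
    -- The lifted loop goes from `0` through `l x` along `τ` to `l y + deckVector k`, then back
    -- along the translated path to `deckVector k`; the last segment closes it.
    let c : SingularChain (ℂ × ℝ) 1 := Finsupp.single τ 1 + segmentChain 0 (l x) -
      segmentChain (0 + deckVector k) (l y + deckVector k) - segmentChain 0 (deckVector k)
    have hc : singularBoundary _ 0 c = 0 := by
      simp only [c, map_sub, map_add, singularBoundary_one, segmentSimplex_vertex_zero,
        segmentSimplex_vertex_one, hk, hτ0, zero_add (deckVector k)]
      abel
    have h1 := chainMap_mem_axisBoundaries hc
    simp only [c, map_sub, map_add, chainMap_translate_deckVector] at h1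
    rw [chainMap_single (σ := τ), hτ] at h1
    have h2 := axisBoundaries.add_mem h1 (segment_deckVector_mem k)
    simp only [LinearMap.sub_apply, LinearMap.id_apply, LinearMap.comp_apply]
    rw [singularBoundary_one, map_sub, hD, hD]
    refine Submodule.mem_sup.mpr ⟨_, h2, k • equatorChain,
      Submodule.smul_mem _ _ (Submodule.mem_span_singleton_self _), ?_⟩
    abel
  rw [LinearMap.sub_apply, LinearMap.comp_apply, h, map_zero, sub_zero, LinearMap.id_apply] at key
  obtain ⟨_, ⟨s, hs, rfl⟩, _, hq, rfl⟩ := Submodule.mem_sup.mp key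
  obtain ⟨n, rfl⟩ := Submodule.mem_span_singleton.mp hq
  exact ⟨n, s, hs, add_comm _ _⟩

theorem exists_boundary_eq_axisComplement {z : SingularChain R3 0}
    (hz : z ∈ chainsIn axisComplement 0) (h : augmentation R3 0 z = 0) :
    ∃ s ∈ chainsIn axisComplement 1, singularBoundary R3 0 s = z := by
  obtain ⟨c, rfl⟩ := exists_chainMap_cylinderCover hz
  rw [augmentation_chainMap] at h
  obtain ⟨s, -, rfl⟩ := (starConvex_univ (𝕜 := ℝ) (0 : ℂ × ℝ)).exists_boundary_eq_zero
    (z := c) (by simp) h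
  exact ⟨chainMap cylinderCover 1 s, chainMap_cylinderCover_mem s, chainMap_boundary _ _ _⟩

/-! ### Homology of the punctured space -/

/-- The complement of the lower half of the vertical axis. -/
def upperRegion : Set R3 := {v | v ∈ axisComplement ∨ 0 < v 2}

/-- The complement of the upper half of the vertical axis. -/
def lowerRegion : Set R3 := {v | v ∈ axisComplement ∨ v 2 < 0}

theorem continuous_coordinate (i : Fin 3) : Continuous fun v : R3 => v i :=
  (EuclideanSpace.proj (𝕜 := ℝ) i).continuous

theorem isOpen_axisComplement : IsOpen axisComplement :=
  (isOpen_ne.preimage (continuous_coordinate 0)).union (isOpen_ne.preimage (continuous_coordinate 1))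

theorem isOpen_upperRegion : IsOpen upperRegion :=
  isOpen_axisComplement.union (isOpen_Ioi.preimage (continuous_coordinate 2))

theorem isOpen_lowerRegion : IsOpen lowerRegion :=
  isOpen_axisComplement.union (isOpen_Iio.preimage (continuous_coordinate 2))

theorem upperRegion_inter_lowerRegion : upperRegion ∩ lowerRegion = axisComplement := by
  ext v
  constructor
  · rintro ⟨h | h, h' | h'⟩
    exacts [h, h, h', absurd h h'.not_gt]
  · exact fun h => ⟨Or.inl h, Or.inl h⟩

theorem upperRegion_union_lowerRegion : upperRegion ∪ lowerRegion = {0}ᶜ := by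
  ext v
  simp only [upperRegion, lowerRegion, axisComplement, Set.mem_union, Set.mem_ofPred_eq,
    Set.mem_compl_iff, Set.mem_singleton_iff]
  have : v = 0 ↔ v 0 = 0 ∧ v 1 = 0 ∧ v 2 = 0 := by
    rw [PiLp.ext_iff, Fin.forall_fin_succ, Fin.forall_fin_two]
    rfl
  rw [this]
  have : 0 < v 2 ∨ v 2 < 0 ↔ v 2 ≠ 0 := or_comm.trans lt_or_lt_iff_ne
  tauto

/-- The north pole `(0, 0, 1)`. -/
def northPole : R3 := EuclideanSpace.single 2 1

@[simp] theorem northPole_zero : northPole 0 = 0 := by simp [northPole]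

@[simp] theorem northPole_one : northPole 1 = 0 := by simp [northPole]

@[simp] theorem northPole_two : northPole 2 = 1 := by simp [northPole]

theorem starConvex_upperRegion : StarConvex ℝ northPole upperRegion := by
  intro v hv a b ha hb hab
  simp only [upperRegion, axisComplement, Set.mem_ofPred_eq, PiLp.add_apply, PiLp.smul_apply,
    northPole_zero, northPole_one, northPole_two, smul_eq_mul, mul_zero, zero_add, mul_one,
    mul_ne_zero_iff] at hv ⊢
  rcases hb.eq_or_lt with rfl | hb
  · right; linarith
  · rcases hv with (h | h) | h
    · exact Or.inl (Or.inl ⟨hb.ne', h⟩)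
    · exact Or.inl (Or.inr ⟨hb.ne', h⟩)
    · right; positivity

theorem neg_mem_lowerRegion {v : R3} : -v ∈ lowerRegion ↔ v ∈ upperRegion := by
  simp [lowerRegion, upperRegion, axisComplement]

theorem starConvex_lowerRegion : StarConvex ℝ (-northPole) lowerRegion := by
  have : lowerRegion = -upperRegion := by
    ext v
    rw [Set.mem_neg, ← neg_mem_lowerRegion, neg_neg]
  rw [this]
  exact starConvex_upperRegion.neg

theorem upperRegion_subset : upperRegion ⊆ {0}ᶜ :=
  upperRegion_union_lowerRegion ▸ Set.subset_union_left

theorem lowerRegion_subset : lowerRegion ⊆ {0}ᶜ :=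
  upperRegion_union_lowerRegion ▸ Set.subset_union_right

theorem mem_chainsIn_axisComplement {n : ℕ} {z : SingularChain R3 n}
    (hU : z ∈ chainsIn upperRegion n) (hV : z ∈ chainsIn lowerRegion n) :
    z ∈ chainsIn axisComplement n :=
  upperRegion_inter_lowerRegion ▸ mem_chainsIn_inter hU hV

theorem chainsIn_axisComplement_le_upper (n : ℕ) :
    chainsIn axisComplement n ≤ chainsIn upperRegion n := chainsIn_mono (fun _ => Or.inl) n

theorem chainsIn_axisComplement_le_lower (n : ℕ) :
    chainsIn axisComplement n ≤ chainsIn lowerRegion n := chainsIn_mono (fun _ => Or.inl) n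

theorem exists_boundary_eq_add {n : ℕ} {u v : SingularChain R3 (n + 1)}
    (hu : u ∈ chainsIn upperRegion (n + 1)) (hv : v ∈ chainsIn lowerRegion (n + 1))
    (hu' : singularBoundary R3 n u = 0) (hv' : singularBoundary R3 n v = 0) :
    ∃ s ∈ chainsIn {0}ᶜ (n + 2), singularBoundary R3 (n + 1) s = u + v := by
  obtain ⟨a, ha, rfl⟩ := starConvex_upperRegion.exists_boundary_eq hu hu'
  obtain ⟨b, hb, rfl⟩ := starConvex_lowerRegion.exists_boundary_eq hv hv'
  exact ⟨a + b, add_mem (chainsIn_mono upperRegion_subset _ ha)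
    (chainsIn_mono lowerRegion_subset _ hb), map_add _ _ _⟩

/-- The connecting map of Mayer–Vietoris: after subdivision a cycle splits as `u + v`, and `∂u =
-∂v` lies in both regions. -/
theorem exists_eq_add_boundary {n : ℕ} {z : SingularChain R3 (n + 1)}
    (hz : z ∈ chainsIn {0}ᶜ (n + 1)) (h : singularBoundary R3 n z = 0) :
    ∃ u ∈ chainsIn upperRegion (n + 1), ∃ v ∈ chainsIn lowerRegion (n + 1),
      ∃ s ∈ chainsIn {0}ᶜ (n + 2), z = u + v + singularBoundary R3 (n + 1) s ∧
        singularBoundary R3 n u ∈ chainsIn axisComplement n ∧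
        singularBoundary R3 n v = -singularBoundary R3 n u := by
  obtain ⟨T, hT, hz'⟩ := exists_homotopy_mem_sup isOpen_upperRegion isOpen_lowerRegion
    upperRegion_union_lowerRegion.ge hz
  rw [h, map_zero, sub_zero] at hz'
  obtain ⟨u, hu, v, hv, huv⟩ := Submodule.mem_sup.mp hz'
  have hv' : singularBoundary R3 n v = -singularBoundary R3 n u := by
    have := congrArg (singularBoundary R3 n) huv
    rw [map_add, map_sub, h, singularBoundary_singularBoundary, sub_zero] at this
    exact eq_neg_of_add_eq_zero_right this
  refine ⟨u, hu, v, hv, T _ z, hT _ _ _ hz, by rw [huv]; abel, ?_, hv'⟩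
  refine mem_chainsIn_axisComplement (boundary_mem_chainsIn hu) ?_
  rw [← neg_neg (singularBoundary R3 n u), ← hv']
  exact neg_mem (boundary_mem_chainsIn hv)

theorem punctured_exists_boundary_eq_zero {z : SingularChain R3 0} (hz : z ∈ chainsIn {0}ᶜ 0)
    (h : augmentation R3 0 z = 0) :
    ∃ s ∈ chainsIn {0}ᶜ 1, singularBoundary R3 0 s = z := by
  have hz' : z ∈ chainsIn upperRegion 0 ⊔ chainsIn lowerRegion 0 := by
    refine map_mem_of_chainsIn LinearMap.id _ (fun σ hσ => ?_) hz
    have hσ' (y) : σ y = σ (stdSimplex.vertex 0) := congrArg σ (Subsingleton.elim _ _)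
    rcases upperRegion_union_lowerRegion.ge (hσ (stdSimplex.vertex 0)) with h | h
    · exact Submodule.mem_sup_left (single_mem_chainsIn (fun y => by rwa [hσ']) _)
    · exact Submodule.mem_sup_right (single_mem_chainsIn (fun y => by rwa [hσ']) _)
  obtain ⟨u, hu, v, hv, rfl⟩ := Submodule.mem_sup.mp hz'
  rw [map_add] at h
  -- A multiple of a point of the intersection, moved between the summands so that both have
  -- augmentation zero. In degree zero no subdivision is needed, as each simplex is a point.
  let c : SingularChain R3 0 :=
    Finsupp.single (pointSimplex (cylinderCover 0)) (augmentation R3 0 u)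
  have hc : c ∈ chainsIn axisComplement 0 := single_mem_chainsIn (fun _ => cylinderCover_mem _) _
  obtain ⟨a, ha, ha'⟩ := starConvex_upperRegion.exists_boundary_eq_zero
    (sub_mem hu (chainsIn_axisComplement_le_upper 0 hc)) (by simp [c])
  obtain ⟨b, hb, hb'⟩ := starConvex_lowerRegion.exists_boundary_eq_zero
    (add_mem hv (chainsIn_axisComplement_le_lower 0 hc)) (by simpa [c, add_comm] using h)
  exact ⟨a + b, add_mem (chainsIn_mono upperRegion_subset _ ha)
    (chainsIn_mono lowerRegion_subset _ hb), by rw [map_add, ha', hb']; abel⟩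

/-- The connecting cycle `∂u` has augmentation zero in the path connected intersection, so it bounds
some `w` there. Then `u - w` and `v + w` are cycles in the acyclic regions. -/
theorem punctured_exists_boundary_eq_one {z : SingularChain R3 1} (hz : z ∈ chainsIn {0}ᶜ 1)
    (h : singularBoundary R3 0 z = 0) :
    ∃ s ∈ chainsIn {0}ᶜ 2, singularBoundary R3 1 s = z := by
  obtain ⟨u, hu, v, hv, t, ht, rfl, hw, huv⟩ := exists_eq_add_boundary hz h
  obtain ⟨w, hw, hw'⟩ := exists_boundary_eq_axisComplement hw (augmentation_boundary u)
  obtain ⟨s, hs, hs'⟩ := exists_boundary_eq_add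
    (sub_mem hu (chainsIn_axisComplement_le_upper 1 hw))
    (add_mem hv (chainsIn_axisComplement_le_lower 1 hw))
    (by rw [map_sub, hw', sub_self]) (by rw [map_add, hw', huv, neg_add_cancel])
  exact ⟨s + t, add_mem hs ht, by rw [map_add, hs']; abel⟩

/-- The connecting cycle is `n` times the equator plus some `∂w`. Subtracting `w + n • a` from `u`
and adding `w + n • b` to `v` leaves cycles in the acyclic regions. -/
theorem punctured_exists_eq_zsmul {a b : SingularChain R3 2} (ha : a ∈ chainsIn upperRegion 2)
    (hb : b ∈ chainsIn lowerRegion 2) (ha' : singularBoundary R3 1 a = equatorChain)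
    (hb' : singularBoundary R3 1 b = equatorChain)
    {z : SingularChain R3 2} (hz : z ∈ chainsIn {0}ᶜ 2)
    (h : singularBoundary R3 1 z = 0) :
    ∃ n : ℤ, ∃ s ∈ chainsIn {0}ᶜ 3, z = n • (a - b) + singularBoundary R3 2 s := by
  obtain ⟨u, hu, v, hv, t, ht, rfl, hw, huv⟩ := exists_eq_add_boundary hz h
  obtain ⟨n, w, hw, hw'⟩ := exists_eq_zsmul_equatorChain hw (singularBoundary_singularBoundary _ _)
  obtain ⟨s, hs, hs'⟩ := exists_boundary_eq_add
    (sub_mem (sub_mem hu (chainsIn_axisComplement_le_upper 2 hw)) (Submodule.smul_mem _ n ha))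
    (add_mem (add_mem hv (chainsIn_axisComplement_le_lower 2 hw)) (Submodule.smul_mem _ n hb))
    (by rw [map_sub, map_sub, map_smul, ha', hw']; abel)
    (by rw [map_add, map_add, map_smul, hb', huv, hw']; abel)
  exact ⟨n, s + t, add_mem hs ht, by rw [map_add, hs', smul_sub]; abel⟩

/-- Splitting `s` after subdivision and sorting the terms by region yields a chain `w` that lies in
both regions and has boundary `n` times the equator; the winding number gives `n = 0`. -/
theorem punctured_zsmul_boundary {a b : SingularChain R3 2} (ha : a ∈ chainsIn upperRegion 2)
    (hb : b ∈ chainsIn lowerRegion 2) (ha' : singularBoundary R3 1 a = equatorChain)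
    {n : ℤ} {s : SingularChain R3 3} (hs : s ∈ chainsIn {0}ᶜ 3)
    (h : singularBoundary R3 2 s = n • (a - b)) : n = 0 := by
  obtain ⟨T, hT, hz'⟩ := exists_homotopy_mem_sup isOpen_upperRegion isOpen_lowerRegion
    upperRegion_union_lowerRegion.ge hs
  obtain ⟨u, hu, v, hv, huv⟩ := Submodule.mem_sup.mp hz'
  have h1 := congrArg (singularBoundary R3 2) huv
  rw [map_add, map_sub, map_sub, singularBoundary_singularBoundary, sub_zero, h, map_smul, map_smul,
    map_sub, map_sub] at h1
  set w := n • a - n • singularBoundary R3 2 (T 2 a) - singularBoundary R3 2 u with hw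
  have hw' : w = n • b - n • singularBoundary R3 2 (T 2 b) + singularBoundary R3 2 v := by
    rw [hw, ← sub_eq_zero]
    rw [← sub_eq_zero] at h1
    rw [← neg_eq_zero, ← h1, smul_sub, smul_sub]
    abel
  have hwU : w ∈ chainsIn upperRegion 2 :=
    sub_mem (sub_mem (Submodule.smul_mem _ n ha) (Submodule.smul_mem _ n
      (boundary_mem_chainsIn (hT _ _ _ ha)))) (boundary_mem_chainsIn hu)
  have hwV : w ∈ chainsIn lowerRegion 2 := hw' ▸
    add_mem (sub_mem (Submodule.smul_mem _ n hb) (Submodule.smul_mem _ n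
      (boundary_mem_chainsIn (hT _ _ _ hb)))) (boundary_mem_chainsIn hv)
  refine zsmul_equatorChain_boundary (mem_chainsIn_axisComplement hwU hwV) ?_
  rw [hw, map_sub, map_sub, map_smul, map_smul, singularBoundary_singularBoundary,
    singularBoundary_singularBoundary, ha', smul_zero, sub_zero, sub_zero]

/-! ### Equivariant choices -/

section EquivariantChoice

variable {G E : Type*} [Group G] [TopologicalSpace E] [MulAction G E] [ContinuousConstSMul G E]

theorem singularRep_apply (g : G) {n : ℕ} (z : SingularChain E n) :
    singularRep G E n g z = chainMap ⟨fun x => g • x, continuous_const_smul g⟩ n z := rfl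

theorem singularRep_single (g : G) {n : ℕ} (σ : C(TopSimplex n, E)) (a : ℤ) :
    singularRep G E n g (Finsupp.single σ a) = Finsupp.single (g • σ) a := by
  simp [singularRep, Finsupp.mapDomain_single]

theorem boundary_singularRep (g : G) {n : ℕ} (z : SingularChain E (n + 1)) :
    singularBoundary E n (singularRep G E (n + 1) g z) =
      singularRep G E n g (singularBoundary E n z) := by
  rw [singularRep_apply, singularRep_apply, chainMap_boundary]

theorem augmentation_singularRep (g : G) {n : ℕ} (z : SingularChain E n) :
    augmentation E n (singularRep G E n g z) = augmentation E n z := by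
  rw [singularRep_apply, augmentation_chainMap]

/-- For a free action, an equivariant family of conditions on the values on simplices that can be
satisfied simplexwise can be satisfied by an equivariant map. -/
theorem exists_intertwiningMap {n : ℕ} {M : Type*} [AddCommGroup M] (ρ : Representation ℤ G M)
    (hfree : ∀ (g : G) (x : E), g • x = x → g = 1) (P : C(TopSimplex n, E) → M → Prop)
    (hP : ∀ σ, ∃ m, P σ m) (hg : ∀ g σ m, P σ m → P (g • σ) (ρ g m)) :
    ∃ f : IntertwiningMap (singularRep G E n) ρ, ∀ σ, P σ (f (Finsupp.single σ 1)) := by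
  choose m hm using hP
  -- One representative per orbit; by freeness exactly one group element carries it to a given
  -- simplex, and values are transported by that element.
  let r (σ : C(TopSimplex n, E)) : C(TopSimplex n, E) :=
    (Quotient.mk (MulAction.orbitRel G C(TopSimplex n, E)) σ).out
  have hr (σ) : ∃ g : G, g • r σ = σ := by
    have := Quotient.mk_out (s := MulAction.orbitRel G C(TopSimplex n, E)) σ
    exact MulAction.mem_orbit_iff.mp ((MulAction.orbitRel G _).symm this)
  choose g hgr using hr
  have hr' (h : G) (σ) : r (h • σ) = r σ :=
    congrArg Quotient.out (Quotient.sound (s := MulAction.orbitRel G _) ⟨h, rfl⟩)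
  have hgg (h : G) (σ) : g (h • σ) = h * g σ := by
    have h1 : g (h • σ) • r σ = (h * g σ) • r σ := by
      rw [← hr' h σ, hgr, hr', mul_smul, hgr]
    have h2 := hfree ((h * g σ)⁻¹ * g (h • σ)) (r σ (stdSimplex.vertex 0)) (by
      rw [mul_smul, inv_smul_eq_iff]
      exact congrArg (fun τ : C(TopSimplex n, E) => τ (stdSimplex.vertex 0)) h1)
    exact (inv_mul_eq_one.mp h2).symm
  let f : SingularChain E n →ₗ[ℤ] M := Finsupp.linearCombination ℤ fun σ => ρ (g σ) (m (r σ))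
  refine ⟨⟨f, fun h => ?_⟩, fun σ => ?_⟩
  · refine Finsupp.lhom_ext' fun σ => LinearMap.ext_ring ?_
    simp only [LinearMap.comp_apply, Finsupp.lsingle_apply, singularRep_single]
    simp [f, hgg, hr']
  · have h1 : f (Finsupp.single σ 1) = ρ (g σ) (m (r σ)) := by simp [f]
    change P σ (f (Finsupp.single σ 1))
    rw [h1]
    have := hg (g σ) (r σ) _ (hm (r σ))
    rwa [hgr] at this

end EquivariantChoice

/-! ### The cellular chain complex -/

theorem cellBoundary₁_apply (x : MonoidAlgebra ℤ ℤˣ) : cellBoundary₁ x = x * (cellT - 1) := rfl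

theorem cellBoundary₂_apply (x : MonoidAlgebra ℤ ℤˣ) : cellBoundary₂ x = x * (1 + cellT) := rfl

theorem cellT_mul_cellT : cellT * cellT = 1 := by
  rw [MonoidAlgebra.single_mul_single, MonoidAlgebra.one_def]
  simp

theorem exists_eq_zsmul_add_zsmul (x : MonoidAlgebra ℤ ℤˣ) :
    ∃ m n : ℤ, x = m • 1 + n • cellT := by
  induction x using MonoidAlgebra.induction_linear with
  | zero => exact ⟨0, 0, by simp⟩
  | add x y hx hy =>
    obtain ⟨m, n, rfl⟩ := hx
    obtain ⟨m', n', rfl⟩ := hy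
    exact ⟨m + m', n + n', by rw [add_smul, add_smul]; abel⟩
  | single u r =>
    rcases Int.units_eq_one_or u with rfl | rfl
    · exact ⟨r, 0, by simp [MonoidAlgebra.one_def]⟩
    · exact ⟨0, r, by simp⟩

theorem zsmul_add_zsmul_eq_zero {m n : ℤ}
    (h : m • (1 : MonoidAlgebra ℤ ℤˣ) + n • cellT = 0) : m = 0 ∧ n = 0 := by
  have h1 := congrArg (fun x : MonoidAlgebra ℤ ℤˣ => x.coeff 1) h
  have h2 := congrArg (fun x : MonoidAlgebra ℤ ℤˣ => x.coeff (-1)) h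
  simp [MonoidAlgebra.one_def] at h1 h2
  exact ⟨h1, h2⟩

theorem cellRep_neg_one (x : MonoidAlgebra ℤ ℤˣ) : cellRep (-1) x = x * cellT := by
  obtain ⟨m, n, rfl⟩ := exists_eq_zsmul_add_zsmul x
  have h1 : cellRep (-1) (1 : MonoidAlgebra ℤ ℤˣ) = cellT := by
    simp [MonoidAlgebra.one_def]
  have h2 : cellRep (-1) cellT = 1 := by
    simp [MonoidAlgebra.one_def]
  rw [map_add, map_zsmul, map_zsmul, h1, h2, add_mul, smul_mul_assoc, smul_mul_assoc, one_mul,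
    cellT_mul_cellT]

/-- In `ℤ[{1, t}]` the annihilator of `t - 1` is generated by the norm element `1 + t`. -/
theorem exists_of_cellBoundary₁_eq_zero {x : MonoidAlgebra ℤ ℤˣ} (h : cellBoundary₁ x = 0) :
    ∃ y, cellBoundary₂ y = x := by
  obtain ⟨m, n, rfl⟩ := exists_eq_zsmul_add_zsmul x
  have h' : (n - m) • (1 : MonoidAlgebra ℤ ℤˣ) + (m - n) • cellT = 0 := by
    rw [← h, cellBoundary₁_apply, add_mul, smul_mul_assoc, smul_mul_assoc, one_mul, mul_sub,
      cellT_mul_cellT, mul_one]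
    module
  obtain rfl := sub_eq_zero.mp (zsmul_add_zsmul_eq_zero h').1
  exact ⟨n • 1, by rw [cellBoundary₂_apply, smul_mul_assoc, one_mul, smul_add]⟩

/-- The annihilator of `1 + t` consists of the multiples of `1 - t`, the fundamental cycle `e²₊ -
e²₋` of the sphere. -/
theorem exists_of_cellBoundary₂_eq_zero {x : MonoidAlgebra ℤ ℤˣ} (h : cellBoundary₂ x = 0) :
    ∃ n : ℤ, x = n • (1 - cellT) := by
  obtain ⟨m, n, rfl⟩ := exists_eq_zsmul_add_zsmul x
  have h' : (m + n) • (1 : MonoidAlgebra ℤ ℤˣ) + (m + n) • cellT = 0 := by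
    rw [← h, cellBoundary₂_apply, add_mul, smul_mul_assoc, smul_mul_assoc, one_mul, mul_add,
      cellT_mul_cellT, mul_one]
    module
  obtain rfl := eq_neg_of_add_eq_zero_right (zsmul_add_zsmul_eq_zero h').1
  exact ⟨m, by module⟩

theorem cellBoundary₂_one_sub_cellT : cellBoundary₂ (1 - cellT) = 0 := by
  rw [cellBoundary₂_apply, sub_mul, one_mul, mul_add, cellT_mul_cellT]
  simp [add_comm]

/-! ### Spaces with the homology of the cellular chain complex -/

section CellularModel

variable (E : Type*) [TopologicalSpace E] [MulAction ℤˣ E] [ContinuousConstSMul ℤˣ E]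

/-- A chain map from the cellular chain complex of the two-sphere to the singular chain complex of
a space with a free action of `{1, -1}`, that induces isomorphisms in homology up to degree two. -/
structure CellularModel where
  map₀ : IntertwiningMap cellRep (singularRep ℤˣ E 0)
  map₁ : IntertwiningMap cellRep (singularRep ℤˣ E 1)
  map₂ : IntertwiningMap cellRep (singularRep ℤˣ E 2)
  comm₁ (x : MonoidAlgebra ℤ ℤˣ) : singularBoundary E 0 (map₁ x) = map₀ (cellBoundary₁ x)
  comm₂ (x : MonoidAlgebra ℤ ℤˣ) : singularBoundary E 1 (map₂ x) = map₁ (cellBoundary₂ x)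
  aug : augmentation E 0 (map₀ 1) = 1
  free (g : ℤˣ) (x : E) : g • x = x → g = 1
  exact₀ (z : SingularChain E 0) : augmentation E 0 z = 0 → ∃ s, singularBoundary E 0 s = z
  exact₁ (z : SingularChain E 1) : singularBoundary E 0 z = 0 → ∃ s, singularBoundary E 1 s = z
  exact₂ (z : SingularChain E 2) : singularBoundary E 1 z = 0 →
    ∃ n : ℤ, ∃ s, z = n • map₂ (1 - cellT) + singularBoundary E 2 s
  injective₂ (n : ℤ) (s : SingularChain E 3) :
    singularBoundary E 2 s = n • map₂ (1 - cellT) → n = 0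

namespace CellularModel

variable {E} (S : CellularModel E)

theorem augmentation_map₀ (m n : ℤ) :
    augmentation E 0 (S.map₀ (m • 1 + n • cellT)) = m + n := by
  have h : S.map₀ cellT = singularRep ℤˣ E 0 (-1) (S.map₀ 1) := by
    rw [← S.map₀.isIntertwining, cellRep_neg_one, one_mul]
  rw [map_add, map_zsmul, map_zsmul, map_add, map_zsmul, map_zsmul, h, augmentation_singularRep,
    S.aug]
  simp

theorem exists_of_augmentation_eq_zero {x : MonoidAlgebra ℤ ℤˣ}
    (h : augmentation E 0 (S.map₀ x) = 0) : ∃ y, cellBoundary₁ y = x := by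
  obtain ⟨m, n, rfl⟩ := exists_eq_zsmul_add_zsmul x
  rw [augmentation_map₀] at h
  obtain rfl := eq_neg_of_add_eq_zero_right h
  exact ⟨(-m) • 1, by rw [cellBoundary₁_apply, smul_mul_assoc, one_mul]; module⟩

/-- An equivariant homotopy inverse of the cellular chain map, in degrees at most one, with the
homotopy in degree zero. -/
theorem exists_retraction₁ : ∃ (s₀ : IntertwiningMap (singularRep ℤˣ E 0) (singularRep ℤˣ E 1))
    (r₀ : IntertwiningMap (singularRep ℤˣ E 0) cellRep)
    (r₁ : IntertwiningMap (singularRep ℤˣ E 1) cellRep),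
    (∀ z, singularBoundary E 0 (s₀ z) = z - S.map₀ (r₀ z)) ∧
    (∀ z, cellBoundary₁ (r₁ z) = r₀ (singularBoundary E 0 z)) := by
  -- Each choice only has to solve an equation for a single simplex. Preserving the augmentation
  -- makes the next two equations solvable.
  obtain ⟨r₀, hr₀⟩ := exists_intertwiningMap (n := 0) cellRep S.free
    (fun _ c => augmentation E 0 (S.map₀ c) = 1) (fun _ => ⟨1, S.aug⟩) (fun g _ c h => by
      rw [S.map₀.isIntertwining, augmentation_singularRep, h])
  have haug (z) : augmentation E 0 (S.map₀ (r₀ z)) = augmentation E 0 z := by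
    have : augmentation E 0 ∘ₗ S.map₀.toLinearMap ∘ₗ r₀.toLinearMap = augmentation E 0 := by
      refine Finsupp.lhom_ext' fun σ => LinearMap.ext_ring ?_
      simpa using hr₀ σ
    exact LinearMap.congr_fun this z
  obtain ⟨s₀, hs₀⟩ := exists_intertwiningMap (n := 0) (singularRep ℤˣ E 1) S.free
    (fun σ s => singularBoundary E 0 s =
      Finsupp.single σ 1 - S.map₀ (r₀ (Finsupp.single σ 1)))
    (fun σ => S.exact₀ _ (by rw [map_sub, haug, sub_self])) (fun g σ s h => by
      rw [boundary_singularRep, h, map_sub, ← singularRep_single, r₀.isIntertwining,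
        S.map₀.isIntertwining])
  obtain ⟨r₁, hr₁⟩ := exists_intertwiningMap (n := 1) cellRep S.free
    (fun σ c => cellBoundary₁ c = r₀ (singularBoundary E 0 (Finsupp.single σ 1)))
    (fun σ => S.exists_of_augmentation_eq_zero (by rw [haug, augmentation_boundary]))
    (fun g σ c h => by
      rw [cellBoundary₁.isIntertwining, h, ← singularRep_single, boundary_singularRep,
        r₀.isIntertwining])
  refine ⟨s₀, r₀, r₁, fun z => ?_, fun z => ?_⟩
  · have : singularBoundary E 0 ∘ₗ s₀.toLinearMap =
        LinearMap.id - S.map₀.toLinearMap ∘ₗ r₀.toLinearMap := by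
      refine Finsupp.lhom_ext' fun σ => LinearMap.ext_ring ?_
      simpa using hs₀ σ
    exact LinearMap.congr_fun this z
  · have : cellBoundary₁.toLinearMap ∘ₗ r₁.toLinearMap =
        r₀.toLinearMap ∘ₗ singularBoundary E 0 := by
      refine Finsupp.lhom_ext' fun σ => LinearMap.ext_ring ?_
      exact hr₁ σ
    exact LinearMap.congr_fun this z

/-- The degree two part of an equivariant homotopy inverse of the cellular chain map. -/
theorem exists_retraction₂ : ∃ (s₁ : IntertwiningMap (singularRep ℤˣ E 1) (singularRep ℤˣ E 2))
    (r₂ : IntertwiningMap (singularRep ℤˣ E 2) cellRep),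
    (∀ z, ∃ w, z = s₁ (singularBoundary E 1 z) + S.map₂ (r₂ z) + singularBoundary E 2 w) ∧
    (∀ z, singularBoundary E 1 z = 0 → cellBoundary₂ (r₂ z) = 0) := by
  obtain ⟨s₀, r₀, r₁, hs₀, hr₁⟩ := S.exists_retraction₁
  -- The prescribed boundary is a cycle by the identities one degree lower, so vanishing of the
  -- first homology solves the equation.
  obtain ⟨s₁, hs₁⟩ := exists_intertwiningMap (n := 1) (singularRep ℤˣ E 2) S.free
    (fun σ s => singularBoundary E 1 s = Finsupp.single σ 1 -
      s₀ (singularBoundary E 0 (Finsupp.single σ 1)) - S.map₁ (r₁ (Finsupp.single σ 1)))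
    (fun σ => S.exact₁ _ (by rw [map_sub, map_sub, hs₀, S.comm₁, hr₁]; abel))
    (fun g σ s h => by
      rw [boundary_singularRep, h, map_sub, map_sub, ← singularRep_single, r₁.isIntertwining,
        S.map₁.isIntertwining, boundary_singularRep, s₀.isIntertwining])
  have hs₁' (z) : singularBoundary E 1 (s₁ z) =
      z - s₀ (singularBoundary E 0 z) - S.map₁ (r₁ z) := by
    have : singularBoundary E 1 ∘ₗ s₁.toLinearMap = LinearMap.id -
        s₀.toLinearMap ∘ₗ singularBoundary E 0 - S.map₁.toLinearMap ∘ₗ r₁.toLinearMap := by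
      refine Finsupp.lhom_ext' fun σ => LinearMap.ext_ring ?_
      exact hs₁ σ
    exact LinearMap.congr_fun this z
  obtain ⟨r₂, hr₂⟩ := exists_intertwiningMap (n := 2) cellRep S.free
    (fun σ c => cellBoundary₂ c = r₁ (singularBoundary E 1 (Finsupp.single σ 1)) ∧
      ∃ w, Finsupp.single σ 1 = s₁ (singularBoundary E 1 (Finsupp.single σ 1)) + S.map₂ c +
        singularBoundary E 2 w)
    (fun σ => by
      set z : SingularChain E 2 := Finsupp.single σ 1
      obtain ⟨c, hc⟩ := exists_of_cellBoundary₁_eq_zero (x := r₁ (singularBoundary E 1 z))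
        (by rw [hr₁, singularBoundary_singularBoundary, map_zero])
      -- With only the boundary of `c` prescribed, the defect is a cycle, homologous to `n` times
      -- the fundamental cycle. Adding `n • (1 - cellT)` to `c` absorbs it without changing `∂₂c`.
      obtain ⟨n, w, hw⟩ := S.exact₂ (z - s₁ (singularBoundary E 1 z) - S.map₂ c) (by
        rw [map_sub, map_sub, hs₁', S.comm₂, hc, singularBoundary_singularBoundary, map_zero]
        abel)
      refine ⟨c + n • (1 - cellT), ?_, w, ?_⟩
      · rw [map_add, map_zsmul, cellBoundary₂_one_sub_cellT, smul_zero, add_zero, hc]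
      · rw [sub_sub, sub_eq_iff_eq_add] at hw
        rw [map_add, map_zsmul]
        refine hw.trans ?_
        abel)
    (fun g σ c h => by
      obtain ⟨h1, w, h2⟩ := h
      rw [← singularRep_single, boundary_singularRep, s₁.isIntertwining, r₁.isIntertwining,
        cellBoundary₂.isIntertwining, h1]
      refine ⟨rfl, singularRep ℤˣ E 3 g w, ?_⟩
      rw [boundary_singularRep, S.map₂.isIntertwining, ← map_add, ← map_add, ← h2])
  refine ⟨s₁, r₂, fun z => ?_, fun z hz => ?_⟩
  · have : (LinearMap.id - s₁.toLinearMap ∘ₗ singularBoundary E 1 -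
        S.map₂.toLinearMap ∘ₗ r₂.toLinearMap : SingularChain E 2 →ₗ[ℤ] SingularChain E 2) z ∈
        LinearMap.range (singularBoundary E 2) := by
      refine map_mem_of_chainsIn (X := Set.univ) _ _ (fun σ _ => ?_) (by simp)
      obtain ⟨-, w, hw⟩ := hr₂ σ
      refine ⟨w, ?_⟩
      simp only [LinearMap.sub_apply, LinearMap.comp_apply, LinearMap.id_apply,
        IntertwiningMap.toLinearMap_apply]
      nth_rewrite 1 [hw]
      abel
    obtain ⟨w, hw⟩ := this
    refine ⟨w, ?_⟩
    simp only [LinearMap.sub_apply, LinearMap.comp_apply, LinearMap.id_apply,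
      IntertwiningMap.toLinearMap_apply] at hw
    rw [hw]
    abel
  · have : cellBoundary₂.toLinearMap ∘ₗ r₂.toLinearMap =
        r₁.toLinearMap ∘ₗ singularBoundary E 1 := by
      refine Finsupp.lhom_ext' fun σ => LinearMap.ext_ring ?_
      exact (hr₂ σ).1
    have := LinearMap.congr_fun this z
    simp only [LinearMap.comp_apply, hz, map_zero] at this
    exact this

variable {A : Type*} [AddCommGroup A] {τ : Representation ℤ ℤˣ A}

/-- A cocycle that vanishes on the two-cell is a coboundary. -/
theorem mem_coboundaries_iff {φ : EquivariantCochain E τ 2} (hτ : ∀ a, τ (-1) a = -a)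
    (hφ : φ ∈ cocycles E τ 2) : φ ∈ coboundaries E τ 2 ↔ φ (S.map₂ 1) = 0 := by
  constructor
  · rintro ⟨ψ, rfl⟩
    change ψ (singularBoundary E 1 (S.map₂ 1)) = 0
    have h : S.map₁ cellT = singularRep ℤˣ E 1 (-1) (S.map₁ 1) := by
      rw [← S.map₁.isIntertwining, cellRep_neg_one, one_mul]
    rw [S.comm₂, cellBoundary₂_apply, one_mul, map_add, map_add, h, ψ.isIntertwining, hτ,
      add_neg_cancel]
  · intro h
    obtain ⟨s₁, r₂, hs, -⟩ := S.exists_retraction₂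
    -- In `z = s₁∂z + map₂ (r₂ z) + ∂w` the cocycle kills the last two terms, so `φ z = φ (s₁∂z)`.
    refine ⟨φ.comp s₁, ?_⟩
    have hδ (w) : φ (singularBoundary E 2 w) = 0 :=
      congrArg (fun f : EquivariantCochain E τ 3 => f w) (AddMonoidHom.mem_ker.mp hφ)
    have hcell (x) : φ (S.map₂ x) = 0 := by
      obtain ⟨m, n, rfl⟩ := exists_eq_zsmul_add_zsmul x
      have h' : S.map₂ cellT = singularRep ℤˣ E 2 (-1) (S.map₂ 1) := by
        rw [← S.map₂.isIntertwining, cellRep_neg_one, one_mul]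
      rw [map_add, map_add, map_zsmul, map_zsmul, map_zsmul, map_zsmul, h', φ.isIntertwining, h]
      simp
    refine IntertwiningMap.ext (LinearMap.ext fun z => ?_)
    obtain ⟨w, hw⟩ := hs z
    change φ (s₁ (singularBoundary E 1 z)) = φ z
    nth_rewrite 2 [hw]
    rw [map_add, map_add, hδ, hcell, add_zero, add_zero]

/-- There are cocycles with any given value on the two-cell. -/
theorem exists_cocycle (hτ : ∀ a, τ (-1) a = -a) (a : A) :
    ∃ φ ∈ cocycles E τ 2, φ (S.map₂ 1) = a := by
  obtain ⟨s₁, r₂, hs, hr⟩ := S.exists_retraction₂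
  -- On cycles `r₂` reads off the homology class: its value is a multiple of `1 - t`, and
  -- `injective₂` determines the multiple. Hence `r₂` kills boundaries and returns the fundamental
  -- cycle.
  have hcycle {z w : SingularChain E 2} {n : ℤ} (hz : singularBoundary E 1 z = 0)
      (hzw : ∃ s, z - n • S.map₂ (1 - cellT) = singularBoundary E 2 s) :
      r₂ z = n • (1 - cellT) := by
    obtain ⟨m, hm⟩ := exists_of_cellBoundary₂_eq_zero (hr z hz)
    obtain ⟨s, hs'⟩ := hzw
    obtain ⟨w, hw⟩ := hs z
    rw [hz, map_zero, zero_add, hm, map_zsmul] at hw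
    have : n - m = 0 := S.injective₂ (n - m) (w - s) (by
      rw [map_sub, ← hs', sub_smul, hw]
      abel)
    rw [hm, sub_eq_zero.mp this]
  have hboundary (z : SingularChain E 3) : r₂ (singularBoundary E 2 z) = 0 := by
    rw [hcycle (w := 0) (n := 0) (singularBoundary_singularBoundary _ _) ⟨z, by simp⟩, zero_smul]
  have hfund : r₂ (S.map₂ (1 - cellT)) = 1 - cellT := by
    rw [hcycle (w := 0) (n := 1) (by rw [S.comm₂, cellBoundary₂_one_sub_cellT, map_zero])
      ⟨0, by simp⟩, one_smul]
  -- The cellular cochain with `α(e²₊) = a`, built from the sign character of the group.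
  let α : IntertwiningMap cellRep τ :=
    { toLinearMap := (LinearMap.toSpanSingleton ℤ A a) ∘ₗ
        (MonoidAlgebra.lift ℤ ℤ ℤˣ (Units.coeHom ℤ)).toLinearMap
      isIntertwining' := fun g => by
        refine LinearMap.ext fun x => ?_
        rcases Int.units_eq_one_or g with rfl | rfl
        · simp
        · simp only [LinearMap.comp_apply, cellRep_neg_one, AlgHom.toLinearMap_apply, map_mul, hτ]
          simp }
  have hα (m n : ℤ) : α (m • 1 + n • cellT) = (m - n) • a := by
    change LinearMap.toSpanSingleton ℤ A a
      (MonoidAlgebra.lift ℤ ℤ ℤˣ (Units.coeHom ℤ) (m • 1 + n • cellT)) = _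
    simp [sub_eq_add_neg]
  refine ⟨α.comp r₂, ?_, ?_⟩
  · refine AddMonoidHom.mem_ker.mpr (IntertwiningMap.ext (LinearMap.ext fun z => ?_))
    change α (r₂ (singularBoundary E 2 z)) = 0
    rw [hboundary, map_zero]
  -- It is only known that `r₂ ∘ map₂` fixes `1 - t`, not that it fixes `1`. This gives `m - n = 1`,
  -- which is all that `α` sees.
  · obtain ⟨m, n, hmn⟩ := exists_eq_zsmul_add_zsmul (r₂ (S.map₂ 1))
    have h : r₂ (S.map₂ cellT) = r₂ (S.map₂ 1) * cellT := by
      rw [← cellRep_neg_one, ← r₂.isIntertwining, ← S.map₂.isIntertwining, cellRep_neg_one, one_mul]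
    rw [map_sub, map_sub, h, hmn, add_mul, smul_mul_assoc, smul_mul_assoc, one_mul,
      cellT_mul_cellT, ← sub_eq_zero] at hfund
    have := (zsmul_add_zsmul_eq_zero (m := m - n - 1) (n := n - m + 1) (by
      rw [← hfund]; module)).1
    change α (r₂ (S.map₂ 1)) = a
    rw [hmn, hα, sub_eq_zero.mp this, one_smul]

end CellularModel

end CellularModel

/-! ### The cellular chain map of the sphere -/

/-- Composition with an injective map identifies no two simplices, so no terms cancel. -/
theorem mem_chainsIn_of_chainMap_mem {E F : Type*} [TopologicalSpace E] [TopologicalSpace F]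
    {f : C(E, F)} (hf : Function.Injective f) {X : Set F} {n : ℕ} {z : SingularChain E n}
    (h : chainMap f n z ∈ chainsIn X n) : z ∈ chainsIn (f ⁻¹' X) n := by
  classical
  intro σ hσ y
  have hinj : Function.Injective fun σ : C(TopSimplex n, E) => f.comp σ := fun _ _ h =>
    ContinuousMap.ext fun y => hf (congrArg (fun g : C(TopSimplex n, F) => g y) h)
  refine h (?_ : f.comp σ ∈ _) y
  change f.comp σ ∈ (Finsupp.mapDomain (fun σ : C(TopSimplex n, E) => f.comp σ) z).support
  rw [Finsupp.mapDomain_support_of_injective hinj]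
  exact Finset.mem_image_of_mem _ hσ

theorem chainMap_singularRep {G E F : Type*} [Group G] [TopologicalSpace E] [TopologicalSpace F]
    [MulAction G E] [MulAction G F] [ContinuousConstSMul G E] [ContinuousConstSMul G F]
    {f : C(E, F)} (hf : ∀ (g : G) x, f (g • x) = g • f x) (g : G) (n : ℕ) (z : SingularChain E n) :
    chainMap f n (singularRep G E n g z) = singularRep G F n g (chainMap f n z) := by
  rw [singularRep_apply, singularRep_apply, chainMap_comp, chainMap_comp]
  congr 2
  ext1 x
  exact hf g x

/-- The map of singular chains induced by an equivariant map. -/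
def equivariantChainMap {G E F : Type*} [Group G] [TopologicalSpace E] [TopologicalSpace F]
    [MulAction G E] [MulAction G F] [ContinuousConstSMul G E] [ContinuousConstSMul G F]
    (f : C(E, F)) (hf : ∀ (g : G) x, f (g • x) = g • f x) (n : ℕ) :
    IntertwiningMap (singularRep G E n) (singularRep G F n) where
  toLinearMap := chainMap f n
  isIntertwining' g := LinearMap.ext fun z => chainMap_singularRep hf g n z

/-- The equivariant map out of the cellular chain group with a given value at the generator. -/
def cellLift {V : Type*} [AddCommGroup V] (ρ : Representation ℤ ℤˣ V) (v : V) :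
    IntertwiningMap cellRep ρ where
  toLinearMap := ρ.asAlgebraHom.toLinearMap.flip v
  isIntertwining' g := by
    ext h
    simp

@[simp]
theorem cellLift_one {V : Type*} [AddCommGroup V] (ρ : Representation ℤ ℤˣ V) (v : V) :
    cellLift ρ v 1 = v := by
  change ρ.asAlgebraHom 1 v = v
  simp

theorem IntertwiningMap.apply_cellT {V : Type*} [AddCommGroup V] {ρ : Representation ℤ ℤˣ V}
    (f : IntertwiningMap cellRep ρ) : f cellT = ρ (-1) (f 1) := by
  rw [← f.isIntertwining, cellRep_neg_one, one_mul]

theorem cellRep_hom_ext {V : Type*} [AddCommGroup V] {ρ : Representation ℤ ℤˣ V}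
    {f g : IntertwiningMap cellRep ρ} (h : f 1 = g 1) : f = g := by
  refine IntertwiningMap.ext (LinearMap.ext fun x => ?_)
  obtain ⟨m, n, rfl⟩ := exists_eq_zsmul_add_zsmul x
  change f _ = g _
  rw [map_add, map_add, map_zsmul, map_zsmul, map_zsmul, map_zsmul,
    IntertwiningMap.apply_cellT f, IntertwiningMap.apply_cellT g, h]

/-! ### The sphere, the punctured space and the equator -/

theorem neg_one_smul_R3 (v : R3) : (-1 : ℤˣ) • v = -v := by simp [Units.smul_def]

instance : ContinuousConstSMul ℤˣ PuncturedR3 where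
  continuous_const_smul u :=
    ((continuous_const_smul u).comp continuous_subtype_val).subtype_mk _

/-- The inclusion of the punctured space. -/
def puncturedInclusion : C(PuncturedR3, R3) := ⟨Subtype.val, continuous_subtype_val⟩

/-- The inclusion of the sphere into the punctured space. -/
def sphereInclusion : C(S2, PuncturedR3) :=
  ⟨fun v => ⟨v, ne_zero_of_mem_unit_sphere v⟩, continuous_subtype_val.subtype_mk _⟩

/-- The radial projection of the punctured space onto the sphere. -/
def radialProjection : C(PuncturedR3, S2) where
  toFun v := ⟨‖(v : R3)‖⁻¹ • (v : R3), by
    rw [mem_sphere_zero_iff_norm, norm_smul, norm_inv, norm_norm,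
      inv_mul_cancel₀ (norm_ne_zero_iff.mpr v.2)]⟩
  continuous_toFun := by
    have hval : Continuous fun v : PuncturedR3 => (v : R3) := continuous_subtype_val
    have hinv : Continuous fun v : PuncturedR3 => ‖(v : R3)‖⁻¹ :=
      (continuous_norm.comp hval).inv₀ fun v => norm_ne_zero_iff.mpr v.2
    exact (hinv.smul hval).subtype_mk _

theorem radialProjection_comp_sphereInclusion :
    radialProjection.comp sphereInclusion = ContinuousMap.id S2 := by
  ext1 v
  apply Subtype.ext
  change ‖(v : R3)‖⁻¹ • (v : R3) = v
  rw [norm_eq_of_mem_sphere v, inv_one, one_smul]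

theorem coe_smul_sphere (u : ℤˣ) (v : S2) : ((u • v : S2) : R3) = u • (v : R3) := rfl

theorem sphereInclusion_smul (u : ℤˣ) (v : S2) :
    sphereInclusion (u • v) = u • sphereInclusion v := rfl

/-- Points of the equator. -/
def equatorPoint (θ : ℝ) : S2 := ⟨!₂[Real.cos θ, Real.sin θ, 0], by
  rw [mem_sphere_zero_iff_norm, EuclideanSpace.norm_eq, Fin.sum_univ_three]
  simp⟩

@[simp] theorem equatorPoint_two (θ : ℝ) : (equatorPoint θ : R3) 2 = 0 := rfl

theorem cylinderCover_mul_I (θ : ℝ) : cylinderCover (θ * Complex.I, 0) = equatorPoint θ := by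
  rw [cylinderCover_eq_iff]
  refine ⟨Complex.ext ?_ ?_, rfl⟩
  · exact Complex.exp_ofReal_mul_I_re θ
  · exact Complex.exp_ofReal_mul_I_im θ

theorem continuous_equatorPoint : Continuous equatorPoint := by
  have : (fun θ : ℝ => (equatorPoint θ : R3)) =
      fun θ : ℝ => cylinderCover ((θ : ℂ) * Complex.I, 0) :=
    funext fun θ => (cylinderCover_mul_I θ).symm
  refine Continuous.subtype_mk (f := fun θ : ℝ => (equatorPoint θ : R3)) ?_ _
  rw [this]
  exact cylinderCover.continuous.comp
    ((Complex.continuous_ofReal.mul continuous_const).prodMk continuous_const)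

/-- The closed cell `e¹₊` as a singular simplex. -/
def halfCircle : C(TopSimplex 1, S2) :=
  ⟨fun y => equatorPoint (Real.pi * y 1),
    continuous_equatorPoint.comp (continuous_const.mul (continuous_coord 1))⟩

theorem segmentSimplex_halfTurn (y : TopSimplex 1) :
    segmentSimplex 0 halfTurn y = (((Real.pi * y 1 : ℝ) : ℂ) * Complex.I, 0) := by
  change y 0 • (0 : ℂ × ℝ) + y 1 • halfTurn = _
  rw [smul_zero, zero_add, halfTurn]
  ext1
  · simp only [Prod.smul_fst, Complex.real_smul]; push_cast; ring
  · simp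

theorem segmentSimplex_halfTurn_deckVector (y : TopSimplex 1) :
    segmentSimplex halfTurn (deckVector 1) y =
      (((Real.pi * y 1 + Real.pi : ℝ) : ℂ) * Complex.I, 0) := by
  change y 0 • halfTurn + y 1 • deckVector 1 = _
  have h : y 0 = 1 - y 1 := eq_sub_of_add_eq (stdSimplex.add_eq_one y)
  rw [h, halfTurn, deckVector]
  ext1
  · simp only [Prod.fst_add, Prod.smul_fst, Complex.real_smul]; push_cast; ring
  · simp

theorem equatorPoint_add_pi (θ : ℝ) : equatorPoint (θ + Real.pi) = (-1 : ℤˣ) • equatorPoint θ := by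
  apply Subtype.ext
  rw [coe_smul_sphere, neg_one_smul_R3]
  ext i
  fin_cases i <;> simp [equatorPoint]

/-- The second half of the equator is the antipode of the first; this is why `equatorChain` is cut
in two, so that it equals the image of `(1 + t)e¹₊`. -/
theorem chainMap_halfCircle : chainMap puncturedInclusion 1 (chainMap sphereInclusion 1
    (Finsupp.single halfCircle 1 + Finsupp.single ((-1 : ℤˣ) • halfCircle) 1)) = equatorChain := by
  rw [equatorChain, map_add, map_add, map_add, chainMap_single, chainMap_single, chainMap_single,
    chainMap_single, chainMap_single, chainMap_single]
  congr 2
  · ext1 y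
    change (halfCircle y : R3) = cylinderCover (segmentSimplex 0 halfTurn y)
    rw [segmentSimplex_halfTurn, cylinderCover_mul_I]
    rfl
  · ext1 y
    change (((-1 : ℤˣ) • equatorPoint (Real.pi * y 1) : S2) : R3) =
      cylinderCover (segmentSimplex halfTurn (deckVector 1) y)
    rw [segmentSimplex_halfTurn_deckVector, cylinderCover_mul_I, equatorPoint_add_pi]

theorem puncturedInclusion_injective : Function.Injective puncturedInclusion :=
  Subtype.val_injective

theorem exists_chainMap_puncturedInclusion {n : ℕ} {z : SingularChain R3 n}
    (hz : z ∈ chainsIn {0}ᶜ n) : ∃ z', chainMap puncturedInclusion n z' = z :=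
  exists_chainMap_eq (fun σ hσ => ⟨⟨fun y => ⟨σ y, hσ y⟩, σ.continuous.subtype_mk _⟩, rfl⟩) hz

theorem chainMap_puncturedInclusion_mem {n : ℕ} (z : SingularChain PuncturedR3 n) :
    chainMap puncturedInclusion n z ∈ chainsIn {0}ᶜ n :=
  chainMap_mem_chainsIn (X := Set.univ) (fun v _ => v.2) (by simp)

/-- Moves vanishing statements proved for chains of `ℝ³` avoiding the origin to the chains of the
subspace. -/
theorem exists_boundary_eq_of_chainMap {n : ℕ} {z : SingularChain PuncturedR3 n}
    (h : ∃ s ∈ chainsIn {0}ᶜ (n + 1), singularBoundary R3 n s = chainMap puncturedInclusion n z) :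
    ∃ s, singularBoundary PuncturedR3 n s = z := by
  obtain ⟨s, hs, h⟩ := h
  obtain ⟨s, rfl⟩ := exists_chainMap_puncturedInclusion hs
  refine ⟨s, chainMap_injective puncturedInclusion_injective n ?_⟩
  rw [← h, chainMap_boundary]

theorem boundary_equatorChain : singularBoundary R3 0 equatorChain = 0 := by
  rw [equatorChain, chainMap_boundary, map_add, boundary_segmentChain, boundary_segmentChain,
    sub_add_sub_cancel', map_sub, chainMap_single, chainMap_single, sub_eq_zero]
  congr 1
  ext1 y
  have := cylinderCover_add_deckVector 0 1
  rw [zero_add (deckVector 1)] at this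
  exact this

/-- A chain of simplices of the closed upper hemisphere with boundary the equator. -/
theorem exists_hemisphere : ∃ c : SingularChain S2 2, c ∈ chainsIn (closedCell 2) 2 ∧
    chainMap puncturedInclusion 2 (chainMap sphereInclusion 2 c) ∈ chainsIn upperRegion 2 ∧
    singularBoundary S2 1 c =
      Finsupp.single halfCircle 1 + Finsupp.single ((-1 : ℤˣ) • halfCircle) 1 := by
  have hstar : StarConvex ℝ northPole {v : R3 | 0 ≤ v 2} := by
    intro v hv a b ha hb _
    simp only [Set.mem_ofPred_eq, PiLp.add_apply, PiLp.smul_apply, northPole_two, smul_eq_mul,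
      mul_one] at hv ⊢
    positivity
  have hq : equatorChain ∈ chainsIn (upperRegion ∩ {v : R3 | 0 ≤ v 2}) 1 := by
    refine mem_chainsIn_inter (chainsIn_axisComplement_le_upper 1 equatorChain_mem) ?_
    rw [← chainMap_halfCircle]
    refine chainMap_mem_chainsIn (X := {v : PuncturedR3 | 0 ≤ (v : R3) 2}) (fun v hv => hv) ?_
    refine chainMap_mem_chainsIn (X := {v : S2 | 0 ≤ (v : R3) 2}) (fun v hv => hv) ?_
    refine add_mem (single_mem_chainsIn (fun y => ?_) _) (single_mem_chainsIn (fun y => ?_) _)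
    · exact (equatorPoint_two _).ge
    · change 0 ≤ (((-1 : ℤˣ) • equatorPoint (Real.pi * y 1) : S2) : R3) 2
      rw [← equatorPoint_add_pi, equatorPoint_two]
  -- The hemisphere is first built as a flat cone over the equator from the north pole, which avoids
  -- the origin and stays in the upper half space; radial projection then bends it onto the sphere.
  have hcone := coneChain_mem_chainsIn (starConvex_upperRegion.inter hstar) hq
  obtain ⟨c, hc⟩ := exists_chainMap_puncturedInclusion
    (chainsIn_mono (Set.inter_subset_left.trans upperRegion_subset) 2 hcone)
  rw [← hc] at hcone
  have hc' := mem_chainsIn_of_chainMap_mem puncturedInclusion_injective hcone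
  have hrad : ∀ v ∈ puncturedInclusion ⁻¹' (upperRegion ∩ {v : R3 | 0 ≤ v 2}),
      radialProjection v ∈ {v : S2 | (v : R3) ∈ upperRegion ∩ {v : R3 | 0 ≤ v 2}} := by
    intro v hv
    have hpos : 0 < ‖(v : R3)‖⁻¹ := inv_pos.mpr (norm_pos_iff.mpr v.2)
    obtain ⟨h1, h2⟩ := hv
    have hval (i : Fin 3) : (radialProjection v : R3) i = ‖(v : R3)‖⁻¹ * (v : R3) i := rfl
    refine ⟨?_, ?_⟩
    · simp only [upperRegion, axisComplement, Set.mem_ofPred_eq, hval, mul_ne_zero_iff,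
        mul_pos_iff_of_pos_left hpos]
      rcases h1 with (h | h) | h
      · exact Or.inl (Or.inl ⟨hpos.ne', h⟩)
      · exact Or.inl (Or.inr ⟨hpos.ne', h⟩)
      · exact Or.inr h
    · change 0 ≤ (radialProjection v : R3) 2
      rw [hval]
      exact mul_nonneg hpos.le h2
  have hmem := chainMap_mem_chainsIn hrad hc'
  refine ⟨chainMap radialProjection 2 c, ?_, ?_, ?_⟩
  · refine chainsIn_mono (fun v hv => ?_) 2 hmem
    exact (⟨hv.2, fun j hj => absurd hj (by omega)⟩ : v ∈ closedCell 2)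
  · refine chainMap_mem_chainsIn (X := {v : PuncturedR3 | (v : R3) ∈ upperRegion})
      (fun v hv => hv) ?_
    exact chainMap_mem_chainsIn (fun v hv => hv.1) hmem
  · have h1 : singularBoundary PuncturedR3 1 c = chainMap sphereInclusion 1
        (Finsupp.single halfCircle 1 + Finsupp.single ((-1 : ℤˣ) • halfCircle) 1) := by
      apply chainMap_injective puncturedInclusion_injective
      rw [chainMap_halfCircle, ← chainMap_boundary, hc, boundary_coneChain, boundary_equatorChain,
        map_zero, sub_zero]
    -- The projection fixes the equator, so the boundary is unchanged.
    rw [chainMap_boundary, h1, chainMap_comp, radialProjection_comp_sphereInclusion, chainMap_id]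

/-- A chain of simplices of the closed upper hemisphere with boundary the equator. -/
def hemisphere : SingularChain S2 2 := exists_hemisphere.choose

theorem boundary_hemisphere : singularBoundary S2 1 hemisphere =
    Finsupp.single halfCircle 1 + Finsupp.single ((-1 : ℤˣ) • halfCircle) 1 :=
  exists_hemisphere.choose_spec.2.2

/-- The cellular chain map of the sphere. -/
def sphereCellMap : CellChainMap where
  toSing₀ := cellLift _ (Finsupp.single (pointSimplex (equatorPoint 0)) 1)
  toSing₁ := cellLift _ (Finsupp.single halfCircle 1)
  toSing₂ := cellLift _ hemisphere
  comm₁ := cellRep_hom_ext (by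
    change singularBoundary S2 0 (cellLift _ _ 1) = cellLift _ _ (cellBoundary₁ 1)
    rw [cellLift_one, cellBoundary₁_apply, one_mul, map_sub, IntertwiningMap.apply_cellT,
      cellLift_one, singularRep_single, singularBoundary_one]
    have h0 : (-1 : ℤˣ) • equatorPoint 0 = equatorPoint Real.pi := by
      rw [← equatorPoint_add_pi, zero_add]
    congr 2
    -- The half circle starts at `e⁰₊` and ends at its antipode, whence `∂e¹₊ = (t - 1)e⁰₊`.
    · ext1 y
      change equatorPoint (Real.pi * (stdSimplex.vertex (1 : Fin 2)) 1) = (-1 : ℤˣ) • equatorPoint 0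
      rw [h0]
      simp
    · ext1 y
      change equatorPoint (Real.pi * (stdSimplex.vertex (0 : Fin 2)) 1) = equatorPoint 0
      simp)
  comm₂ := cellRep_hom_ext (by
    change singularBoundary S2 1 (cellLift _ _ 1) = cellLift _ _ (cellBoundary₂ 1)
    rw [cellLift_one, cellBoundary₂_apply, one_mul, map_add, IntertwiningMap.apply_cellT,
      cellLift_one, singularRep_single, boundary_hemisphere])
  carried₀ := by
    rw [cellLift_one]
    refine Finsupp.single_mem_supported ℤ _ fun y => ⟨?_, fun j hj => ?_⟩
    · change 0 ≤ Real.cos 0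
      simp
    · change (equatorPoint 0 : R3) j = 0
      fin_cases j
      · exact absurd hj (lt_irrefl _)
      · exact Real.sin_zero
      · rfl
  carried₁ := by
    rw [cellLift_one]
    refine Finsupp.single_mem_supported ℤ _ fun y => ⟨?_, fun j hj => ?_⟩
    · refine Real.sin_nonneg_of_nonneg_of_le_pi (mul_nonneg Real.pi_pos.le (y.2.1 1)) ?_
      exact mul_le_of_le_one_right Real.pi_pos.le (stdSimplex.le_one y 1)
    · fin_cases j
      · exact absurd hj (by decide)
      · exact absurd hj (by decide)
      · rfl
  carried₂ := by
    rw [cellLift_one]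
    exact exists_hemisphere.choose_spec.1

/-! ### The singular chains of the sphere and of the punctured space -/

theorem eq_zero_of_neg_one_smul_eq {v : R3} (h : (-1 : ℤˣ) • v = v) : v = 0 := by
  rw [neg_one_smul_R3] at h
  have h2 : (2 : ℝ) • v = 0 := by rw [two_smul]; exact neg_eq_iff_add_eq_zero.mp h
  exact (smul_eq_zero.mp h2).resolve_left two_ne_zero

theorem smul_punctured_ne {u : ℤˣ} (hu : u ≠ 1) (v : PuncturedR3) : u • v ≠ v := by
  obtain rfl := (Int.units_eq_one_or u).resolve_left hu
  exact fun h => v.2 (eq_zero_of_neg_one_smul_eq (congrArg Subtype.val h))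

theorem smul_sphere_ne {u : ℤˣ} (hu : u ≠ 1) (v : S2) : u • v ≠ v := by
  obtain rfl := (Int.units_eq_one_or u).resolve_left hu
  exact fun h => ne_zero_of_mem_unit_sphere v (eq_zero_of_neg_one_smul_eq (congrArg Subtype.val h))

/-- The image in `ℝ³` of a chain of the sphere. -/
def sphereChain (n : ℕ) : SingularChain S2 n →ₗ[ℤ] SingularChain R3 n :=
  chainMap puncturedInclusion n ∘ₗ chainMap sphereInclusion n

theorem sphereChain_boundary (n : ℕ) (z : SingularChain S2 (n + 1)) :
    singularBoundary R3 n (sphereChain (n + 1) z) = sphereChain n (singularBoundary S2 n z) := by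
  simp only [sphereChain, LinearMap.comp_apply, chainMap_boundary]

theorem hemisphere_mem : sphereChain 2 hemisphere ∈ chainsIn upperRegion 2 :=
  exists_hemisphere.choose_spec.2.1

theorem boundary_sphereChain_hemisphere :
    singularBoundary R3 1 (sphereChain 2 hemisphere) = equatorChain := by
  rw [sphereChain_boundary, boundary_hemisphere]
  exact chainMap_halfCircle

theorem antipode_hemisphere_mem :
    sphereChain 2 (singularRep ℤˣ S2 2 (-1) hemisphere) ∈ chainsIn lowerRegion 2 := by
  have h := mem_chainsIn_of_chainMap_mem puncturedInclusion_injective hemisphere_mem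
  refine chainMap_mem_chainsIn (X := puncturedInclusion ⁻¹' lowerRegion) (fun v hv => hv) ?_
  rw [chainMap_singularRep sphereInclusion_smul, singularRep_apply]
  refine chainMap_mem_chainsIn (fun v hv => ?_) h
  change (-1 : ℤˣ) • (v : R3) ∈ lowerRegion
  rw [neg_one_smul_R3]
  exact neg_mem_lowerRegion.mpr hv

/-- The antipodal map exchanges the two half circles, so both hemispheres have the same boundary and
their difference is the fundamental cycle. -/
theorem boundary_sphereChain_antipode_hemisphere :
    singularBoundary R3 1 (sphereChain 2 (singularRep ℤˣ S2 2 (-1) hemisphere)) =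
      equatorChain := by
  rw [sphereChain_boundary, boundary_singularRep, boundary_hemisphere, map_add,
    singularRep_single, singularRep_single, smul_smul, neg_one_mul, neg_neg, one_smul,
    add_comm (Finsupp.single _ _)]
  exact chainMap_halfCircle

theorem sphereChain_one_sub_cellT :
    sphereChain 2 (sphereCellMap.toSing₂ (1 - cellT)) = sphereChain 2 hemisphere -
      sphereChain 2 (singularRep ℤˣ S2 2 (-1) hemisphere) := by
  rw [← map_sub, map_sub, IntertwiningMap.apply_cellT]
  change sphereChain 2 (cellLift _ _ 1 - singularRep ℤˣ S2 2 (-1) (cellLift _ _ 1)) = _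
  rw [cellLift_one]

theorem radialProjection_sphereInclusion {n : ℕ} (z : SingularChain S2 n) :
    chainMap radialProjection n (chainMap sphereInclusion n z) = z := by
  rw [chainMap_comp, radialProjection_comp_sphereInclusion, chainMap_id]

/-- Radial projection retracts a filling in the punctured space to one in the sphere. -/
theorem exists_boundary_eq_of_sphereInclusion {n : ℕ} {z : SingularChain S2 n}
    (h : ∃ s, singularBoundary PuncturedR3 n s = chainMap sphereInclusion n z) :
    ∃ s, singularBoundary S2 n s = z := by
  obtain ⟨s, h⟩ := h
  exact ⟨chainMap radialProjection _ s, by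
    rw [chainMap_boundary, h, radialProjection_sphereInclusion]⟩

/-- The singular chains of the punctured space. -/
def puncturedModel : CellularModel PuncturedR3 where
  map₀ := (equivariantChainMap sphereInclusion sphereInclusion_smul 0).comp sphereCellMap.toSing₀
  map₁ := (equivariantChainMap sphereInclusion sphereInclusion_smul 1).comp sphereCellMap.toSing₁
  map₂ := (equivariantChainMap sphereInclusion sphereInclusion_smul 2).comp sphereCellMap.toSing₂
  comm₁ x := by
    have h := DFunLike.congr_fun sphereCellMap.comm₁ x
    change singularBoundary S2 0 (sphereCellMap.toSing₁ x) = _ at h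
    change singularBoundary _ 0 (chainMap _ 1 (sphereCellMap.toSing₁ x)) = chainMap _ 0 _
    rw [chainMap_boundary, h]
    rfl
  comm₂ x := by
    have h := DFunLike.congr_fun sphereCellMap.comm₂ x
    change singularBoundary S2 1 (sphereCellMap.toSing₂ x) = _ at h
    change singularBoundary _ 1 (chainMap _ 2 (sphereCellMap.toSing₂ x)) = chainMap _ 1 _
    rw [chainMap_boundary, h]
    rfl
  aug := by
    change augmentation _ 0 (chainMap sphereInclusion 0 (cellLift _ _ 1)) = 1
    rw [cellLift_one, augmentation_chainMap, augmentation_single]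
  free u v h := by
    by_contra hu
    exact smul_punctured_ne hu v h
  exact₀ z hz := by
    obtain ⟨s, hs⟩ := exists_boundary_eq_of_chainMap (punctured_exists_boundary_eq_zero
      (chainMap_puncturedInclusion_mem z) (by rw [augmentation_chainMap, hz]))
    exact ⟨s, hs⟩
  exact₁ z hz := by
    obtain ⟨s, hs⟩ := exists_boundary_eq_of_chainMap (punctured_exists_boundary_eq_one
      (chainMap_puncturedInclusion_mem z) (by rw [chainMap_boundary, hz, map_zero]))
    exact ⟨s, hs⟩
  exact₂ z hz := by
    obtain ⟨n, s, hs, h⟩ := punctured_exists_eq_zsmul hemisphere_mem antipode_hemisphere_mem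
      boundary_sphereChain_hemisphere boundary_sphereChain_antipode_hemisphere
      (chainMap_puncturedInclusion_mem z) (by rw [chainMap_boundary, hz, map_zero])
    obtain ⟨s, rfl⟩ := exists_chainMap_puncturedInclusion hs
    refine ⟨n, s, chainMap_injective puncturedInclusion_injective _ ?_⟩
    rw [h, map_add, map_zsmul, ← chainMap_boundary]
    congr 2
    exact sphereChain_one_sub_cellT.symm
  injective₂ n s hs := by
    refine punctured_zsmul_boundary hemisphere_mem antipode_hemisphere_mem
      boundary_sphereChain_hemisphere (chainMap_puncturedInclusion_mem s) ?_
    rw [chainMap_boundary, hs, map_zsmul]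
    congr 1
    exact sphereChain_one_sub_cellT

/-- The singular chains of the sphere. -/
def sphereModel : CellularModel S2 where
  map₀ := sphereCellMap.toSing₀
  map₁ := sphereCellMap.toSing₁
  map₂ := sphereCellMap.toSing₂
  comm₁ x := DFunLike.congr_fun sphereCellMap.comm₁ x
  comm₂ x := DFunLike.congr_fun sphereCellMap.comm₂ x
  aug := by
    change augmentation _ 0 (cellLift _ _ 1) = 1
    rw [cellLift_one, augmentation_single]
  free u v h := by
    by_contra hu
    exact smul_sphere_ne hu v h
  exact₀ z hz := exists_boundary_eq_of_sphereInclusion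
    (puncturedModel.exact₀ _ (by rw [augmentation_chainMap, hz]))
  exact₁ z hz := exists_boundary_eq_of_sphereInclusion
    (puncturedModel.exact₁ _ (by rw [chainMap_boundary, hz, map_zero]))
  exact₂ z hz := by
    obtain ⟨n, s, h⟩ := puncturedModel.exact₂ (chainMap sphereInclusion 2 z)
      (by rw [chainMap_boundary, hz, map_zero])
    refine ⟨n, chainMap radialProjection 3 s, ?_⟩
    rw [← radialProjection_sphereInclusion z, h, map_add, map_zsmul, ← chainMap_boundary]
    congr 2
    exact radialProjection_sphereInclusion _
  injective₂ n s hs := by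
    refine puncturedModel.injective₂ n (chainMap sphereInclusion 3 s) ?_
    rw [chainMap_boundary, hs, map_zsmul]
    rfl

/-! ### The coverings of the projective plane and of its product with the line -/

theorem isQuotientMap_projectivization :
    Topology.IsQuotientMap fun v : PuncturedR3 => (Projectivization.mk ℝ (v : R3) v.2 : RP2) :=
  isQuotientMap_quotient_mk' (s := projectivizationSetoid ℝ R3)

theorem sphereCover_radialProjection (v : PuncturedR3) :
    sphereCover (radialProjection v) = Projectivization.mk ℝ (v : R3) v.2 := by
  rw [sphereCover, Projectivization.mk_eq_mk_iff']
  exact ⟨‖(v : R3)‖⁻¹, rfl⟩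

theorem continuous_sphereCover : Continuous sphereCover :=
  isQuotientMap_projectivization.continuous.comp sphereInclusion.continuous

/-- Preceded by radial projection, the map becomes the defining quotient map of the projective
plane. -/
theorem isQuotientMap_sphereCover : Topology.IsQuotientMap sphereCover := by
  refine .of_comp radialProjection.continuous continuous_sphereCover ?_
  convert isQuotientMap_projectivization using 1
  exact funext sphereCover_radialProjection

/-- Two vectors on a line with equal norms differ by a sign. -/
theorem projectivization_mk_eq_iff {v w : PuncturedR3} (h : ‖(v : R3)‖ = ‖(w : R3)‖) :
    (Projectivization.mk ℝ (v : R3) v.2 : RP2) = Projectivization.mk ℝ (w : R3) w.2 ↔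
      v ∈ MulAction.orbit ℤˣ w := by
  rw [Projectivization.mk_eq_mk_iff']
  constructor
  · rintro ⟨a, ha⟩
    have ha' : |a| = 1 := by
      rw [← ha, norm_smul, Real.norm_eq_abs] at h
      exact mul_right_cancel₀ (norm_ne_zero_iff.mpr w.2) (h.trans (one_mul _).symm)
    rcases eq_or_eq_neg_of_abs_eq ha' with rfl | rfl
    · exact ⟨1, Subtype.ext (by rw [← ha, one_smul]; exact one_smul _ _)⟩
    · exact ⟨-1, Subtype.ext (by
        rw [← ha, neg_one_smul]; exact neg_one_smul_R3 _)⟩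
  · rintro ⟨u, rfl⟩
    rcases Int.units_eq_one_or u with rfl | rfl
    · exact ⟨1, by rw [one_smul]; exact (one_smul _ _).symm⟩
    · exact ⟨-1, by rw [neg_one_smul]; exact (neg_one_smul_R3 _).symm⟩

theorem norm_smul_units (u : ℤˣ) (v : R3) : ‖u • v‖ = ‖v‖ := by
  rcases Int.units_eq_one_or u with rfl | rfl
  · rw [one_smul]
  · rw [neg_one_smul_R3, norm_neg]

/-- The open half space of vectors having positive inner product with `v` is disjoint from its
negative. -/
theorem exists_nhds_disjoint (v : PuncturedR3) :
    ∃ U ∈ nhds v, ∀ u : ℤˣ, ((u • ·) '' U ∩ U).Nonempty → u = 1 := by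
  refine ⟨{w | 0 < inner ℝ (v : R3) (w : R3)}, ?_, fun u hu => ?_⟩
  · refine IsOpen.mem_nhds ?_ (real_inner_self_pos.mpr v.2)
    have hval : Continuous fun v : PuncturedR3 => (v : R3) := continuous_subtype_val
    exact isOpen_lt continuous_const ((innerSL ℝ (v : R3)).continuous.comp hval)
  · obtain ⟨_, ⟨w, hw, rfl⟩, hw'⟩ := hu
    by_contra hne
    obtain rfl := (Int.units_eq_one_or u).resolve_left hne
    change 0 < inner ℝ (v : R3) ((-1 : ℤˣ) • (w : R3)) at hw'
    rw [neg_one_smul_R3, inner_neg_right] at hw'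
    exact lt_asymm (neg_pos.mp hw') hw

theorem isQuotientCoveringMap_sphereCover : IsQuotientCoveringMap sphereCover ℤˣ where
  __ := isQuotientMap_sphereCover
  continuous_const_smul := S2.instContinuousConstSMul.continuous_const_smul
  apply_eq_iff_mem_orbit {v w} := by
    refine (projectivization_mk_eq_iff (v := sphereInclusion v) (w := sphereInclusion w) ?_).trans
      ⟨?_, ?_⟩
    · exact (norm_eq_of_mem_sphere v).trans (norm_eq_of_mem_sphere w).symm
    · rintro ⟨u, hu⟩
      exact ⟨u, Subtype.ext (congrArg (fun v : PuncturedR3 => (v : R3)) hu)⟩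
    · rintro ⟨u, rfl⟩
      exact ⟨u, rfl⟩
  disjoint v := by
    obtain ⟨U, hU, h⟩ := exists_nhds_disjoint (sphereInclusion v)
    refine ⟨sphereInclusion ⁻¹' U, sphereInclusion.continuous.continuousAt hU, fun u hu => h u ?_⟩
    obtain ⟨_, ⟨w, hw, rfl⟩, hw'⟩ := hu
    exact ⟨_, ⟨_, hw, rfl⟩, hw'⟩

theorem continuous_puncturedCover : Continuous puncturedCover := by
  have hval : Continuous fun v : PuncturedR3 => (v : R3) := continuous_subtype_val
  exact isQuotientMap_projectivization.continuous.prodMk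
    ((continuous_norm.comp hval).log fun v => norm_ne_zero_iff.mpr v.2)

/-- Polar coordinates of the punctured space. -/
def polar (y : S2 × ℝ) : PuncturedR3 :=
  ⟨Real.exp y.2 • (y.1 : R3), smul_ne_zero (Real.exp_pos _).ne' (ne_zero_of_mem_unit_sphere y.1)⟩

theorem continuous_polar : Continuous polar :=
  ((Real.continuous_exp.comp continuous_snd).smul
    (continuous_subtype_val.comp continuous_fst)).subtype_mk _

theorem puncturedCover_polar (y : S2 × ℝ) : puncturedCover (polar y) = (sphereCover y.1, y.2) := by
  refine Prod.ext ?_ ?_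
  · refine (Projectivization.mk_eq_mk_iff' _ _ _ _ _).mpr ?_
    exact ⟨Real.exp y.2, rfl⟩
  · change Real.log ‖Real.exp y.2 • (y.1 : R3)‖ = y.2
    rw [norm_smul, norm_eq_of_mem_sphere y.1, mul_one, Real.norm_eq_abs, Real.abs_exp,
      Real.log_exp]

/-- In polar coordinates the map is `sphereCover × id`; openness of the first factor keeps the
product a quotient map. -/
theorem isQuotientMap_puncturedCover : Topology.IsQuotientMap puncturedCover := by
  refine .of_comp continuous_polar continuous_puncturedCover ?_
  have h : puncturedCover ∘ polar = Prod.map sphereCover id := funext puncturedCover_polar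
  rw [h]
  exact (isQuotientCoveringMap_sphereCover.isOpenQuotientMap.prodMap .id).isQuotientMap

theorem isQuotientCoveringMap_puncturedCover : IsQuotientCoveringMap puncturedCover ℤˣ where
  __ := isQuotientMap_puncturedCover
  continuous_const_smul u := continuous_const_smul u
  apply_eq_iff_mem_orbit {v w} := by
    refine ⟨fun h => ?_, ?_⟩
    · refine (projectivization_mk_eq_iff ?_).mp (congrArg Prod.fst h)
      exact Real.log_injOn_pos (norm_pos_iff.mpr v.2) (norm_pos_iff.mpr w.2)
        (congrArg Prod.snd h)
    · rintro ⟨u, hu⟩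
      have h : ‖(v : R3)‖ = ‖(w : R3)‖ := by
        rw [← hu]
        exact norm_smul_units u w
      exact Prod.ext ((projectivization_mk_eq_iff h).mpr ⟨u, hu⟩) (congrArg Real.log h)
  disjoint := exists_nhds_disjoint

/-! ### Simple connectivity -/

open unitInterval

/-- Removes the end-point casts that appear when a path is recovered from its subpaths. -/
theorem Path.Homotopic.Quotient.trans_mk_eq_of_cast {X : Type*} [TopologicalSpace X] {x₀ : X}
    (c : ∀ z, Path.Homotopic.Quotient x₀ z) {x y x' y' : X} (γ : Path x y) (hx : x' = x)
    (hy : y' = y) (h : (c x').trans (.mk (γ.cast hx hy)) = c y') :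
    (c x).trans (.mk γ) = c y := by
  subst hx hy
  exact h

/-- A space is simply connected if it is the union of two simply connected open subsets with a
path connected intersection. -/
theorem simplyConnectedSpace_of_union {X : Type*} [TopologicalSpace X] {U V : Set X}
    (hU : IsOpen U) (hV : IsOpen V) (hUV : U ∪ V = Set.univ) (hpU : IsPathConnected U)
    (hpV : IsPathConnected V) (hW : IsPathConnected (U ∩ V))
    (hhU : ∀ {x y : X} (p q : Path x y), (∀ t, p t ∈ U) → (∀ t, q t ∈ U) → p.Homotopic q)
    (hhV : ∀ {x y : X} (p q : Path x y), (∀ t, p t ∈ V) → (∀ t, q t ∈ V) → p.Homotopic q) :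
    SimplyConnectedSpace X := by
  obtain ⟨x₀, hx₀, hx₀'⟩ := hW
  -- A preferred class from `x₀` to each point, containing every path in `U` and every path in `V`
  -- that ends there. Over the intersection a path inside `U ∩ V` serves both conditions.
  have hc (z : X) : ∃ c : Path.Homotopic.Quotient x₀ z,
      (∀ p : Path x₀ z, (∀ t, p t ∈ U) → .mk p = c) ∧
      (∀ p : Path x₀ z, (∀ t, p t ∈ V) → .mk p = c) := by
    by_cases hzU : z ∈ U
    · by_cases hzV : z ∈ V
      · obtain ⟨p, hp⟩ := hx₀' ⟨hzU, hzV⟩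
        exact ⟨.mk p, fun q hq => Path.Homotopic.Quotient.eq.mpr (hhU q p hq fun t => (hp t).1),
          fun q hq => Path.Homotopic.Quotient.eq.mpr (hhV q p hq fun t => (hp t).2)⟩
      · obtain ⟨p, hp⟩ := hpU.joinedIn x₀ hx₀.1 z hzU
        exact ⟨.mk p, fun q hq => Path.Homotopic.Quotient.eq.mpr (hhU q p hq hp),
          fun q hq => absurd (q.target ▸ hq 1) hzV⟩
    · obtain ⟨p, hp⟩ := hpV.joinedIn x₀ hx₀.2 z ((hUV.ge trivial).resolve_left hzU)
      exact ⟨.mk p, fun q hq => absurd (q.target ▸ hq 1) hzU,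
        fun q hq => Path.Homotopic.Quotient.eq.mpr (hhV q p hq hp)⟩
  choose c hcU hcV using hc
  have hjU {z w : X} (q : Path z w) (hq : ∀ t, q t ∈ U) : (c z).trans (.mk q) = c w := by
    obtain ⟨p, hp⟩ := hpU.joinedIn x₀ hx₀.1 z (q.source ▸ hq 0)
    rw [← hcU z p hp, ← Path.Homotopic.Quotient.mk_trans]
    refine hcU w _ fun t => ?_
    have : (p.trans q) t ∈ Set.range p ∪ Set.range q := Path.trans_range p q ▸ ⟨t, rfl⟩
    rcases this with ⟨s, hs⟩ | ⟨s, hs⟩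
    · exact hs ▸ hp s
    · exact hs ▸ hq s
  have hjV {z w : X} (q : Path z w) (hq : ∀ t, q t ∈ V) : (c z).trans (.mk q) = c w := by
    obtain ⟨p, hp⟩ := hpV.joinedIn x₀ hx₀.2 z (q.source ▸ hq 0)
    rw [← hcV z p hp, ← Path.Homotopic.Quotient.mk_trans]
    refine hcV w _ fun t => ?_
    have : (p.trans q) t ∈ Set.range p ∪ Set.range q := Path.trans_range p q ▸ ⟨t, rfl⟩
    rcases this with ⟨s, hs⟩ | ⟨s, hs⟩
    · exact hs ▸ hp s
    · exact hs ▸ hq s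
  -- Cut `γ` into pieces inside `U` or `V`; each piece respects the preferred classes. Hence the
  -- class of `γ` depends only on its end points.
  have key {x y : X} (γ : Path x y) : (c x).trans (.mk γ) = c y := by
    obtain ⟨t, ht0, hmono, ⟨n, hn⟩, hcov⟩ := exists_monotone_Icc_subset_open_cover_unitInterval
      (c := fun b : Bool => γ ⁻¹' (cond b U V)) (fun b => by
        cases b
        · exact hV.preimage γ.continuous
        · exact hU.preimage γ.continuous) (fun s _ => by
        rw [Set.mem_iUnion]
        rcases hUV.ge (Set.mem_univ (γ s)) with h | h
        · exact ⟨true, h⟩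
        · exact ⟨false, h⟩)
    have step (m : ℕ) : (c (γ (t 0))).trans (.mk (γ.subpath (t 0) (t m))) = c (γ (t m)) := by
      induction m with
      | zero =>
        rw [Path.subpath_self, Path.Homotopic.Quotient.mk_refl, Path.Homotopic.Quotient.trans_refl]
      | succ m ih =>
        have h : Path.Homotopic.Quotient.mk (γ.subpath (t 0) (t (m + 1))) =
            (Path.Homotopic.Quotient.mk (γ.subpath (t 0) (t m))).trans
              (.mk (γ.subpath (t m) (t (m + 1)))) := by
          rw [← Path.Homotopic.Quotient.mk_trans]
          exact Path.Homotopic.Quotient.eq.mpr ⟨(Path.Homotopy.subpathTransSubpath γ _ _ _).symm⟩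
        rw [h, ← Path.Homotopic.Quotient.trans_assoc, ih]
        have hrange (s : I) : (γ.subpath (t m) (t (m + 1))) s ∈ γ '' Set.Icc (t m) (t (m + 1)) :=
          Path.range_subpath_of_le γ _ _ (hmono m.le_succ) ▸ ⟨s, rfl⟩
        obtain ⟨b, hb⟩ := hcov m
        cases b
        · refine hjV _ fun s => ?_
          obtain ⟨r, hr, h⟩ := hrange s
          exact h ▸ hb hr
        · refine hjU _ fun s => ?_
          obtain ⟨r, hr, h⟩ := hrange s
          exact h ▸ hb hr
    have h := step n
    rw [ht0, hn n le_rfl, Path.subpath_zero_one] at h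
    exact Path.Homotopic.Quotient.trans_mk_eq_of_cast c γ _ _ h
  refine simply_connected_iff_paths_homotopic'.mpr ⟨?_, fun {x y} p q => ?_⟩
  · exact pathConnectedSpace_iff_univ.mpr
      (hUV ▸ hpU.union hpV ⟨x₀, hx₀⟩)
  · rw [← Path.Homotopic.Quotient.eq]
    have h := (key p).trans (key q).symm
    have := congrArg (fun a => (c x).symm.trans a) h
    simpa [← Path.Homotopic.Quotient.trans_assoc] using this

/-- Both paths lift to the contractible subspace `S`; a homotopy there is pushed forward. -/
theorem homotopic_of_starConvex {S : Set R3} {v₀ : R3} (hS : StarConvex ℝ v₀ S) (hS' : S ⊆ {0}ᶜ)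
    {v w : PuncturedR3} (p q : Path v w) (hp : ∀ t, (p t : R3) ∈ S) (hq : ∀ t, (q t : R3) ∈ S) :
    p.Homotopic q := by
  have hv : (v : R3) ∈ S := p.source ▸ hp 0
  have hw : (w : R3) ∈ S := p.target ▸ hp 1
  have : ContractibleSpace S := hS.contractibleSpace ⟨v, hv⟩
  have lift (p : Path v w) (hp : ∀ t, (p t : R3) ∈ S) : ∃ p' : Path (⟨v, hv⟩ : S) ⟨w, hw⟩,
      ∀ t, (p' t : R3) = p t :=
    ⟨{ toFun := fun t => ⟨p t, hp t⟩
       continuous_toFun := (continuous_subtype_val.comp p.continuous).subtype_mk _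
       source' := Subtype.ext (congrArg (fun v : PuncturedR3 => (v : R3)) p.source)
       target' := Subtype.ext (congrArg (fun v : PuncturedR3 => (v : R3)) p.target) }, fun _ => rfl⟩
  obtain ⟨p', hp'⟩ := lift p hp
  obtain ⟨q', hq'⟩ := lift q hq
  let f : C(S, PuncturedR3) := ⟨fun v => ⟨v, hS' v.2⟩, continuous_subtype_val.subtype_mk _⟩
  have hp'' : p'.map f.continuous = p := Path.ext (funext fun t => Subtype.ext (hp' t))
  have hq'' : q'.map f.continuous = q := Path.ext (funext fun t => Subtype.ext (hq' t))
  rw [← hp'', ← hq'']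
  exact (SimplyConnectedSpace.paths_homotopic p' q').map f

theorem isPathConnected_punctured {S : Set R3} (hS : IsPathConnected S) (hS' : S ⊆ {0}ᶜ) :
    IsPathConnected {v : PuncturedR3 | (v : R3) ∈ S} := by
  have hi : Topology.IsInducing fun v : PuncturedR3 => (v : R3) := .subtypeVal
  rw [hi.isPathConnected_iff]
  convert hS
  ext v
  exact ⟨fun ⟨w, hw, h⟩ => h ▸ hw, fun hv => ⟨⟨v, hS' hv⟩, hv, rfl⟩⟩

theorem isPathConnected_axisComplement : IsPathConnected axisComplement := by
  have : axisComplement = Set.range cylinderCover := by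
    ext v
    exact ⟨exists_cylinderCover_eq, fun ⟨a, h⟩ => h ▸ cylinderCover_mem a⟩
  rw [this]
  exact isPathConnected_range cylinderCover.continuous

instance : SimplyConnectedSpace PuncturedR3 := by
  have hval : Continuous fun v : PuncturedR3 => (v : R3) := continuous_subtype_val
  refine simplyConnectedSpace_of_union (U := {v : PuncturedR3 | (v : R3) ∈ upperRegion})
    (V := {v : PuncturedR3 | (v : R3) ∈ lowerRegion}) (isOpen_upperRegion.preimage hval)
    (isOpen_lowerRegion.preimage hval) ?_ (isPathConnected_punctured ?_ upperRegion_subset)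
    (isPathConnected_punctured ?_ lowerRegion_subset) ?_
    (homotopic_of_starConvex starConvex_upperRegion upperRegion_subset)
    (homotopic_of_starConvex starConvex_lowerRegion lowerRegion_subset)
  · exact Set.eq_univ_of_forall fun v => upperRegion_union_lowerRegion.ge v.2
  · exact starConvex_upperRegion.isPathConnected (Or.inr (by simp))
  · exact starConvex_lowerRegion.isPathConnected (Or.inr (by simp))
  · change IsPathConnected {v : PuncturedR3 | (v : R3) ∈ upperRegion ∩ lowerRegion}
    rw [upperRegion_inter_lowerRegion]
    exact isPathConnected_punctured isPathConnected_axisComplement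
      fun v hv => upperRegion_subset (Or.inl hv)

theorem simplyConnectedSpace_of_retract {X Y : Type*} [TopologicalSpace X] [TopologicalSpace Y]
    [SimplyConnectedSpace X] (i : C(Y, X)) (r : C(X, Y)) (h : r.comp i = ContinuousMap.id Y) :
    SimplyConnectedSpace Y := by
  have hr (y : Y) : r (i y) = y := congrArg (fun f : C(Y, Y) => f y) h
  refine simply_connected_iff_paths_homotopic'.mpr
    ⟨Function.Surjective.pathConnectedSpace (fun y => ⟨i y, hr y⟩) r.continuous, fun {x y} p q => ?_⟩
  have := ((SimplyConnectedSpace.paths_homotopic (p.map i.continuous)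
    (q.map i.continuous)).map r).pathCast (hr x).symm (hr y).symm
  convert this
  · ext t
    exact (hr _).symm
  · ext t
    exact (hr _).symm

instance : SimplyConnectedSpace S2 :=
  simplyConnectedSpace_of_retract sphereInclusion radialProjection
    radialProjection_comp_sphereInclusion

/-! ### Fundamental groups of order two -/

theorem card_fundamentalGroup {E X : Type*} [TopologicalSpace E] [TopologicalSpace X]
    [MulAction ℤˣ E] [SimplyConnectedSpace E] {p : E → X} (hp : IsQuotientCoveringMap p ℤˣ)
    (x : X) : Nat.card (FundamentalGroup X x) = 2 := by
  obtain ⟨e, he⟩ := hp.surjective x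
  rw [Nat.card_congr (hp.fundamentalGroupEquiv ⟨e, he⟩).toEquiv,
    Nat.card_congr MulOpposite.opEquiv.symm, Nat.card_eq_fintype_card, Fintype.card_units_int]

theorem mul_eq_one_of_card_eq_two {P : Type*} [Group P] (h : Nat.card P = 2) {a b : P}
    (ha : a ≠ 1) (hb : b ≠ 1) : a * b = 1 := by
  obtain ⟨y, hy, huniv⟩ := (Nat.card_eq_two_iff' (1 : P)).mp h
  have := huniv a ha
  have := huniv b hb
  subst_vars
  by_contra hne
  have := huniv _ hne
  simp_all

theorem existsUnique_hom_of_card_eq_two {P M : Type*} [Group P] [Group M]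
    (h : Nat.card P = 2) {m : M} (hm : m * m = 1) : ∃! f : P →* M, ∀ a, a ≠ 1 → f a = m := by
  classical
  refine ⟨{ toFun := fun a => if a = 1 then 1 else m
            map_one' := if_pos rfl
            map_mul' := fun a b => ?_ }, fun a ha => if_neg ha, fun f hf => ?_⟩
  · by_cases ha : a = 1
    · simp [ha]
    · by_cases hb : b = 1
      · simp [hb]
      · rw [mul_eq_one_of_card_eq_two h ha hb]
        simp [ha, hb, hm]
  · ext1 a
    by_cases ha : a = 1
    · simp [ha]
    · rw [hf a ha]
      exact (if_neg ha).symm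

/-! ### The action of deck transformations on the coefficients -/

section Twisted

variable {E X G : Type*} [TopologicalSpace E] [TopologicalSpace X] [Group G] [MulAction G E]
  [SimplyConnectedSpace E] {p : E → X}

/-- The isomorphism with the fundamental group sends a non-trivial element to a non-trivial one, and
inversion preserves this. -/
theorem deckRep_apply_of_ne_one (hp : IsQuotientCoveringMap p G) {x : X} (e : p ⁻¹' {x})
    {f : FundamentalGroup X x →* Matrix.GeneralLinearGroup (Fin 3) ℤ}
    (hf : ∀ a, a ≠ 1 → f a = -1) {g : G} (hg : g ≠ 1) (v : Fin 3 → ℤ) :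
    deckRep hp e (latticeRep f) g v = -v := by
  change latticeRep f ((hp.fundamentalGroupEquiv e).symm (MulOpposite.op g⁻¹)) v = -v
  have h : f ((hp.fundamentalGroupEquiv e).symm (MulOpposite.op g⁻¹)) = -1 := by
    refine hf _ fun h => hg ?_
    rw [MulEquiv.symm_apply_eq, map_one] at h
    simpa using h
  change ((f _ : Matrix.GeneralLinearGroup (Fin 3) ℤ) : Matrix (Fin 3) (Fin 3) ℤ).mulVec v = -v
  rw [h, Units.val_neg, Units.val_one, Matrix.neg_mulVec, Matrix.one_mulVec]

end Twisted

/-! ### Cohomology in degree two -/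

theorem QuotientAddGroup.exists_equiv_of_surjective {A B : Type*} [AddCommGroup A] [AddCommGroup B]
    {N : AddSubgroup A} (f : A →+ B) (hf : Function.Surjective f) (hN : ∀ a, a ∈ N ↔ f a = 0) :
    ∃ Φ : A ⧸ N ≃+ B, ∀ a, Φ (QuotientAddGroup.mk a) = f a := by
  obtain rfl : N = f.ker := AddSubgroup.ext hN
  exact ⟨QuotientAddGroup.quotientKerEquivOfSurjective f hf, fun _ => rfl⟩

/-! ### Transport of equivariant cohomology along homeomorphisms -/

section Pullback

variable {G H E F A : Type*} [Group G] [Group H] [TopologicalSpace E] [TopologicalSpace F]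
  [MulAction G E] [MulAction H F] [ContinuousConstSMul G E] [ContinuousConstSMul H F]
  [AddCommGroup A] {τ : Representation ℤ G A} {τ' : Representation ℤ H A}

/-- The pullback of equivariant cochains by a map that respects the group actions. -/
def cochainPullback (f : C(F, E)) (hf : ∀ u : H, ∃ g : G, (∀ v, f (u • v) = g • f v) ∧ τ' u = τ g)
    (n : ℕ) (φ : EquivariantCochain E τ n) : EquivariantCochain F τ' n where
  toLinearMap := φ.toLinearMap ∘ₗ chainMap f n
  isIntertwining' u := LinearMap.ext fun z => by
    obtain ⟨g, hg, hτ⟩ := hf u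
    have h : chainMap f n (singularRep H F n u z) = singularRep G E n g (chainMap f n z) := by
      rw [singularRep_apply, singularRep_apply, chainMap_comp, chainMap_comp]
      congr 2
      ext1 x
      exact hg x
    change φ (chainMap f n (singularRep H F n u z)) = τ' u (φ (chainMap f n z))
    rw [h, φ.isIntertwining, hτ]

theorem coboundary_cochainPullback (f : C(F, E))
    (hf : ∀ u : H, ∃ g : G, (∀ v, f (u • v) = g • f v) ∧ τ' u = τ g) (n : ℕ)
    (φ : EquivariantCochain E τ n) :
    coboundary F τ' n (cochainPullback f hf n φ) =
      cochainPullback f hf (n + 1) (coboundary E τ n φ) := by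
  refine IntertwiningMap.ext (LinearMap.ext fun z => ?_)
  change φ (chainMap f n (singularBoundary F n z)) = φ (singularBoundary E n (chainMap f (n + 1) z))
  rw [chainMap_boundary]

end Pullback

/-- The isomorphism is evaluation on the transported two-cell; pullbacks along `h` and its inverse
reduce kernel and image to the case of `P`. The actions are matched element by element, so no
isomorphism of groups has to be chosen. -/
theorem CellularModel.nonempty_equiv {P : Type*} [TopologicalSpace P] [MulAction ℤˣ P]
    [ContinuousConstSMul ℤˣ P] (S : CellularModel P) {G E A : Type*} [Group G] [TopologicalSpace E]
    [MulAction G E] [ContinuousConstSMul G E] [AddCommGroup A] {τ : Representation ℤ G A}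
    {τ' : Representation ℤ ℤˣ A} (hτ' : ∀ a, τ' (-1) a = -a) (h : P ≃ₜ E)
    (hh : ∀ u : ℤˣ, ∃ g : G, (∀ v, h (u • v) = g • h v) ∧ τ' u = τ g)
    (hh' : ∀ g : G, ∃ u : ℤˣ, (∀ v, h.symm (g • v) = u • h.symm v) ∧ τ g = τ' u) :
    Nonempty (EquivariantCohomology E τ 2 ≃+ A) := by
  let f : C(P, E) := ⟨h, h.continuous⟩
  let f' : C(E, P) := ⟨h.symm, h.symm.continuous⟩
  have hff' : f'.comp f = ContinuousMap.id P := ContinuousMap.ext h.symm_apply_apply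
  have hf'f : f.comp f' = ContinuousMap.id E := ContinuousMap.ext h.apply_symm_apply
  let c : SingularChain E 2 := chainMap f 2 (S.map₂ 1)
  let ev : cocycles E τ 2 →+ A :=
    { toFun := fun φ => φ.1 c
      map_zero' := rfl
      map_add' := fun _ _ => rfl }
  have hco {φ : EquivariantCochain E τ 2} (hφ : φ ∈ cocycles E τ 2) :
      cochainPullback (τ' := τ') f hh 2 φ ∈ cocycles P τ' 2 := by
    rw [AddMonoidHom.mem_ker, coboundary_cochainPullback, AddMonoidHom.mem_ker.mp hφ]
    rfl
  refine ⟨(QuotientAddGroup.exists_equiv_of_surjective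
    (N := (coboundaries E τ 2).addSubgroupOf (cocycles E τ 2)) ev (fun a => ?_)
    fun φ => ?_).choose⟩
  · obtain ⟨φ, hφ, rfl⟩ := S.exists_cocycle hτ' a
    refine ⟨⟨cochainPullback f' hh' 2 φ, ?_⟩, ?_⟩
    · rw [AddMonoidHom.mem_ker, coboundary_cochainPullback, AddMonoidHom.mem_ker.mp hφ]
      rfl
    · change φ (chainMap f' 2 (chainMap f 2 (S.map₂ 1))) = _
      rw [chainMap_comp, hff', chainMap_id]
  · rw [AddSubgroup.mem_addSubgroupOf]
    refine Iff.trans ⟨?_, ?_⟩ (S.mem_coboundaries_iff hτ' (hco φ.2))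
    · rintro ⟨ψ, hψ⟩
      refine ⟨cochainPullback f hh 1 ψ, ?_⟩
      rw [coboundary_cochainPullback, hψ]
    · rintro ⟨ψ, hψ⟩
      refine ⟨cochainPullback f' hh' 1 ψ, ?_⟩
      rw [coboundary_cochainPullback, hψ]
      refine IntertwiningMap.ext (LinearMap.ext fun z => ?_)
      change φ.1 (chainMap f 2 (chainMap f' 2 z)) = φ.1 z
      rw [chainMap_comp, hf'f, chainMap_id]

theorem cellDelta₂_eq_zero {A : Type*} [AddCommGroup A] {τ : Representation ℤ ℤˣ A}
    (hτ : ∀ a, τ (-1) a = -a) : cellDelta₂ τ = 0 := by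
  refine AddMonoidHom.ext fun ψ => cellRep_hom_ext ?_
  change ψ (cellBoundary₂ 1) = 0
  rw [cellBoundary₂_apply, one_mul, map_add, IntertwiningMap.apply_cellT, hτ, add_neg_cancel]

/-- As `δ₂ = 0`, the right-hand quotient is by the zero group, and an equivariant cellular cochain
is determined by its value on `e²₊`. -/
theorem exists_cellular_equiv {A : Type*} [AddCommGroup A] {τ : Representation ℤ ℤˣ A}
    (hτ : ∀ a, τ (-1) a = -a) :
    ∃ Φ : EquivariantCohomology S2 τ 2 ≃+ IntertwiningMap cellRep τ ⧸ (cellDelta₂ τ).range,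
      ∀ z : cocycles S2 τ 2, Φ (QuotientAddGroup.mk z) =
        QuotientAddGroup.mk (adjointMap τ sphereCellMap.toSing₂ z.1) := by
  refine QuotientAddGroup.exists_equiv_of_surjective
    (N := (coboundaries S2 τ 2).addSubgroupOf (cocycles S2 τ 2))
    ((QuotientAddGroup.mk' (cellDelta₂ τ).range).comp
      ((adjointMap τ sphereCellMap.toSing₂).comp (cocycles S2 τ 2).subtype)) ?_ ?_
  · intro y
    obtain ⟨ψ, rfl⟩ := QuotientAddGroup.mk_surjective y
    obtain ⟨φ, hφ, h⟩ := sphereModel.exists_cocycle hτ (ψ 1)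
    exact ⟨⟨φ, hφ⟩, congrArg _ (cellRep_hom_ext h)⟩
  · intro φ
    rw [AddSubgroup.mem_addSubgroupOf]
    refine (sphereModel.mem_coboundaries_iff hτ φ.2).trans ?_
    change _ ↔ QuotientAddGroup.mk (adjointMap τ sphereCellMap.toSing₂ φ.1) = _
    rw [QuotientAddGroup.eq_zero_iff, cellDelta₂_eq_zero hτ]
    constructor
    · exact fun h => ⟨0, (cellRep_hom_ext h).symm⟩
    · rintro ⟨ψ, h⟩
      exact (congrArg (fun f : IntertwiningMap cellRep τ => f 1) h).symm

/-! ### Universal coverings -/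

theorem IsLocalHomeomorph.locallyPathConnectedSpace {E X : Type*} [TopologicalSpace E]
    [TopologicalSpace X] [LocallyPathConnectedSpace X] {p : E → X} (hp : IsLocalHomeomorph p) :
    LocallyPathConnectedSpace E := by
  choose φ hφ _ using hp
  let _ : ChartedSpace X E :=
    { atlas := Set.range φ
      chartAt := φ
      mem_chart_source := hφ
      chart_mem_atlas := Set.mem_range_self }
  exact ChartedSpace.locallyPathConnectedSpace X E

/-- Each covering map lifts through the other with matching base points; the two composites are
lifts that fix a point, hence identities. -/
theorem IsCoveringMap.exists_homeomorph {P E X : Type*} [TopologicalSpace P] [TopologicalSpace E]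
    [TopologicalSpace X] [SimplyConnectedSpace P] [SimplyConnectedSpace E]
    [LocallyPathConnectedSpace X] {q : P → X} {p : E → X} (hq : IsCoveringMap q)
    (hp : IsCoveringMap p) (hp' : Function.Surjective p) :
    ∃ h : P ≃ₜ E, ∀ v, p (h v) = q v := by
  have := hq.isLocalHomeomorph.locallyPathConnectedSpace
  have := hp.isLocalHomeomorph.locallyPathConnectedSpace
  obtain ⟨v₀⟩ : Nonempty P := inferInstance
  obtain ⟨e₀, he₀⟩ := hp' (q v₀)
  obtain ⟨a, ⟨ha₀, ha⟩, -⟩ := hp.existsUnique_continuousMap_lifts ⟨q, hq.continuous⟩ v₀ e₀ he₀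
  obtain ⟨b, ⟨hb₀, hb⟩, -⟩ := hq.existsUnique_continuousMap_lifts ⟨p, hp.continuous⟩ e₀ v₀ he₀.symm
  have hba : b.comp a = ContinuousMap.id P :=
    (hq.existsUnique_continuousMap_lifts ⟨q, hq.continuous⟩ v₀ v₀ rfl).unique
      ⟨by simp [ha₀, hb₀], funext fun v => (congrFun hb (a v)).trans (congrFun ha v)⟩ ⟨rfl, rfl⟩
  have hab : a.comp b = ContinuousMap.id E :=
    (hp.existsUnique_continuousMap_lifts ⟨p, hp.continuous⟩ e₀ e₀ rfl).unique
      ⟨by simp [ha₀, hb₀], funext fun v => (congrFun ha (b v)).trans (congrFun hb v)⟩ ⟨rfl, rfl⟩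
  exact ⟨⟨⟨a, b, fun v => congrArg (fun f : C(P, P) => f v) hba,
    fun v => congrArg (fun f : C(E, E) => f v) hab⟩, a.continuous, b.continuous⟩, congrFun ha⟩

instance : LocallyPathConnectedSpace (RP2 × ℝ) := by
  have : LocallyPathConnectedSpace PuncturedR3 :=
    (isOpen_compl_singleton (x := (0 : R3))).locallyPathConnectedSpace
  exact isQuotientMap_puncturedCover.locallyPathConnectedSpace

theorem nonempty_twistedCohomology_equiv {E G : Type*} [TopologicalSpace E]
    [SimplyConnectedSpace E] [Group G] [MulAction G E] {p : E → RP2 × ℝ}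
    (hp : IsQuotientCoveringMap p G) {x : RP2 × ℝ} (e : p ⁻¹' {x})
    {f : FundamentalGroup (RP2 × ℝ) x →* Matrix.GeneralLinearGroup (Fin 3) ℤ}
    (hf : ∀ a, a ≠ 1 → f a = -1) :
    Nonempty (TwistedCohomology hp e (latticeRep f) 2 ≃+ (Fin 3 → ℤ)) := by
  have := hp.toContinuousConstSMul
  have := hp.isCancelSMul
  obtain ⟨v₀, hv₀⟩ := isQuotientMap_puncturedCover.surjective x
  have hτ' := deckRep_apply_of_ne_one isQuotientCoveringMap_puncturedCover ⟨v₀, hv₀⟩ hf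
    (g := -1) (by decide)
  have hτ {g : G} (hg : g ≠ 1) := LinearMap.ext fun a => (deckRep_apply_of_ne_one hp e hf hg a).trans
    (hτ' a).symm
  obtain ⟨h, hh⟩ := isQuotientCoveringMap_puncturedCover.isCoveringMap.exists_homeomorph
    hp.isCoveringMap hp.surjective
  -- The fibres of the standard covering are pairs of antipodal points, and freeness of the action
  -- on `E` rules out that the point stays fixed.
  have hsymm {g : G} (hg : g ≠ 1) (y : E) : h.symm (g • y) = (-1 : ℤˣ) • h.symm y := by
    have hq : puncturedCover (h.symm (g • y)) = puncturedCover (h.symm y) := by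
      rw [← hh, ← hh, h.apply_symm_apply, h.apply_symm_apply, hp.map_smul]
    obtain ⟨u, hu⟩ := isQuotientCoveringMap_puncturedCover.apply_eq_iff_mem_orbit.mp hq
    rcases Int.units_eq_one_or u with rfl | rfl
    · refine absurd (IsCancelSMul.right_cancel g 1 y ?_) hg
      rw [one_smul]
      exact h.symm.injective (hu.symm.trans (one_smul _ _))
    · exact hu.symm
  obtain ⟨g₀, hg₀, hne⟩ : ∃ g : G, g • h v₀ = h ((-1 : ℤˣ) • v₀) ∧ g ≠ 1 := by
    have hq : p (h ((-1 : ℤˣ) • v₀)) = p (h v₀) := by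
      rw [hh, hh, isQuotientCoveringMap_puncturedCover.map_smul]
    obtain ⟨g, hg⟩ := hp.apply_eq_iff_mem_orbit.mp hq
    refine ⟨g, hg, ?_⟩
    rintro rfl
    refine smul_punctured_ne (by decide : (-1 : ℤˣ) ≠ 1) v₀ (h.injective ?_)
    exact hg.symm.trans (one_smul _ _)
  refine puncturedModel.nonempty_equiv hτ' h (fun u => ?_) fun g => ?_
  · rcases Int.units_eq_one_or u with rfl | rfl
    · exact ⟨1, fun v => by rw [one_smul, one_smul], by rw [map_one, map_one]⟩
    -- `g₀` was chosen at `v₀` only; since every `g ≠ 1` corresponds to `-1` at all points, it works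
    -- for every `v`.
    · refine ⟨g₀, fun v => ?_, (hτ hne).symm⟩
      rw [← h.apply_symm_apply (g₀ • h v), hsymm hne, h.symm_apply_apply]
  · by_cases hg : g = 1
    · subst hg
      exact ⟨1, fun v => by rw [one_smul, one_smul], by rw [map_one, map_one]⟩
    · exact ⟨-1, hsymm hg, hτ hg⟩

end

theorem mainTheorem7 :
    -- `ℝ³ ∖ {0}` is a universal covering of `ℝP² × ℝ`, with group `{1, -1}`
    (SimplyConnectedSpace PuncturedR3 ∧ IsQuotientCoveringMap puncturedCover ℤˣ) ∧
    -- the fundamental group of `ℝP² × ℝ` has order two, and `a ↦ -I` defines a representation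
    (∀ x : RP2 × ℝ, Nat.card (FundamentalGroup (RP2 × ℝ) x) = 2 ∧
      ∃! f : FundamentalGroup (RP2 × ℝ) x →* Matrix.GeneralLinearGroup (Fin 3) ℤ,
        ∀ a, a ≠ 1 → f a = -1) ∧
    -- `H²(ℝP² × ℝ; ℤ³_f) ≅ ℤ³`, computed with any universal covering
    (∀ (E G : Type*) [TopologicalSpace E] [SimplyConnectedSpace E] [Group G] [MulAction G E]
      (p : E → RP2 × ℝ) (hp : IsQuotientCoveringMap p G) (x : RP2 × ℝ) (e : p ⁻¹' {x})
      (f : FundamentalGroup (RP2 × ℝ) x →* Matrix.GeneralLinearGroup (Fin 3) ℤ),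
      (∀ a, a ≠ 1 → f a = -1) →
        Nonempty (TwistedCohomology hp e (latticeRep f) 2 ≃+ (Fin 3 → ℤ))) ∧
    -- the sphere is a universal covering of `ℝP²`; `δ₂ = 0`, and a cellular chain map identifies
    -- `H²(ℝP²; ℤ³_f) ≅ ℤ³` with `Hom(C₂(S²), ℤ³) / im δ₂`
    (∃ (_ : SimplyConnectedSpace S2) (hp : IsQuotientCoveringMap sphereCover ℤˣ)
      (κ : CellChainMap), ∀ (x : RP2) (e : sphereCover ⁻¹' {x})
        (f : FundamentalGroup RP2 x →* Matrix.GeneralLinearGroup (Fin 3) ℤ),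
        (∀ a, a ≠ 1 → f a = -1) →
          cellDelta₂ (deckRep hp e (latticeRep f)) = 0 ∧
          Nonempty (TwistedCohomology hp e (latticeRep f) 2 ≃+ (Fin 3 → ℤ)) ∧
          ∃ Φ : TwistedCohomology hp e (latticeRep f) 2 ≃+
              (Representation.IntertwiningMap cellRep (deckRep hp e (latticeRep f)) ⧸
                (cellDelta₂ (deckRep hp e (latticeRep f))).range),
            ∀ z : cocycles S2 (deckRep hp e (latticeRep f)) 2,
              Φ (QuotientAddGroup.mk z) =
                QuotientAddGroup.mk
                  (adjointMap (deckRep hp e (latticeRep f)) κ.toSing₂ z.1)) := by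
  refine ⟨⟨inferInstance, isQuotientCoveringMap_puncturedCover⟩, fun x => ?_,
    fun E G _ _ _ _ p hp x e f hf => nonempty_twistedCohomology_equiv hp e hf,
    inferInstance, isQuotientCoveringMap_sphereCover, sphereCellMap, fun x e f hf => ?_⟩
  · have h := card_fundamentalGroup isQuotientCoveringMap_puncturedCover x
    exact ⟨h, existsUnique_hom_of_card_eq_two h (by rw [neg_mul_neg, one_mul])⟩
  · have hτ := deckRep_apply_of_ne_one isQuotientCoveringMap_sphereCover e hf (g := -1) (by decide)
    exact ⟨cellDelta₂_eq_zero hτ, sphereModel.nonempty_equiv hτ (Homeomorph.refl S2)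
      (fun u => ⟨u, fun _ => rfl, rfl⟩) fun u => ⟨u, fun _ => rfl, rfl⟩, exists_cellular_equiv hτ⟩
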